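/- **Setting.** Fix $n\in\mathbb N=\{1,2,\dots\}$. Let $\varepsilon_i$, $i\in\mathbb Z$, be i.i.d. random vectors in $\mathbb R^{\tilde d}$, $\mathcal G_i=\sigma(\varepsilon_i,\varepsilon_{i-1},\dots)$, and $X_i=J_i(\varepsilon_i,\varepsilon_{i-1},\dots)\in\mathbb R^d$ with measurable $J_i$ (which may depend on $n$); $Z_i=(X_i,X_{i-1},\dots)$. For any process $Y_i=(Y_{ij})_j=H_i(\varepsilon_i,\varepsilon_{i-1},\dots)$ let $Y_i^{*(i-k)}$ be $Y_i$ with $\varepsilon_{i-k}$ replaced by an independent copy, and $\delta_r^{Y}(k)=\sup_{i\le n}\sup_j\|Y_{ij}-Y_{ij}^{*(i-k)}\|_r$, where $\|W\|_r=\mathbb E[|W|^r]^{1/r}$. Let $\mathcal F$ be a class of measurable $f:(\mathbb R^d)^{\mathbb N_0}\times[0,1]\to\mathbb R$ with $\sup_{f\in\mathcal F}\|f\|_\infty\le M$, $M>0$, each written as $f(z,u)=D_{f,n}(u)\bar f(z,u)$. Put $$\mathbb G_n(f)=\frac1{\sqrt n}\sum_{i=1}^n\{f(Z_i,\tfrac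 in)-\mathbb Ef(Z_i,\tfrac in)\},\quad \|f\|_{2,n}=\Big(\frac1n\sum_{i=1}^n\|f(Z_i,\tfrac in)\|_2^2\Big)^{1/2},$$ $D_n^\infty(u)=\sup_{f\in\mathcal F}|D_{f,n}(u)|$, and let $\mathbb D_n^\infty\ge 0$ satisfy $(\frac1n\sum_{i=1}^nD_n^\infty(\frac in)^2)^{1/2}\le\mathbb D_n^\infty$. Let $\Delta=(\Delta(k))_{k\ge0}$ be a nonnegative decreasing sequence and $\mathbb D_n\ge0$. **Smoothness classes.** For $z\in(\mathbb R^m)^{\mathbb N_0}$ put $|z|_{L,s}=(\sum_{i\ge0}L_i|z_i|_\infty^s)^{1/s}$. A class of functions $g:(\mathbb R^m)^{\mathbb N_0}\times[0,1]\to\mathbb R$ is an $(L,s,R,C)$-class if $L$ is a summable nonnegative sequence, $s\in(0,1]$, $R\ge0$ is measurable in $z$, $C=(C_R,C_{\bar f})\in(0,\infty)^2$, $|g(z,u)-g(z',u)|\le|z-z'|_{L,s}^s[R(z,u)+R(z',u)]$ for all $u$ and all $z,z'$ with $|z-z'|_{L,s}<\infty$, $\sup_u|g(0,u)|\le C_{\bar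 f}$ and $\sup_uR(0,u)\le C_R$. **Compatibility assumption** (Assumption 2). Let $\nu\ge2$. There are a process $X_i^\circ=J_i^\circ(\varepsilon_i,\varepsilon_{i-1},\dots)\in\mathbb R^{d^\circ}$ with measurable $J_i^\circ$, $Z_i^\circ=(X_i^\circ,X_{i-1}^\circ,\dots)$, and functions $\bar\mu^{(\kappa)}_{f,i}$, $\kappa\in\{1,2\}$, with $\bar\mu_{f,i}^{(\kappa)}(Z_{i-1}^\circ,u)=\mathbb E[\bar f(Z_i,u)^\kappa|\mathcal G_{i-1}]^{1/\kappa}$ a.s. for $f\in\mathcal F$, $i=1,\dots,n$, $u\in[0,1]$ (where $\bar f(Z_i,u)\in L^2$). For $\kappa=1,2$, $\{\bar\mu^{(\kappa)}_{f,i}:f\in\mathcal F,1\le i\le n\}$ is an $(L,s,R,C)$-class (same $L,s,R,C$). For some $p\in(1,\infty]$, $C_X>0$ (with $\frac p{p-1}=1$ if $p=\infty$), $$\sup_{1\le i\le n,\,u}\|R(Z_{i-1}^\circ,u)\|_{\nu p}\le C_R,\qquad \sup_{i\le n,\,j}\|X^\circ_{ij}\|_{\frac{\nu sp}{p-1}}\le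 C_X,$$ $$2d^\circ C_R\sum_{j=0}^{k-1}L_j\,\delta^{X^\circ}_{\frac{\nu sp}{p-1}}(k-j-1)^s\le\Delta(k)\ (k\ge0),\qquad \sup_{f\in\mathcal F}\Big(\frac1n\sum_{i=1}^n|D_{f,n}(\tfrac in)|^2\Big)^{1/2}\le\mathbb D_n .$$ Put $C_\Delta=2d^\circ|L|_1C_X^sC_R+C_{\bar f}$, $|L|_1=\sum_{i\ge0}L_i$. **Submultiplicativity assumption** (Assumption 3'). For $q\in\mathbb N$ let $\omega(q)=q^{1/\nu}\log(eq)^{3/2}$, $\mathcal L(q)=\log\log(e^eq)$, $\Phi(q)=q\mathcal L(q)$, $\tilde\beta(q)=\sum_{j\ge q}\Delta(j)\omega(j)\mathcal L(j)$. The sequence $j\mapsto\Delta(j)\omega(j)\mathcal L(j)$, $j\ge1$, is decreasing and summable, and for some $C_{\tilde\beta}>0$ and all $q_1,q_2\in\mathbb N$, $\frac{\tilde\beta(q_1q_2)}{\Phi(q_1q_2)}\le C_{\tilde\beta}\frac{\tilde\beta(q_1)}{\Phi(q_1)}\frac{\tilde\beta(q_2)}{\Phi(q_2)}$. Put $\tilde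 V(f)=\|f\|_{2,n}+\sum_{j\ge1}\min\{\|f\|_{2,n},\mathbb D_n\Delta(j)\omega(j)\}\mathcal L(j)$ and $\tilde q^*(z)=\min\{q\in\mathbb N:\tilde\beta(q)\le\Phi(q)z\}$. **Theorem (Bernstein inequality, non-smooth case).** There are universal constants $c_0^\circ,c_1^\circ>0$ such that in every such setting there are events $B_n^\circ(q)$, not depending on $f\in\mathcal F$, with the following properties. For all $q\in\{1,\dots,n\}$, $f\in\mathcal F$, $x>0$, $$\mathbb P\big(|\mathbb G_n(f)|>x,\,B_n^\circ(q)\big)\le c_0^\circ\exp\Big(-\frac1{c_1^\circ}\frac{x^2}{\tilde V(f)^2+\frac{M\Phi(q)}{\sqrt n}x}\Big),\qquad \mathbb P(B_n^\circ(q)^c)\le[4+C_\Delta C_{\tilde\beta}]\Big(\frac{\sqrt n\,\mathbb D_n^\infty}{M}\frac{\tilde\beta(q)}{\Phi(q)}\Big)^2 .$$ Moreover, if $\mathbb D_n^\infty>0$, then for all $y>0$, with $\tilde q^*=\tilde q^*\big(\frac{M}{\sqrt n\,\mathbb D_n^\infty y}\big)$ (which may exceed $n$), for all $f\in\mathcal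 F$, $x>0$, $$\mathbb P\big(|\mathbb G_n(f)|>x,\,B_n^\circ(\tilde q^*)\big)\le c_0^\circ\exp\Big(-\frac1{c_1^\circ}\frac{x^2}{\tilde V(f)^2+\Phi(\tilde q^*)\frac{Mx}{\sqrt n}}\Big),\qquad \mathbb P(B_n^\circ(\tilde q^*)^c)\le\frac{4+C_\Delta C_{\tilde\beta}}{y^2}.$$ -/

import Mathlib

open MeasureTheory ProbabilityTheory
open scoped ENNReal

namespace EmpProc

/-- Sequences `(z_0, z_1, z_2, …)` in `ℝ^m`; the norm of `Fin m → ℝ` is the maximum norm. -/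
abbrev Seq (m : ℕ) : Type := ℕ → Fin m → ℝ

/-- Real functions `f(z, u)` of a sequence `z` in `ℝ^m` and of a rescaled time `u ∈ [0,1]`. -/
abbrev Fn (m : ℕ) : Type := Seq m → unitInterval → ℝ

section Processes

variable {Ω : Type*} {m d : ℕ}

/-- The whole past `(Y_i, Y_{i-1}, Y_{i-2}, …)` of a process `Y`. -/
def past (Y : ℤ → Ω → Fin m → ℝ) (i : ℤ) (ω : Ω) : Seq m :=
  fun l => Y (i - l) ω

/-- The σ-algebra `𝒢_i = σ(ε_i, ε_{i-1}, …)`. -/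
abbrev pastSigma (ε : ℤ → Ω → Fin m → ℝ) (i : ℤ) : MeasurableSpace Ω :=
  MeasurableSpace.comap (past ε i) inferInstance

/-- The process `X_i = J_i(ε_i, ε_{i-1}, …)`. -/
def bernoulliShift (J : ℤ → Seq m → Fin d → ℝ) (ε : ℤ → Ω → Fin m → ℝ)
    (i : ℤ) (ω : Ω) : Fin d → ℝ :=
  J i (past ε i ω)

/-- The past of the innovations at time `i` with `ε_{i-k}` replaced by an independent copy.
The copy lives on the second factor of `Ω × Ω`, the original innovations on the first. -/
def coupledPast (ε : ℤ → Ω → Fin m → ℝ) (i : ℤ) (k : ℕ) (w : Ω × Ω) : Seq m :=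
  fun l => if l = k then ε (i - l) w.2 else ε (i - l) w.1

/-- The uniform functional dependence measure
`δ_r^X(k) = sup_{i ≤ n} sup_j ‖X_{ij} - X_{ij}^{*(i-k)}‖_r` of `X_i = J_i(ε_i, ε_{i-1}, …)`. -/
noncomputable def dependence [MeasurableSpace Ω] (P : Measure Ω) (ε : ℤ → Ω → Fin m → ℝ)
    (J : ℤ → Seq m → Fin d → ℝ) (n : ℕ) (r : ℝ≥0∞) (k : ℕ) : ℝ≥0∞ :=
  ⨆ (i : ℤ) (_ : i ≤ (n : ℤ)) (j : Fin d),
    eLpNorm (fun w : Ω × Ω => J i (past ε i w.1) j - J i (coupledPast ε i k w) j) r (P.prod P)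

/-- `ε_i`, `i ∈ ℤ`, are independent and identically distributed random vectors. -/
structure IsInnovation [MeasurableSpace Ω] (P : Measure Ω) (ε : ℤ → Ω → Fin m → ℝ) : Prop where
  measurable : ∀ i, Measurable (ε i)
  indep : iIndepFun ε P
  ident : ∀ i, IdentDistrib (ε i) (ε 0) P P

/-- The point `i / n` of `[0,1]`, for `1 ≤ i ≤ n`. -/
noncomputable def gridPoint (n i : ℕ) : unitInterval :=
  Set.projIcc (0 : ℝ) 1 zero_le_one ((i : ℝ) / n)

/-- `𝔾_n(f) = n^{-1/2} ∑_{i=1}^n (f(Z_i, i/n) - 𝔼 f(Z_i, i/n))` with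
`Z_i = (X_i, X_{i-1}, …)`. -/
noncomputable def bbG [MeasurableSpace Ω] (P : Measure Ω) (X : ℤ → Ω → Fin d → ℝ) (n : ℕ)
    (f : Fn d) (ω : Ω) : ℝ :=
  1 / Real.sqrt n * ∑ i ∈ Finset.Icc 1 n,
    (f (past X i ω) (gridPoint n i) - ∫ ω', f (past X i ω') (gridPoint n i) ∂P)

/-- `‖f‖_{2,n} = (n^{-1} ∑_{i=1}^n ‖f(Z_i, i/n)‖_2^2)^{1/2}`. -/
noncomputable def norm2n [MeasurableSpace Ω] (P : Measure Ω) (X : ℤ → Ω → Fin d → ℝ) (n : ℕ)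
    (f : Fn d) : ℝ :=
  Real.sqrt (1 / (n : ℝ) * ∑ i ∈ Finset.Icc 1 n,
    ∫ ω, f (past X i ω) (gridPoint n i) ^ 2 ∂P)

end Processes

/-- `ω(q) = q^{1/ν} log(e q)^{3/2}`. -/
noncomputable def omegaFactor (ν : ℝ) (q : ℕ) : ℝ :=
  (q : ℝ) ^ (1 / ν) * Real.log (Real.exp 1 * q) ^ (3 / 2 : ℝ)

/-- `ℒ(q) = log log(e^e q)`. -/
noncomputable def logLog (q : ℕ) : ℝ :=
  Real.log (Real.log (Real.exp (Real.exp 1) * q))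

/-- `Φ(q) = q ℒ(q)`. -/
noncomputable def Phi (q : ℕ) : ℝ := q * logLog q

/-- `β̃(q) = ∑_{j ≥ q} Δ(j) ω(j) ℒ(j)`. -/
noncomputable def betaTilde (ν : ℝ) (Δ : ℕ → ℝ) (q : ℕ) : ℝ :=
  ∑' j : ℕ, Δ (q + j) * omegaFactor ν (q + j) * logLog (q + j)

/-- `Ṽ(f) = ‖f‖_{2,n} + ∑_{j ≥ 1} min{‖f‖_{2,n}, 𝔻_n Δ(j) ω(j)} ℒ(j)`, as a function of the
value `a = ‖f‖_{2,n}`. -/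
noncomputable def VTilde (ν : ℝ) (Δ : ℕ → ℝ) (Dn : ℝ) (a : ℝ) : ℝ :=
  a + ∑' j : ℕ, min a (Dn * Δ (j + 1) * omegaFactor ν (j + 1)) * logLog (j + 1)

/-- `q̃*(z) = min{q ≥ 1 : β̃(q) ≤ Φ(q) z}`. -/
noncomputable def qStar (ν : ℝ) (Δ : ℕ → ℝ) (z : ℝ) : ℕ :=
  sInf {q : ℕ | 1 ≤ q ∧ betaTilde ν Δ q ≤ Phi q * z}

/-- `|z|_{χ,s} = (∑_i χ_i |z_i|_∞^s)^{1/s}`, possibly infinite. -/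
noncomputable def weightedNorm {m : ℕ} (χ : ℕ → ℝ) (s : ℝ) (z : Seq m) : ℝ≥0∞ :=
  (∑' i : ℕ, ENNReal.ofReal (χ i) * ENNReal.ofReal (‖z i‖ ^ s)) ^ (1 / s)

/-- `A` is an `(L, s, R, (C_R, C_f))`-class: its elements satisfy
`|g(z,u) - g(z',u)| ≤ |z - z'|_{L,s}^s (R(z,u) + R(z',u))` (no condition where
`|z - z'|_{L,s} = ∞`), `|g(0,u)| ≤ C_f` and `R(0,u) ≤ C_R`. -/
structure IsSmoothClass {m : ℕ} (A : Set (Fn m)) (L : ℕ → ℝ) (s : ℝ) (R : Fn m)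
    (CR Cf : ℝ) : Prop where
  L_nonneg : ∀ i, 0 ≤ L i
  L_summable : Summable L
  s_pos : 0 < s
  s_le_one : s ≤ 1
  R_nonneg : ∀ z u, 0 ≤ R z u
  R_measurable : ∀ u, Measurable fun z => R z u
  CR_pos : 0 < CR
  Cf_pos : 0 < Cf
  holder : ∀ g ∈ A, ∀ u z z', weightedNorm L s (z - z') ≠ ⊤ →
    |g z u - g z' u| ≤ (weightedNorm L s (z - z')).toReal ^ s * (R z u + R z' u)
  zero_le : ∀ g ∈ A, ∀ u, |g 0 u| ≤ Cf
  R_zero_le : ∀ u, R 0 u ≤ CR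

/-- `F` is a class of measurable functions bounded by `M`, and each `f ∈ F` is written as
`f(z,u) = D_f(u) · f̄(z,u)`. -/
structure IsFunctionClass {d : ℕ} (F : Set (Fn d)) (D : Fn d → unitInterval → ℝ)
    (fbar : Fn d → Fn d) (M : ℝ) : Prop where
  measurable : ∀ f ∈ F, Measurable (Function.uncurry f)
  decomp : ∀ f ∈ F, ∀ z u, f z u = D f u * fbar f z u
  bounded : ∀ f ∈ F, ∀ z u, |f z u| ≤ M

/-- `sup_{f ∈ F} (n^{-1} ∑_{i=1}^n |D_f(i/n)|^2)^{1/2} ≤ 𝔻_n`. -/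
def WeightBound {d : ℕ} (F : Set (Fn d)) (D : Fn d → unitInterval → ℝ) (n : ℕ) (Dn : ℝ) : Prop :=
  ∀ f ∈ F, Real.sqrt (1 / (n : ℝ) * ∑ i ∈ Finset.Icc 1 n, |D f (gridPoint n i)| ^ 2) ≤ Dn

/-- `(n^{-1} ∑_{i=1}^n D_n^∞(i/n)^2)^{1/2} ≤ 𝔻_n^∞` with `D_n^∞(u) = sup_{f ∈ F} |D_f(u)|`. -/
def EnvelopeWeightBound {d : ℕ} (F : Set (Fn d)) (D : Fn d → unitInterval → ℝ) (n : ℕ)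
    (Dinf : ℝ) : Prop :=
  ((n : ℝ≥0∞)⁻¹ * ∑ i ∈ Finset.Icc 1 n,
    (⨆ f ∈ F, ENNReal.ofReal |D f (gridPoint n i)|) ^ 2) ^ (1 / 2 : ℝ) ≤ ENNReal.ofReal Dinf

/-- The exponent `ν s p / (p - 1)`, with `p / (p - 1) = 1` for `p = ∞`. -/
noncomputable def momentExp (ν s : ℝ) (p : ℝ≥0∞) : ℝ≥0∞ :=
  ENNReal.ofReal (ν * s) * (1 - p⁻¹)⁻¹

/-- Compatibility condition for a class of possibly non-smooth functions. The auxiliary process is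
`X°_i = J°_i(ε_i, ε_{i-1}, …)` with values in `ℝ^dO`, and `Z°_i = (X°_i, X°_{i-1}, …)`;
`mu κ f i` is the function `μ̄_{f,i}^{(κ)}`. -/
structure Compatibility {Ω : Type*} [MeasurableSpace Ω] (P : Measure Ω) {dt d : ℕ}
    (ε : ℤ → Ω → Fin dt → ℝ) (X : ℤ → Ω → Fin d → ℝ) (n : ℕ) (F : Set (Fn d))
    (D : Fn d → unitInterval → ℝ) (fbar : Fn d → Fn d) (ν : ℝ) (Δ : ℕ → ℝ) (Dn : ℝ)
    {dO : ℕ} (JO : ℤ → Seq dt → Fin dO → ℝ) (mu : ℕ → Fn d → ℕ → Fn dO)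
    (L : ℕ → ℝ) (s : ℝ) (R : Fn dO) (CR Cf : ℝ) (p : ℝ≥0∞) (CX : ℝ) : Prop where
  two_le_nu : 2 ≤ ν
  JO_measurable : ∀ i, Measurable (JO i)
  fbar_memLp : ∀ f ∈ F, ∀ i ∈ Finset.Icc 1 n, ∀ u,
    MemLp (fun ω => fbar f (past X i ω) u) 2 P
  mu_eq : ∀ κ ∈ ({1, 2} : Finset ℕ), ∀ f ∈ F, ∀ i ∈ Finset.Icc 1 n, ∀ u,
    (fun ω => mu κ f i (past (bernoulliShift JO ε) ((i : ℤ) - 1) ω) u) =ᵐ[P]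
      fun ω => (P[fun ω' => fbar f (past X i ω') u ^ κ | pastSigma ε ((i : ℤ) - 1)] ω)
        ^ (1 / (κ : ℝ))
  smooth : ∀ κ ∈ ({1, 2} : Finset ℕ),
    IsSmoothClass {g | ∃ f ∈ F, ∃ i ∈ Finset.Icc 1 n, g = mu κ f i} L s R CR Cf
  one_lt_p : 1 < p
  CX_pos : 0 < CX
  R_moment : ∀ i ∈ Finset.Icc 1 n, ∀ u,
    eLpNorm (fun ω => R (past (bernoulliShift JO ε) ((i : ℤ) - 1) ω) u) (ENNReal.ofReal ν * p) P
      ≤ ENNReal.ofReal CR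
  X_moment : ∀ i : ℤ, i ≤ n → ∀ j,
    eLpNorm (fun ω => bernoulliShift JO ε i ω j) (momentExp ν s p) P ≤ ENNReal.ofReal CX
  decay : ∀ k : ℕ,
    ENNReal.ofReal (2 * dO * CR) * ∑ j ∈ Finset.range k,
      ENNReal.ofReal (L j) * dependence P ε JO n (momentExp ν s p) (k - j - 1) ^ s
      ≤ ENNReal.ofReal (Δ k)
  weight : WeightBound F D n Dn

/-- `j ↦ Δ(j) ω(j) ℒ(j)`, `j ≥ 1`, is decreasing and summable, and `β̃ / Φ` is
submultiplicative up to the constant `C_β̃`. -/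
structure Submultiplicative (ν : ℝ) (Δ : ℕ → ℝ) (Cβ : ℝ) : Prop where
  summable : Summable fun j : ℕ => Δ (j + 1) * omegaFactor ν (j + 1) * logLog (j + 1)
  decreasing : ∀ j k : ℕ, 1 ≤ j → j ≤ k →
    Δ k * omegaFactor ν k * logLog k ≤ Δ j * omegaFactor ν j * logLog j
  const_pos : 0 < Cβ
  submul : ∀ q₁ q₂ : ℕ, 1 ≤ q₁ → 1 ≤ q₂ →
    betaTilde ν Δ (q₁ * q₂) / Phi (q₁ * q₂)
      ≤ Cβ * (betaTilde ν Δ q₁ / Phi q₁) * (betaTilde ν Δ q₂ / Phi q₂)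

/-- `C_Δ = 2 d° |L|_1 C_X^s C_R + C_f`. -/
noncomputable def CDelta (dO : ℕ) (L : ℕ → ℝ) (s CX CR Cf : ℝ) : ℝ :=
  2 * dO * (∑' i, L i) * CX ^ s * CR + Cf

end EmpProc

/-!
Write `W_i = f(Z_i, i/n)`, `h_i = E[W_i | 𝒢_{i-1}]`, and `ℋ_m = σ(ε_m, ε_{m+1}, …)`. The centred sum
is split into three parts:

* `∑ (W_i - h_i)`, a martingale;
* `∑ (E[h_i | ℋ_{i-q}] - E h_i)`, a sum of `q`-dependent variables;
* `∑ (h_i - E[h_i | ℋ_{i-q}])`, the long-range part of the conditional means.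

Each part has exponential moments of Gaussian type for parameters `|l| ≤ 1 / (4 M q)`, the first and
the third one only on the event `bernsteinEvent`, and the exponential Markov inequality concludes
(`IsDominated.measureReal_abs_sum_le`).

The functions `f` need not be smooth, but `h_i` and `g_i = E[W_i² | 𝒢_{i-1}]` are Hölder functions
of the past of the auxiliary process. Hence the increment `E[h_i | ℋ_m] - E[h_i | ℋ_{m+1}]`, which
measures the effect of resampling `ε_m` (`abs_condExp_sub_le`), is bounded by `|D_f(i/n)|` times a
variable that does not depend on `f` and whose `L²` norm is at most `Δ(i - m)`
(`eLpNorm_couplingBound_le`); similarly for `g_i`, with `D_f²` and in `L¹`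
(`eLpNorm_couplingBoundSq_le`). Replacing `|D_f|` by the envelope `D_n^∞` yields bounds that are
uniform over the class, and the good event requires the sum of the squares of the former and the sum
of the latter to be small. Its complement is controlled by Markov's inequality
(`IsEnvelope.measureReal_compl_goodEvent_le`).

For the long-range part, the increments over `m` form a reversed martingale. From
`exp(x - x²) ≤ 1 + x + x²` one obtains a supermartingale with random compensators that are bounded
on the good event (`IsDominated.setIntegral_exp_tail_le`).

For the martingale part, the compensator is `∑ g_i`. On the good event it differs from the sum of
the finite-range variables `E[g_i | ℋ_{i-q²}]` by at most `(2 M q)²`, and the latter sum is treated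
by blocks of length `q²`, which are independent if they have equal parity. The range `q²` is
affordable because `g_i ≤ M²` has to be compared with `l² ≤ 1 / (4 M q)²`. By the
submultiplicativity of `β̃ / Φ`, with `q₁ = q₂ = q`, the error at range `q²` is of the order of the
square of the error at range `q` (`IsDominated.setIntegral_exp_martingale_le`,
`measureReal_compl_bernsteinEvent_le`).

For the finite-range part, blocks of length `q` are used. The variance of a block sum is estimated
by decomposing `E[h_i | ℋ_{i-q}] - E h_i` into increments of lag `k < q`. Increments of equal lag
are orthogonal for different `i`, and the root mean square of their `L²` norms over `i` is bounded
both by `‖f‖_{2,n}` and by `𝔻_n Δ(k + 1)` (`IsDominated.integral_exp_finiteRange_le`). The factors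
`ω` and `ℒ` enter only through `ω ≥ 1`, `ℒ ≥ 1` and the monotonicity of `ℒ`.

The functions `μ̄` are not assumed to be measurable. Measurability is needed to transfer the Hölder
bounds to the coupled past, and it follows from the Hölder condition with measurable `R` on the
sequences of finite weighted norm (`measurable_indicator_of_holder`).
-/

namespace EmpProc

/-! ### σ-algebras generated by sets of innovations -/

section Sigma

variable {Ω : Type*} {dt : ℕ}

/-- The σ-algebra `σ(ε_k : k ∈ S)`. -/
abbrev sig (ε : ℤ → Ω → Fin dt → ℝ) (S : Set ℤ) : MeasurableSpace Ω :=
  ⨆ k ∈ S, MeasurableSpace.comap (ε k) inferInstance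

lemma sig_mono (ε : ℤ → Ω → Fin dt → ℝ) {S T : Set ℤ} (h : S ⊆ T) : sig ε S ≤ sig ε T :=
  biSup_mono h

lemma sig_le [m0 : MeasurableSpace Ω] {ε : ℤ → Ω → Fin dt → ℝ} (hε : ∀ k, Measurable (ε k))
    (S : Set ℤ) : sig ε S ≤ m0 :=
  iSup₂_le fun k _ => (hε k).comap_le

lemma sig_union (ε : ℤ → Ω → Fin dt → ℝ) (S T : Set ℤ) :
    sig ε (S ∪ T) = sig ε S ⊔ sig ε T := by
  simp only [sig, Set.mem_union, iSup_or, iSup_sup_eq]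

lemma measurable_sig (ε : ℤ → Ω → Fin dt → ℝ) {S : Set ℤ} {k : ℤ} (hk : k ∈ S) :
    Measurable[sig ε S] (ε k) := by
  have h : MeasurableSpace.comap (ε k) inferInstance ≤ sig ε S :=
    le_iSup₂_of_le (f := fun k (_ : k ∈ S) => MeasurableSpace.comap (ε k) inferInstance)
      k hk le_rfl
  exact (comap_measurable (ε k)).mono h le_rfl

lemma measurable_past_sig (ε : ℤ → Ω → Fin dt → ℝ) (i : ℤ) :
    Measurable[sig ε (Set.Iic i)] (past ε i) := by
  refine @measurable_pi_lambda _ _ _ (sig ε (Set.Iic i)) _ _ fun l => ?_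
  exact measurable_sig ε (by simp)

lemma pastSigma_eq_sig (ε : ℤ → Ω → Fin dt → ℝ) (i : ℤ) :
    pastSigma ε i = sig ε (Set.Iic i) := by
  refine le_antisymm (measurable_past_sig ε i).comap_le (iSup₂_le fun k hk => ?_)
  have hk' : k ≤ i := hk
  have h : ε k = (fun z : Seq dt => z (i - k).toNat) ∘ past ε i := by
    funext ω
    simp only [Function.comp, past]
    congr 1
    omega
  have hm : Measurable[pastSigma ε i] (ε k) := by
    rw [h]
    exact (measurable_pi_apply _).comp (comap_measurable _)
  exact hm.comap_le

lemma indep_sig [MeasurableSpace Ω] {P : Measure Ω} {ε : ℤ → Ω → Fin dt → ℝ}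
    (hε : IsInnovation P ε) {S T : Set ℤ} (h : Disjoint S T) :
    Indep (sig ε S) (sig ε T) P :=
  indep_iSup_of_disjoint (fun k => (hε.measurable k).comap_le) hε.indep h

/-- Enlarging the conditioning σ-algebra by independent information does not change a
conditional expectation. -/
lemma condExp_sup_of_indep {m₁ mS m₃ m0 : MeasurableSpace Ω} {P : Measure Ω}
    [IsProbabilityMeasure P] (h1S : m₁ ≤ mS) (hS : mS ≤ m0) (h3 : m₃ ≤ m0)
    (hind : Indep mS m₃ P) {X : Ω → ℝ} (hX : StronglyMeasurable[mS] X) (hXi : Integrable X P) :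
    P[X | m₁ ⊔ m₃] =ᵐ[P] P[X | m₁] := by
  have h1 : m₁ ≤ m0 := h1S.trans hS
  have hle : m₁ ⊔ m₃ ≤ m0 := sup_le h1 h3
  -- both sides integrate to the same value over `a ∩ b`, `a ∈ m₁`, `b ∈ m₃`
  have key : ∀ Y : Ω → ℝ, StronglyMeasurable[mS] Y → Integrable Y P → ∀ a b : Set Ω,
      MeasurableSet[m₁] a → MeasurableSet[m₃] b →
      ∫ ω in a ∩ b, Y ω ∂P = P.real b * ∫ ω in a, Y ω ∂P := by
    intro Y hY hYi a b ha hb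
    have ha0 : MeasurableSet a := h1 _ ha
    have hb0 : MeasurableSet b := h3 _ hb
    have hm : StronglyMeasurable[mS] (a.indicator Y) := hY.indicator (h1S _ ha)
    have hc := condExp_indep_eq hS h3 hm hind
    have h4 : ∫ ω in b, a.indicator Y ω ∂P = ∫ ω in b, (∫ ω', a.indicator Y ω' ∂P) ∂P := by
      rw [← setIntegral_condExp h3 (hYi.indicator ha0) hb]
      exact setIntegral_congr_ae hb0 (hc.mono fun ω hω _ => hω)
    rw [setIntegral_indicator ha0, integral_indicator ha0, setIntegral_const, smul_eq_mul,
      Set.inter_comm] at h4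
    exact h4
  symm
  refine ae_eq_condExp_of_forall_setIntegral_eq hle hXi
    (fun s _ _ => integrable_condExp.integrableOn) ?_
    ⟨_, stronglyMeasurable_condExp.mono le_sup_left, ae_eq_refl _⟩
  have hgen : m₁ ⊔ m₃ = MeasurableSpace.generateFrom
      (Set.image2 (· ∩ ·) {a | MeasurableSet[m₁] a} {b | MeasurableSet[m₃] b}) := by
    refine le_antisymm (sup_le (fun a ha => ?_) (fun b hb => ?_)) ?_
    · exact MeasurableSpace.measurableSet_generateFrom
        ⟨a, ha, Set.univ, MeasurableSet.univ, Set.inter_univ a⟩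
    · exact MeasurableSpace.measurableSet_generateFrom
        ⟨Set.univ, MeasurableSet.univ, b, hb, Set.univ_inter b⟩
    · refine MeasurableSpace.generateFrom_le ?_
      rintro _ ⟨a, ha, b, hb, rfl⟩
      exact MeasurableSet.inter (le_sup_left (a := m₁) (b := m₃) _ ha)
        (le_sup_right (a := m₁) (b := m₃) _ hb)
  have hpi : IsPiSystem (Set.image2 (· ∩ ·) {a | MeasurableSet[m₁] a}
      {b | MeasurableSet[m₃] b}) := by
    rintro _ ⟨a, ha, b, hb, rfl⟩ _ ⟨a', ha', b', hb', rfl⟩ _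
    exact ⟨a ∩ a', MeasurableSet.inter ha ha', b ∩ b', MeasurableSet.inter hb hb',
      Set.inter_inter_inter_comm _ _ _ _⟩
  intro s hs _
  induction s, hs using MeasurableSpace.induction_on_inter hgen hpi with
  | empty => simp
  | basic t ht =>
    obtain ⟨a, ha, b, hb, rfl⟩ := ht
    have e1 := key _ (stronglyMeasurable_condExp.mono h1S : StronglyMeasurable[mS] (P[X | m₁]))
      integrable_condExp a b ha hb
    have e2 := key X hX hXi a b ha hb
    rw [setIntegral_condExp h1 hXi ha] at e1
    exact e1.trans e2.symm
  | compl t ht ih =>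
    have e1 := integral_add_compl (hle _ ht) (integrable_condExp (m := m₁) (μ := P) (f := X))
    have e2 := integral_add_compl (hle _ ht) hXi
    rw [integral_condExp h1] at e1
    have := ih (measure_lt_top _ _)
    linarith
  | iUnion t hd ht ih =>
    rw [integral_iUnion (fun i => hle _ (ht i)) hd integrable_condExp.integrableOn,
      integral_iUnion (fun i => hle _ (ht i)) hd hXi.integrableOn]
    exact tsum_congr fun i => ih i (measure_lt_top _ _)

/-- The conditional expectation of a function of `(ε_k)_{k ∈ S}` given `(ε_k)_{k ∈ T}` only uses
the common innovations. -/
lemma condExp_sig_inter [MeasurableSpace Ω] {P : Measure Ω} [IsProbabilityMeasure P]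
    {ε : ℤ → Ω → Fin dt → ℝ} (hε : IsInnovation P ε) (S T : Set ℤ) {X : Ω → ℝ}
    (hX : StronglyMeasurable[sig ε S] X) (hXi : Integrable X P) :
    P[X | sig ε T] =ᵐ[P] P[X | sig ε (S ∩ T)] := by
  have h := condExp_sup_of_indep (m₁ := sig ε (S ∩ T)) (m₃ := sig ε (T \ S))
    (sig_mono ε Set.inter_subset_left) (sig_le hε.measurable S) (sig_le hε.measurable _)
    (indep_sig hε Set.disjoint_sdiff_right) hX hXi
  rwa [← sig_union, Set.inter_comm S T, Set.inter_union_sdiff, Set.inter_comm T S] at h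

end Sigma

/-! ### Resampling one innovation -/

section Coupling

variable {Ω : Type*} {dt : ℕ}

lemma measurable_past [MeasurableSpace Ω] {ε : ℤ → Ω → Fin dt → ℝ} (hε : ∀ k, Measurable (ε k))
    (i : ℤ) : Measurable (past ε i) :=
  measurable_pi_lambda _ fun _ => hε _

lemma measurable_coupledPast [MeasurableSpace Ω] {ε : ℤ → Ω → Fin dt → ℝ}
    (hε : ∀ k, Measurable (ε k)) (i : ℤ) (k : ℕ) : Measurable (coupledPast ε i k) := by
  refine measurable_pi_lambda _ fun l => ?_
  by_cases h : l = k
  · simp only [coupledPast, h, if_true]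
    exact (hε _).comp measurable_snd
  · simp only [coupledPast, h, if_false]
    exact (hε _).comp measurable_fst

/-- The past with its `k`-th entry removed, as a function of the remaining innovations. -/
def erasedPast (ε : ℤ → Ω → Fin dt → ℝ) (i : ℤ) (k : ℕ) (ω : Ω) : Seq dt :=
  Function.update (past ε i ω) k 0

lemma measurable_erasedPast (ε : ℤ → Ω → Fin dt → ℝ) (i : ℤ) (k : ℕ) :
    Measurable[sig ε {i - k}ᶜ] (erasedPast ε i k) := by
  refine @measurable_pi_lambda _ _ _ (sig ε {i - k}ᶜ) _ _ fun l => ?_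
  by_cases h : l = k
  · simp only [erasedPast, h, Function.update_self]
    exact @measurable_const _ _ _ (sig ε {i - k}ᶜ) _
  · simp only [erasedPast, Function.update_of_ne h, past]
    exact measurable_sig ε (by simpa using h)

lemma past_eq_update (ε : ℤ → Ω → Fin dt → ℝ) (i : ℤ) (k : ℕ) (ω : Ω) :
    past ε i ω = Function.update (erasedPast ε i k ω) k (ε (i - k) ω) := by
  simp only [erasedPast, Function.update_idem]
  exact (Function.update_eq_self k (past ε i ω)).symm

lemma coupledPast_eq_update (ε : ℤ → Ω → Fin dt → ℝ) (i : ℤ) (k : ℕ) (w : Ω × Ω) :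
    coupledPast ε i k w = Function.update (erasedPast ε i k w.1) k (ε (i - k) w.2) := by
  funext l
  by_cases h : l = k
  · subst h; simp [coupledPast]
  · simp [coupledPast, erasedPast, past, h]

/-- A function of `ε_{i-k}` and of something independent of it has the same law when `ε_{i-k}` is
replaced by its independent copy. -/
lemma map_pair_eq_map_prod [MeasurableSpace Ω] {P : Measure Ω} [IsProbabilityMeasure P]
    {ε : ℤ → Ω → Fin dt → ℝ} (hε : IsInnovation P ε) (m : ℤ) {γ : Type*} [MeasurableSpace γ]
    {A : Ω → γ} (hA : Measurable[sig ε {m}ᶜ] A) :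
    P.map (fun ω => (A ω, ε m ω)) = (P.prod P).map (fun w : Ω × Ω => (A w.1, ε m w.2)) := by
  have hA' : Measurable A := hA.mono (sig_le hε.measurable _) le_rfl
  have hind : IndepFun A (ε m) P := by
    have h := indep_sig hε (S := {m}ᶜ) (T := {m}) disjoint_compl_left
    exact indep_of_indep_of_le_left (indep_of_indep_of_le_right h
      (measurable_sig ε (Set.mem_singleton m)).comap_le) hA.comap_le
  rw [(indepFun_iff_map_prod_eq_prod_map_map hA'.aemeasurable
    (hε.measurable m).aemeasurable).1 hind]
  exact (Measure.map_prod_map P P hA' (hε.measurable m))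

lemma measurable_update_pair (k : ℕ) :
    Measurable fun p : Seq dt × (Fin dt → ℝ) => (Function.update p.1 k p.2 : Seq dt) := by
  refine measurable_pi_lambda _ fun l => ?_
  by_cases h : l = k
  · subst h
    simpa using measurable_snd
  · simp only [Function.update_of_ne h]
    exact (measurable_pi_apply l).comp measurable_fst

lemma map_coupledPast [MeasurableSpace Ω] {P : Measure Ω} [IsProbabilityMeasure P]
    {ε : ℤ → Ω → Fin dt → ℝ} (hε : IsInnovation P ε) (i : ℤ) (k : ℕ) :
    (P.prod P).map (coupledPast ε i k) = P.map (past ε i) := by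
  have hA := measurable_erasedPast ε i k
  have hA' : Measurable (erasedPast ε i k) := hA.mono (sig_le hε.measurable _) le_rfl
  have h1 : past ε i = (fun p : Seq dt × (Fin dt → ℝ) => (Function.update p.1 k p.2 : Seq dt)) ∘
      fun ω => (erasedPast ε i k ω, ε (i - k) ω) := funext (past_eq_update ε i k)
  have h2 : coupledPast ε i k =
      (fun p : Seq dt × (Fin dt → ℝ) => (Function.update p.1 k p.2 : Seq dt)) ∘
      fun w : Ω × Ω => (erasedPast ε i k w.1, ε (i - k) w.2) :=
    funext (coupledPast_eq_update ε i k)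
  have h3 : Measurable fun w : Ω × Ω => (erasedPast ε i k w.1, ε (i - k) w.2) :=
    (hA'.comp measurable_fst).prodMk ((hε.measurable _).comp measurable_snd)
  rw [h1, h2, ← Measure.map_map (measurable_update_pair k) (hA'.prodMk (hε.measurable _)),
    ← Measure.map_map (measurable_update_pair k) h3, map_pair_eq_map_prod hε (i - k) hA]

/-- Conditioning on all innovations but `ε_{i-k}` is integrating out `ε_{i-k}`. -/
lemma condExp_compl_singleton [MeasurableSpace Ω] {P : Measure Ω} [IsProbabilityMeasure P]
    {ε : ℤ → Ω → Fin dt → ℝ} (hε : IsInnovation P ε) (i : ℤ) (k : ℕ) {H : Seq dt → ℝ}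
    (hH : Measurable H) (hi : Integrable (fun ω => H (past ε i ω)) P) :
    (fun ω => ∫ ω', H (coupledPast ε i k (ω, ω')) ∂P)
      =ᵐ[P] P[fun ω => H (past ε i ω) | sig ε {i - k}ᶜ] := by
  have hA := measurable_erasedPast ε i k
  have hle := sig_le hε.measurable {i - (k : ℤ)}ᶜ
  have hci : Integrable (fun w : Ω × Ω => H (coupledPast ε i k w)) (P.prod P) := by
    have h1 : Integrable H (P.map (past ε i)) :=
      (integrable_map_measure hH.aestronglyMeasurable
        (measurable_past hε.measurable i).aemeasurable).2 hi
    rw [← map_coupledPast hε i k] at h1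
    exact (integrable_map_measure hH.aestronglyMeasurable
        (measurable_coupledPast hε.measurable i k).aemeasurable).1 h1
  refine ae_eq_condExp_of_forall_setIntegral_eq hle hi
    (fun s _ _ => hci.integral_prod_left.integrableOn) ?_ ?_
  · intro s hs _
    have hs0 := hle _ hs
    let G : (ℝ × Seq dt) × (Fin dt → ℝ) → ℝ := fun p => p.1.1 * H (Function.update p.1.2 k p.2)
    have hG : Measurable G := (measurable_fst.comp measurable_fst).mul (hH.comp
      ((measurable_update_pair k).comp ((measurable_snd.comp measurable_fst).prodMk
        measurable_snd)))
    let A : Ω → ℝ × Seq dt := fun ω => (s.indicator (fun _ => 1) ω, erasedPast ε i k ω)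
    have hAm : Measurable[sig ε {i - (k : ℤ)}ᶜ] A :=
      (measurable_const.indicator hs).prodMk hA
    have hA' : Measurable A := hAm.mono hle le_rfl
    have hlaw := map_pair_eq_map_prod hε (i - k) hAm
    have e1 : ∫ ω in s, H (past ε i ω) ∂P = ∫ ω, G (A ω, ε (i - k) ω) ∂P := by
      rw [← integral_indicator hs0]
      refine integral_congr_ae (Filter.Eventually.of_forall fun ω => ?_)
      simp only [G, A, ← past_eq_update]
      by_cases hω : ω ∈ s <;> simp [hω]
    have e2 : ∫ ω in s, ∫ ω', H (coupledPast ε i k (ω, ω')) ∂P ∂P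
        = ∫ w : Ω × Ω, G (A w.1, ε (i - k) w.2) ∂(P.prod P) := by
      rw [← integral_indicator hs0, integral_prod]
      · refine integral_congr_ae (Filter.Eventually.of_forall fun ω => ?_)
        simp only [G, A, ← coupledPast_eq_update ε i k (ω, _)]
        by_cases hω : ω ∈ s <;> simp [hω]
      · have : (fun w : Ω × Ω => G (A w.1, ε (i - k) w.2))
            = (Prod.fst ⁻¹' s).indicator (fun w : Ω × Ω => H (coupledPast ε i k w)) := by
          funext w
          simp only [G, A, ← coupledPast_eq_update ε i k w]
          by_cases hω : w.1 ∈ s <;> simp [hω]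
        rw [this]
        exact hci.indicator (measurable_fst hs0)
    rw [e1, e2, ← integral_map (f := G) (φ := fun w : Ω × Ω => (A w.1, ε (i - k) w.2))
      ((hA'.comp measurable_fst).prodMk ((hε.measurable _).comp measurable_snd)).aemeasurable
      hG.aestronglyMeasurable, ← hlaw, integral_map (hA'.prodMk (hε.measurable _)).aemeasurable
      hG.aestronglyMeasurable]
  · refine ⟨_, ?_, ae_eq_refl _⟩
    have hm : Measurable fun p : Seq dt × Ω => H (Function.update p.1 k (ε (i - k) p.2)) :=
      hH.comp ((measurable_update_pair k).comp (measurable_fst.prodMk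
        ((hε.measurable _).comp measurable_snd)))
    have h3 : StronglyMeasurable fun z : Seq dt =>
        ∫ ω', H (Function.update z k (ε (i - k) ω')) ∂P :=
      hm.stronglyMeasurable.integral_prod_right
    simp only [coupledPast_eq_update]
    exact h3.comp_measurable hA

/-- A bound on the effect of resampling `ε_{i-k}` controls the change of the conditional
expectation when the innovation `ε_{i-k}` is revealed. -/
lemma abs_condExp_sub_le [MeasurableSpace Ω] {P : Measure Ω} [IsProbabilityMeasure P]
    {ε : ℤ → Ω → Fin dt → ℝ} (hε : IsInnovation P ε) (i : ℤ) (k : ℕ) {H : Seq dt → ℝ}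
    (hH : Measurable H) (hi : Integrable (fun ω => H (past ε i ω)) P) {ψ : Ω × Ω → ℝ}
    (hψ : Integrable ψ (P.prod P))
    (hle : ∀ᵐ w ∂(P.prod P), |H (past ε i w.1) - H (coupledPast ε i k w)| ≤ ψ w) :
    ∀ᵐ ω ∂P, |(P[fun ω => H (past ε i ω) | sig ε (Set.Ici (i - k))]) ω
        - (P[fun ω => H (past ε i ω) | sig ε (Set.Ici (i - k + 1))]) ω|
      ≤ (P[fun ω => ∫ ω', ψ (ω, ω') ∂P | sig ε (Set.Ici (i - k))]) ω := by
  set m : ℤ := i - k with hm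
  set h : Ω → ℝ := fun ω => H (past ε i ω) with hh
  set g : Ω → ℝ := fun ω => ∫ ω', H (coupledPast ε i k (ω, ω')) ∂P with hg
  have hgc := condExp_compl_singleton hε i k hH hi
  have hgi : Integrable g P := integrable_condExp.congr hgc.symm
  have hsi : Integrable (fun ω => ∫ ω', ψ (ω, ω') ∂P) P := hψ.integral_prod_left
  have hci : Integrable (fun w : Ω × Ω => H (coupledPast ε i k w)) (P.prod P) := by
    have h1 : Integrable H (P.map (past ε i)) :=
      (integrable_map_measure hH.aestronglyMeasurable
        (measurable_past hε.measurable i).aemeasurable).2 hi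
    rw [← map_coupledPast hε i k] at h1
    exact (integrable_map_measure hH.aestronglyMeasurable
        (measurable_coupledPast hε.measurable i k).aemeasurable).1 h1
  have e1 : P[g | sig ε (Set.Ici m)] =ᵐ[P] P[h | sig ε (Set.Ici (m + 1))] := by
    have hset : ({m}ᶜ : Set ℤ) ∩ Set.Ici m = Set.Ici (m + 1) := by
      ext x; simp only [Set.mem_inter_iff, Set.mem_compl_iff, Set.mem_singleton_iff, Set.mem_Ici]
      omega
    have h1 := condExp_congr_ae (m := sig ε (Set.Ici m)) hgc
    have h2 := condExp_sig_inter hε {m}ᶜ (Set.Ici m)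
      (stronglyMeasurable_condExp (m := sig ε {m}ᶜ) (μ := P) (f := h)) integrable_condExp
    rw [hset] at h2
    refine h1.trans (h2.trans (condExp_condExp_of_le (sig_mono ε ?_) (sig_le hε.measurable _)))
    intro x hx
    simp only [Set.mem_Ici, Set.mem_compl_iff, Set.mem_singleton_iff] at *
    omega
  have hbound : |h - g| ≤ᵐ[P] fun ω => ∫ ω', ψ (ω, ω') ∂P := by
    filter_upwards [Measure.ae_ae_of_ae_prod hle, hψ.prod_right_ae, hci.prod_right_ae]
      with ω hω hψω hcω
    have : h ω - g ω = ∫ ω', (H (past ε i ω) - H (coupledPast ε i k (ω, ω'))) ∂P := by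
      rw [integral_sub (integrable_const _) hcω]; simp [hh, hg]
    simp only [Pi.abs_apply, Pi.sub_apply, this]
    exact (abs_integral_le_integral_abs).trans
      (integral_mono_ae ((integrable_const _).sub hcω).abs hψω hω)
  filter_upwards [e1, condExp_sub hi hgi (sig ε (Set.Ici m)),
    abs_condExp_ae_le_condExp_abs (μ := P) (m := sig ε (Set.Ici m)) (h - g),
    condExp_mono (m := sig ε (Set.Ici m)) (hi.sub hgi).abs hsi hbound] with ω h1 h2 h3 h4
  rw [← h1]
  simp only [Pi.abs_apply, Pi.sub_apply] at h2 h3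
  rw [← h2]
  exact h3.trans h4

end Coupling

/-! ### Functions satisfying a weighted Hölder condition -/

section Smooth

variable {m : ℕ}

/-- `|z|_{L,s}^s = ∑_i L_i |z_i|_∞^s`, possibly infinite. -/
noncomputable def weightedSum (L : ℕ → ℝ) (s : ℝ) (z : Seq m) : ℝ≥0∞ :=
  ∑' i : ℕ, ENNReal.ofReal (L i) * ENNReal.ofReal (‖z i‖ ^ s)

lemma weightedNorm_ne_top_iff {L : ℕ → ℝ} {s : ℝ} (hs : 0 < s) {z : Seq m} :
    weightedNorm L s z ≠ ⊤ ↔ weightedSum L s z ≠ ⊤ := by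
  have : 0 < 1 / s := by positivity
  simp only [weightedNorm, weightedSum, ne_eq, ENNReal.rpow_eq_top_iff_of_pos this]

lemma weightedNorm_toReal_rpow {L : ℕ → ℝ} {s : ℝ} (hs : 0 < s) (z : Seq m) :
    (weightedNorm L s z).toReal ^ s = (weightedSum L s z).toReal := by
  rw [ENNReal.toReal_rpow, weightedNorm, ← ENNReal.rpow_mul, one_div_mul_cancel hs.ne',
    ENNReal.rpow_one, weightedSum]

lemma measurable_weightedSum (L : ℕ → ℝ) (s : ℝ) : Measurable (weightedSum (m := m) L s) := by
  refine Measurable.tsum fun i => Measurable.const_mul (ENNReal.measurable_ofReal.comp ?_) _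
  exact ((measurable_pi_apply i).norm).pow_const s

lemma weightedSum_add_le {L : ℕ → ℝ} {s : ℝ} (hs : 0 < s) (hs1 : s ≤ 1) (z z' : Seq m) :
    weightedSum L s (z + z') ≤ weightedSum L s z + weightedSum L s z' := by
  simp only [weightedSum, ← ENNReal.tsum_add, ← mul_add]
  refine ENNReal.tsum_le_tsum fun i => mul_le_mul_right ?_ _
  rw [← ENNReal.ofReal_add (by positivity) (by positivity)]
  refine ENNReal.ofReal_le_ofReal ?_
  exact (Real.rpow_le_rpow (norm_nonneg _) (norm_add_le _ _) hs.le).trans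
    (Real.rpow_add_le_add_rpow (norm_nonneg _) (norm_nonneg _) hs.le hs1)

lemma weightedSum_neg (L : ℕ → ℝ) (s : ℝ) (z : Seq m) :
    weightedSum L s (-z) = weightedSum L s z := by
  simp [weightedSum]

/-- Finitely supported sequences with entries in a countable dense set, indexed by the lists of
the positions of their entries. -/
noncomputable def denseFinSeq (m : ℕ) (c : List ℕ) : Seq m :=
  fun i => if i < c.length then TopologicalSpace.denseSeq (Fin m → ℝ) (c.getD i 0) else 0

/-- The sequences of finite weighted norm are separable for the weighted distance. -/
lemma exists_weightedSum_sub_denseFinSeq_lt {L : ℕ → ℝ} {s : ℝ} (hs : 0 < s)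
    {z : Seq m} (hz : weightedSum L s z ≠ ⊤) {η : ℝ≥0∞} (hη : 0 < η)
    (hη' : η ≠ ⊤) :
    ∃ c, weightedSum L s (z - denseFinSeq m c) < η := by
  have hη2 : 0 < η / 2 := ENNReal.half_pos hη.ne'
  have htail := ENNReal.tendsto_sum_nat_add _ hz
  obtain ⟨N, hN⟩ := ((tendsto_order.1 htail).2 _ hη2).exists
  have hδ : 0 < η / 2 / (N + 1) := ENNReal.div_pos hη2.ne' (by finiteness)
  have hex : ∀ i, ∃ a : ℕ, ENNReal.ofReal (L i) * ENNReal.ofReal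
      (‖z i - TopologicalSpace.denseSeq (Fin m → ℝ) a‖ ^ s) < η / 2 / (N + 1) := by
    intro i
    have hcont : Continuous fun x : Fin m → ℝ =>
        ENNReal.ofReal (L i) * ENNReal.ofReal (‖z i - x‖ ^ s) := by
      refine (ENNReal.continuous_const_mul ENNReal.ofReal_ne_top).comp
        (ENNReal.continuous_ofReal.comp ?_)
      exact ((continuous_const.sub continuous_id).norm).rpow_const fun _ => Or.inr hs.le
    have hopen := hcont.isOpen_preimage _ (isOpen_Iio (a := η / 2 / (N + 1)))
    obtain ⟨x, hx, a, rfl⟩ := (TopologicalSpace.denseRange_denseSeq (Fin m → ℝ)).inter_open_nonempty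
      _ hopen ⟨z i, by simpa [Real.zero_rpow hs.ne'] using hδ⟩
    exact ⟨a, hx⟩
  choose a ha using hex
  refine ⟨(List.range N).map a, ?_⟩
  set r := denseFinSeq m ((List.range N).map a) with hr
  have hlow : ∀ i < N, (z - r) i = z i - TopologicalSpace.denseSeq (Fin m → ℝ) (a i) := by
    intro i hi
    simp [hr, denseFinSeq, hi]
  have hhigh : ∀ i, (z - r) (i + N) = z (i + N) := by
    intro i
    simp [hr, denseFinSeq]
  have h1 : weightedSum L s (z - r) ≤ ∑ i ∈ Finset.range N, η / 2 / (N + 1)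
        + ∑' i, ENNReal.ofReal (L (i + N)) * ENNReal.ofReal (‖z (i + N)‖ ^ s) := by
    have h2 : weightedSum L s (z - r)
        = ∑ i ∈ Finset.range N, ENNReal.ofReal (L i) * ENNReal.ofReal (‖(z - r) i‖ ^ s)
          + ∑' i, ENNReal.ofReal (L (i + N)) * ENNReal.ofReal (‖(z - r) (i + N)‖ ^ s) :=
      (Summable.sum_add_tsum_nat_add' (k := N) ENNReal.summable).symm
    rw [h2]
    refine add_le_add (Finset.sum_le_sum fun i hi => ?_) (le_of_eq (tsum_congr fun i => ?_))
    · rw [hlow i (Finset.mem_range.1 hi)]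
      exact (ha i).le
    · rw [hhigh]
  refine h1.trans_lt ?_
  rw [Finset.sum_const, Finset.card_range, nsmul_eq_mul]
  refine (ENNReal.add_lt_add_of_le_of_lt ?_ ?_ hN).trans_eq (ENNReal.add_halves η)
  · finiteness
  · calc (N : ℝ≥0∞) * (η / 2 / (N + 1)) ≤ (N + 1) * (η / 2 / (N + 1)) := by gcongr; simp
      _ = η / 2 := ENNReal.mul_div_cancel (by simp) (by finiteness)

/-- A function with a weighted Hölder bound is measurable on the sequences of finite norm: where
the local constant `R` is at most `K` it is the infimum of the cones over a countable dense set. -/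
lemma measurable_indicator_of_holder {L : ℕ → ℝ} {s : ℝ} (hs : 0 < s) (hs1 : s ≤ 1)
    {g R : Seq m → ℝ} (hR : Measurable R)
    (hg : ∀ z z', weightedSum L s (z - z') ≠ ⊤ →
      |g z - g z'| ≤ (weightedSum L s (z - z')).toReal * (R z + R z')) :
    Measurable ({z | weightedSum L s z ≠ ⊤}.indicator g) := by
  set G : Set (Seq m) := {z | weightedSum L s z ≠ ⊤} with hG
  have hGm : MeasurableSet G := by
    have : G = (weightedSum L s) ⁻¹' {⊤}ᶜ := rfl
    rw [this]; exact measurable_weightedSum L s (measurableSet_singleton _).compl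
  have hsub : ∀ z ∈ G, ∀ z' ∈ G, weightedSum L s (z - z') ≠ ⊤ := by
    intro z hz z' hz'
    rw [sub_eq_add_neg]
    refine ((weightedSum_add_le hs hs1 z (-z')).trans_lt ?_).ne
    rw [weightedSum_neg]
    exact ENNReal.add_lt_top.2 ⟨lt_top_iff_ne_top.2 hz, lt_top_iff_ne_top.2 hz'⟩
  let A : ℕ → Set (Seq m) := fun K => G ∩ {z | R z ≤ K}
  have hAm : ∀ K, MeasurableSet (A K) := fun K => hGm.inter (hR measurableSet_Iic)
  -- a countable dense subset of `A K`
  have hdense : ∀ K, ∃ C : Set (Seq m), C.Countable ∧ C ⊆ A K ∧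
      ∀ z ∈ A K, ∀ η : ℝ, 0 < η → ∃ c ∈ C, (weightedSum L s (z - c)).toReal < η := by
    intro K
    let I : Set (List ℕ × ℕ) :=
      {x | ∃ z ∈ A K, weightedSum L s (z - denseFinSeq m x.1) < (x.2 + 1 : ℝ≥0∞)⁻¹}
    choose! φ hφA hφ using fun (x : List ℕ × ℕ) (hx : x ∈ I) => hx
    refine ⟨φ '' I, (Set.to_countable I).image φ, ?_, ?_⟩
    · rintro _ ⟨x, hx, rfl⟩
      exact hφA x hx
    · intro z hz η hη
      obtain ⟨k, hk⟩ := exists_nat_one_div_lt (half_pos hη)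
      have hpos : (0 : ℝ≥0∞) < (k + 1 : ℝ≥0∞)⁻¹ := ENNReal.inv_pos.2 (by finiteness)
      obtain ⟨c, hc⟩ := exists_weightedSum_sub_denseFinSeq_lt hs hz.1 hpos (by finiteness)
      have hx : (c, k) ∈ I := ⟨z, hz, hc⟩
      refine ⟨φ (c, k), ⟨_, hx, rfl⟩, ?_⟩
      have h1 : weightedSum L s (z - φ (c, k)) ≤ (k + 1 : ℝ≥0∞)⁻¹ + (k + 1 : ℝ≥0∞)⁻¹ := by
        have e : z - φ (c, k) = (z - denseFinSeq m c) + -(φ (c, k) - denseFinSeq m c) := by abel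
        rw [e]
        refine (weightedSum_add_le hs hs1 _ _).trans (add_le_add hc.le ?_)
        rw [weightedSum_neg]
        exact (hφ _ hx).le
      have h2 := ENNReal.toReal_mono (by finiteness) h1
      have h3 : ((k + 1 : ℝ≥0∞)⁻¹ + (k + 1 : ℝ≥0∞)⁻¹).toReal = 1 / ((k : ℝ) + 1)
          + 1 / ((k : ℝ) + 1) := by
        rw [ENNReal.toReal_add (by finiteness) (by finiteness)]
        simp [ENNReal.toReal_add]
      linarith
  choose C hCc hCA hCd using hdense
  have hball : ∀ (K : ℕ) (c : Seq m) (a : ℝ), MeasurableSet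
      {z | g c + (weightedSum L s (z - c)).toReal * (2 * K) < a} := by
    intro K c a
    refine measurableSet_lt (Measurable.const_add (Measurable.mul_const
      (ENNReal.measurable_toReal.comp ((measurable_weightedSum L s).comp ?_)) _) _) measurable_const
    exact measurable_id.sub_const c
  have hlt : ∀ a : ℝ, MeasurableSet (G ∩ {z | g z < a}) := by
    intro a
    have : G ∩ {z | g z < a} = ⋃ K : ℕ, A K ∩ ⋃ c ∈ C K,
        {z | g c + (weightedSum L s (z - c)).toReal * (2 * K) < a} := by
      ext z
      simp only [Set.mem_inter_iff, Set.mem_ofPred_eq, Set.mem_iUnion, exists_prop]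
      constructor
      · rintro ⟨hz, hza⟩
        obtain ⟨K, hK⟩ := exists_nat_ge (R z)
        have hzA : z ∈ A K := ⟨hz, hK⟩
        have hpos : 0 < (a - g z) / (4 * K + 1) := div_pos (by linarith) (by positivity)
        obtain ⟨c, hc, hd⟩ := hCd K z hzA _ hpos
        refine ⟨K, hzA, c, hc, ?_⟩
        have h1 := hg z c (hsub z hz c (hCA K hc).1)
        have h2 : R c ≤ K := (hCA K hc).2
        rw [lt_div_iff₀ (by positivity)] at hd
        have h0 : 0 ≤ (weightedSum L s (z - c)).toReal := ENNReal.toReal_nonneg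
        have h3 := (abs_le.1 h1).1
        have h4 : (weightedSum L s (z - c)).toReal * (R z + R c)
          ≤ (weightedSum L s (z - c)).toReal * (2 * K) :=
          mul_le_mul_of_nonneg_left (by linarith) h0
        nlinarith
      · rintro ⟨K, hzA, c, hc, hlt⟩
        refine ⟨hzA.1, ?_⟩
        have h1 := hg z c (hsub z hzA.1 c (hCA K hc).1)
        have h2 : R c ≤ K := (hCA K hc).2
        have h2' : R z ≤ K := hzA.2
        have h0 : 0 ≤ (weightedSum L s (z - c)).toReal := ENNReal.toReal_nonneg
        have h3 := (abs_le.1 h1).2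
        have h4 : (weightedSum L s (z - c)).toReal * (R z + R c)
          ≤ (weightedSum L s (z - c)).toReal * (2 * K) :=
          mul_le_mul_of_nonneg_left (by linarith) h0
        linarith
    rw [this]
    exact MeasurableSet.iUnion fun K => (hAm K).inter
      (MeasurableSet.biUnion (hCc K) fun c _ => hball K c a)
  refine measurable_of_Iio fun a => ?_
  have : G.indicator g ⁻¹' Set.Iio a = (G ∩ {z | g z < a}) ∪ (Gᶜ ∩ {_z | 0 < a}) := by
    ext z
    by_cases hz : z ∈ G <;> simp [hz]
  rw [this]
  exact (hlt a).union (hGm.compl.inter (MeasurableSet.const _))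

end Smooth

/-! ### Moment bounds for the auxiliary process -/

section Moments

variable {Ω : Type*} {dt m : ℕ}

/-- The past `(X_i, X_{i-1}, …)` of the process `X_i = J_i(ε_i, ε_{i-1}, …)` as a function of the
past `e` of the innovations. -/
def shiftPast (J : ℤ → Seq dt → Fin m → ℝ) (i : ℤ) (e : Seq dt) : Seq m :=
  fun l => J (i - l) fun l' => e (l + l')

lemma past_bernoulliShift (J : ℤ → Seq dt → Fin m → ℝ) (ε : ℤ → Ω → Fin dt → ℝ) (i : ℤ) (ω : Ω) :
    past (bernoulliShift J ε) i ω = shiftPast J i (past ε i ω) := by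
  funext l
  simp only [past, bernoulliShift, shiftPast]
  congr 1
  funext l'
  simp only [past]
  congr 1
  push_cast; ring

lemma measurable_shiftPast {J : ℤ → Seq dt → Fin m → ℝ} (hJ : ∀ i, Measurable (J i)) (i : ℤ) :
    Measurable (shiftPast J i) :=
  measurable_pi_lambda _ fun _ =>
    (hJ _).comp (measurable_pi_lambda _ fun _ => measurable_pi_apply _)

lemma shiftPast_past_apply (J : ℤ → Seq dt → Fin m → ℝ) (ε : ℤ → Ω → Fin dt → ℝ) (i : ℤ) (ω : Ω)
    (l : ℕ) : shiftPast J i (past ε i ω) l = J (i - l) (past ε (i - l) ω) := by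
  rw [← past_bernoulliShift]; rfl

lemma shiftPast_coupledPast_of_le (J : ℤ → Seq dt → Fin m → ℝ) (ε : ℤ → Ω → Fin dt → ℝ) (i : ℤ)
    {k l : ℕ} (h : l ≤ k) (w : Ω × Ω) :
    shiftPast J i (coupledPast ε i k w) l = J (i - l) (coupledPast ε (i - l) (k - l) w) := by
  simp only [shiftPast]
  congr 1
  funext l'
  have h1 : (l + l' = k) ↔ (l' = k - l) := by omega
  have h2 : i - ((l + l' : ℕ) : ℤ) = i - (l : ℤ) - (l' : ℤ) := by push_cast; ring
  simp only [coupledPast, h1, h2]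

lemma shiftPast_coupledPast_of_lt (J : ℤ → Seq dt → Fin m → ℝ) (ε : ℤ → Ω → Fin dt → ℝ) (i : ℤ)
    {k l : ℕ} (h : k < l) (w : Ω × Ω) :
    shiftPast J i (coupledPast ε i k w) l = shiftPast J i (past ε i w.1) l := by
  simp only [shiftPast]
  congr 1
  funext l'
  have h1 : ¬ (l + l' = k) := by omega
  simp only [coupledPast, h1, if_false, past]

lemma norm_rpow_le_sum {s : ℝ} (hs : 0 < s) (v : Fin m → ℝ) : ‖v‖ ^ s ≤ ∑ j, ‖v j‖ ^ s := by
  rcases isEmpty_or_nonempty (Fin m) with h | h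
  · have : v = 0 := Subsingleton.elim _ _
    simp [this, Real.zero_rpow hs.ne']
  · obtain ⟨j, hj⟩ := Finite.exists_max fun j => ‖v j‖
    have h1 : ‖v‖ ≤ ‖v j‖ := (pi_norm_le_iff_of_nonneg (norm_nonneg _)).2 hj
    exact (Real.rpow_le_rpow (norm_nonneg _) h1 hs.le).trans
      (Finset.single_le_sum (f := fun j => ‖v j‖ ^ s) (fun _ _ => by positivity)
        (Finset.mem_univ j))

/-- Moments of `|V|_∞^s` from moments of the coordinates of `V`. -/
lemma eLpNorm_norm_rpow_le {α : Type*} [MeasurableSpace α] {μ : Measure α} {s : ℝ} (hs : 0 < s)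
    {r : ℝ≥0∞} (hr : 1 ≤ r) {V : α → Fin m → ℝ} (hV : Measurable V) {c : ℝ≥0∞}
    (hc : ∀ j, eLpNorm (fun a => V a j) (r * ENNReal.ofReal s) μ ≤ c) :
    eLpNorm (fun a => ‖V a‖ ^ s) r μ ≤ m * c ^ s := by
  have hm : ∀ j, Measurable fun a => ‖V a j‖ ^ s := fun j =>
    ((measurable_pi_apply j).comp hV).norm.pow_const s
  calc eLpNorm (fun a => ‖V a‖ ^ s) r μ ≤ eLpNorm (∑ j, fun a => ‖V a j‖ ^ s) r μ := by
        refine eLpNorm_mono_real fun a => ?_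
        rw [Finset.sum_apply, Real.norm_of_nonneg (by positivity)]
        exact norm_rpow_le_sum hs (V a)
    _ ≤ ∑ j, eLpNorm (fun a => ‖V a j‖ ^ s) r μ :=
        eLpNorm_sum_le (fun j _ => (hm j).aestronglyMeasurable) hr
    _ ≤ ∑ _j : Fin m, c ^ s := by
        refine Finset.sum_le_sum fun j _ => ?_
        rw [eLpNorm_norm_rpow _ hs]
        exact ENNReal.rpow_le_rpow (hc j) hs.le
    _ = m * c ^ s := by simp

/-- Only the first `k + 1` entries of the past of the auxiliary process are affected when the
innovation at lag `k` is resampled. -/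
lemma weightedSum_coupling_eq (J : ℤ → Seq dt → Fin m → ℝ) (ε : ℤ → Ω → Fin dt → ℝ) {L : ℕ → ℝ}
    (hL : ∀ i, 0 ≤ L i) {s : ℝ} (hs : 0 < s) (i : ℤ) (k : ℕ) (w : Ω × Ω) :
    weightedSum L s (shiftPast J i (past ε i w.1) - shiftPast J i (coupledPast ε i k w))
      = ENNReal.ofReal (∑ l ∈ Finset.range (k + 1), L l *
        ‖J (i - l) (past ε (i - l) w.1) - J (i - l) (coupledPast ε (i - l) (k - l) w)‖ ^ s) := by
  rw [weightedSum, tsum_eq_sum (s := Finset.range (k + 1)),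
    ENNReal.ofReal_sum_of_nonneg fun l _ => mul_nonneg (hL l) (by positivity)]
  · refine Finset.sum_congr rfl fun l hl => ?_
    rw [ENNReal.ofReal_mul (hL l), Pi.sub_apply, shiftPast_past_apply,
      shiftPast_coupledPast_of_le _ _ _ (by simpa [Nat.lt_succ_iff] using hl)]
  · intro l hl
    rw [Pi.sub_apply, shiftPast_coupledPast_of_lt _ _ _ (by simpa using hl)]
    simp [Real.zero_rpow hs.ne']

lemma weightedSum_coupling_ne_top (J : ℤ → Seq dt → Fin m → ℝ) (ε : ℤ → Ω → Fin dt → ℝ)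
    {L : ℕ → ℝ} (hL : ∀ i, 0 ≤ L i) {s : ℝ} (hs : 0 < s) (i : ℤ) (k : ℕ) (w : Ω × Ω) :
    weightedSum L s (shiftPast J i (past ε i w.1) - shiftPast J i (coupledPast ε i k w)) ≠ ⊤ := by
  rw [weightedSum_coupling_eq J ε hL hs]
  exact ENNReal.ofReal_ne_top

lemma eLpNorm_weightedSum_coupling_le [MeasurableSpace Ω] {P : Measure Ω} [IsProbabilityMeasure P]
    {ε : ℤ → Ω → Fin dt → ℝ} (hε : ∀ k, Measurable (ε k)) {J : ℤ → Seq dt → Fin m → ℝ}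
    (hJ : ∀ i, Measurable (J i)) {L : ℕ → ℝ} (hL : ∀ i, 0 ≤ L i) {s : ℝ} (hs : 0 < s)
    {r : ℝ≥0∞} (hr : 1 ≤ r) {n : ℕ} {i : ℤ} (hi : i ≤ n) (k : ℕ) :
    eLpNorm (fun w => (weightedSum L s
        (shiftPast J i (past ε i w.1) - shiftPast J i (coupledPast ε i k w))).toReal) r (P.prod P)
      ≤ m * ∑ l ∈ Finset.range (k + 1), ENNReal.ofReal (L l) *
        dependence P ε J n (r * ENNReal.ofReal s) (k - l) ^ s := by
  let V : ℕ → Ω × Ω → Fin m → ℝ := fun l w =>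
    J (i - l) (past ε (i - l) w.1) - J (i - l) (coupledPast ε (i - l) (k - l) w)
  have hV : ∀ l, Measurable (V l) := fun l =>
    ((hJ _).comp ((measurable_past hε _).comp measurable_fst)).sub
      ((hJ _).comp (measurable_coupledPast hε _ _))
  have e : (fun w => (weightedSum L s
        (shiftPast J i (past ε i w.1) - shiftPast J i (coupledPast ε i k w))).toReal)
      = ∑ l ∈ Finset.range (k + 1), L l • fun w => ‖V l w‖ ^ s := by
    funext w
    rw [weightedSum_coupling_eq J ε hL hs, ENNReal.toReal_ofReal
      (Finset.sum_nonneg fun l _ => mul_nonneg (hL l) (by positivity)), Finset.sum_apply]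
    rfl
  rw [e, Finset.mul_sum]
  refine (eLpNorm_sum_le (fun l _ =>
    (((hV l).norm.pow_const s).const_smul (L l)).aestronglyMeasurable) hr).trans
    (Finset.sum_le_sum fun l _ => ?_)
  rw [eLpNorm_const_smul, Real.enorm_eq_ofReal (hL l), ← mul_assoc, mul_comm (m : ℝ≥0∞), mul_assoc]
  refine mul_le_mul_right (eLpNorm_norm_rpow_le hs hr (hV l) fun j => ?_) _
  exact le_iSup₂_of_le (i - l) (by omega) (le_iSup_of_le j le_rfl)

/-- Almost sure finiteness and moments of the weighted norm of the past of a process with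
uniformly bounded moments. -/
lemma weightedSum_past_moment [MeasurableSpace Ω] {P : Measure Ω} [IsProbabilityMeasure P]
    {X : ℤ → Ω → Fin m → ℝ} (hX : ∀ i, Measurable (X i)) {L : ℕ → ℝ} (hL : ∀ i, 0 ≤ L i)
    (hLs : Summable L) {s : ℝ} (hs : 0 < s) {r : ℝ≥0∞} (hr : 1 ≤ r) {C : ℝ} (hC : 0 ≤ C)
    {i : ℤ} (hc : ∀ l : ℕ, ∀ j, eLpNorm (fun ω => X (i - l) ω j) (r * ENNReal.ofReal s) P
      ≤ ENNReal.ofReal C) :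
    (∀ᵐ ω ∂P, weightedSum L s (past X i ω) ≠ ⊤) ∧
      eLpNorm (fun ω => (weightedSum L s (past X i ω)).toReal) r P
        ≤ ENNReal.ofReal (m * (∑' l, L l) * C ^ s) := by
  have hN : ∀ l : ℕ, Measurable fun ω => ‖X (i - l) ω‖ ^ s := fun l => (hX _).norm.pow_const s
  have hb : ∀ l : ℕ, eLpNorm (fun ω => ‖X (i - l) ω‖ ^ s) r P ≤ ENNReal.ofReal (m * C ^ s) := by
    intro l
    refine (eLpNorm_norm_rpow_le hs hr (hX _) (hc l)).trans_eq ?_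
    rw [ENNReal.ofReal_mul (by positivity), ENNReal.ofReal_natCast,
      ENNReal.ofReal_rpow_of_nonneg hC hs.le]
  have hsum : ∀ t : Finset ℕ, eLpNorm (∑ l ∈ t, L l • fun ω => ‖X (i - l) ω‖ ^ s) r P
      ≤ ENNReal.ofReal (m * (∑' l, L l) * C ^ s) := by
    intro t
    calc _ ≤ ∑ l ∈ t, eLpNorm (L l • fun ω => ‖X (i - l) ω‖ ^ s) r P :=
          eLpNorm_sum_le (fun l _ => ((hN l).const_smul (L l)).aestronglyMeasurable) hr
      _ ≤ ∑ l ∈ t, ENNReal.ofReal (L l * (m * C ^ s)) := by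
          refine Finset.sum_le_sum fun l _ => ?_
          rw [eLpNorm_const_smul, Real.enorm_eq_ofReal (hL l), ENNReal.ofReal_mul (hL l)]
          exact mul_le_mul_right (hb l) _
      _ = ENNReal.ofReal ((∑ l ∈ t, L l) * (m * C ^ s)) := by
          rw [← ENNReal.ofReal_sum_of_nonneg fun l _ => mul_nonneg (hL l) (by positivity),
            Finset.sum_mul]
      _ ≤ _ := by
          refine ENNReal.ofReal_le_ofReal ?_
          have := hLs.sum_le_tsum t fun l _ => hL l
          calc (∑ l ∈ t, L l) * (m * C ^ s) ≤ (∑' l, L l) * (m * C ^ s) := by gcongr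
            _ = _ := by ring
  have hfin : ∀ᵐ ω ∂P, weightedSum L s (past X i ω) ≠ ⊤ := by
    refine (ae_lt_top ((measurable_weightedSum L s).comp (measurable_pi_lambda _ fun l => hX _))
      ?_).mono fun ω hω => hω.ne
    have h1 : ∫⁻ ω, weightedSum L s (past X i ω) ∂P
        = ∑' l : ℕ, ENNReal.ofReal (L l) * eLpNorm (fun ω => ‖X (i - l) ω‖ ^ s) 1 P := by
      simp only [weightedSum, past]
      rw [lintegral_tsum fun l => ((hN l).ennreal_ofReal.const_mul _).aemeasurable]
      refine tsum_congr fun l => ?_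
      rw [lintegral_const_mul _ (hN l).ennreal_ofReal, eLpNorm_one_eq_lintegral_enorm]
      congr 1
      refine lintegral_congr fun ω => ?_
      rw [Real.enorm_eq_ofReal (by positivity)]
    have h2 : ∫⁻ ω, weightedSum L s (past X i ω) ∂P
        ≤ ∑' l : ℕ, ENNReal.ofReal (L l) * ENNReal.ofReal (m * C ^ s) := by
      rw [h1]
      refine ENNReal.tsum_le_tsum fun l => mul_le_mul_right ?_ _
      exact (eLpNorm_le_eLpNorm_of_exponent_le hr (hN l).aestronglyMeasurable).trans (hb l)
    refine (h2.trans_lt ?_).ne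
    rw [ENNReal.tsum_mul_right, ← ENNReal.ofReal_tsum_of_nonneg hL hLs]
    finiteness
  refine ⟨hfin, ?_⟩
  refine (Lp.eLpNorm_lim_le_liminf_eLpNorm
    (f := fun N => ∑ l ∈ Finset.range N, L l • fun ω => ‖X (i - l) ω‖ ^ s)
    (fun N => (Finset.aestronglyMeasurable_sum _ fun l _ =>
      ((hN l).const_smul (L l)).aestronglyMeasurable)) _ ?_).trans
    (Filter.liminf_le_of_frequently_le' (Filter.Frequently.of_forall fun N => hsum _))
  filter_upwards [hfin] with ω hω
  have h3 := (ENNReal.hasSum_toReal hω).tendsto_sum_nat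
  have e : (weightedSum L s (past X i ω)).toReal = ∑' l : ℕ,
      (ENNReal.ofReal (L l) * ENNReal.ofReal (‖past X i ω l‖ ^ s)).toReal :=
    ENNReal.tsum_toReal_eq fun l => by finiteness
  rw [e]
  refine h3.congr fun N => ?_
  rw [Finset.sum_apply]
  refine Finset.sum_congr rfl fun l _ => ?_
  rw [ENNReal.toReal_mul, ENNReal.toReal_ofReal (hL l), ENNReal.toReal_ofReal (by positivity)]
  rfl

end Moments

/-! ### Resampling bounds that are uniform over the function class -/

section Envelope

variable {Ω : Type*} {dt dO : ℕ}

/-- The bound `|z - z*|_{L,s}^s (R(z) + R(z*))` on the effect of resampling the innovation at lag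
`k`, where `z` is the past of the auxiliary process and `z*` its coupled version. -/
noncomputable def couplingBound (ε : ℤ → Ω → Fin dt → ℝ) (J : ℤ → Seq dt → Fin dO → ℝ)
    (L : ℕ → ℝ) (s : ℝ) (R : Fn dO) (u : unitInterval) (i : ℤ) (k : ℕ) (w : Ω × Ω) : ℝ :=
  (weightedSum L s (shiftPast J i (past ε i w.1) - shiftPast J i (coupledPast ε i k w))).toReal *
    (R (shiftPast J i (past ε i w.1)) u + R (shiftPast J i (coupledPast ε i k w)) u)

/-- The bound `C_f + |z|_{L,s}^s (R(z) + C_R)` on the functions of a smoothness class. -/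
noncomputable def sizeBound (L : ℕ → ℝ) (s : ℝ) (R : Fn dO) (CR Cf : ℝ) (u : unitInterval)
    (z : Seq dO) : ℝ :=
  Cf + (weightedSum L s z).toReal * (R z u + CR)

/-- The bound on the effect of resampling on the squares of the functions of a smoothness
class. -/
noncomputable def couplingBoundSq (ε : ℤ → Ω → Fin dt → ℝ) (J : ℤ → Seq dt → Fin dO → ℝ)
    (L : ℕ → ℝ) (s : ℝ) (R : Fn dO) (CR Cf : ℝ) (u : unitInterval) (i : ℤ) (k : ℕ)
    (w : Ω × Ω) : ℝ :=
  couplingBound ε J L s R u i k w * (sizeBound L s R CR Cf u (shiftPast J i (past ε i w.1))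
    + sizeBound L s R CR Cf u (shiftPast J i (coupledPast ε i k w)))

lemma measurable_sizeBound {L : ℕ → ℝ} {s : ℝ} {R : Fn dO} (hR : ∀ u, Measurable fun z => R z u)
    (CR Cf : ℝ) (u : unitInterval) : Measurable (sizeBound L s R CR Cf u) :=
  ((measurable_weightedSum L s).ennreal_toReal.mul ((hR u).add_const _)).const_add _

lemma IsSmoothClass.abs_sub_le {A : Set (Fn dO)} {L : ℕ → ℝ} {s : ℝ} {R : Fn dO} {CR Cf : ℝ}
    (h : IsSmoothClass A L s R CR Cf) {g : Fn dO} (hg : g ∈ A) (u : unitInterval) {z z' : Seq dO}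
    (hz : weightedSum L s (z - z') ≠ ⊤) :
    |g z u - g z' u| ≤ (weightedSum L s (z - z')).toReal * (R z u + R z' u) := by
  rw [← weightedNorm_toReal_rpow h.s_pos]
  exact h.holder g hg u z z' ((weightedNorm_ne_top_iff h.s_pos).2 hz)

lemma IsSmoothClass.abs_le_sizeBound {A : Set (Fn dO)} {L : ℕ → ℝ} {s : ℝ} {R : Fn dO} {CR Cf : ℝ}
    (h : IsSmoothClass A L s R CR Cf) {g : Fn dO} (hg : g ∈ A) (u : unitInterval) {z : Seq dO}
    (hz : weightedSum L s z ≠ ⊤) : |g z u| ≤ sizeBound L s R CR Cf u z := by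
  have h1 := h.abs_sub_le hg u (z := z) (z' := 0) (by rwa [sub_zero])
  rw [sub_zero] at h1
  have h2 := h.zero_le g hg u
  have h3 : |g z u| ≤ |g z u - g 0 u| + |g 0 u| := by
    simpa using abs_add_le (g z u - g 0 u) (g 0 u)
  have h4 : (weightedSum L s z).toReal * (R z u + R 0 u)
      ≤ (weightedSum L s z).toReal * (R z u + CR) :=
    mul_le_mul_of_nonneg_left (by linarith [h.R_zero_le u]) ENNReal.toReal_nonneg
  rw [sizeBound]
  linarith

lemma IsSmoothClass.CDelta_nonneg {A : Set (Fn dO)} {L : ℕ → ℝ} {s : ℝ} {R : Fn dO} {CR Cf : ℝ}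
    (h : IsSmoothClass A L s R CR Cf) {CX : ℝ} (hX : 0 < CX) : 0 ≤ CDelta dO L s CX CR Cf := by
  have hLs : 0 ≤ ∑' l, L l := tsum_nonneg h.L_nonneg
  have := h.CR_pos
  have := h.Cf_pos
  rw [CDelta]
  positivity

/-- The Hölder exponent conjugate, up to the factor `ν`, to `ν p`. -/
noncomputable def dualExp (ν : ℝ) (p : ℝ≥0∞) : ℝ≥0∞ := ENNReal.ofReal ν * (1 - p⁻¹)⁻¹

lemma momentExp_eq {ν s : ℝ} (hν : 0 ≤ ν) (p : ℝ≥0∞) :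
    momentExp ν s p = dualExp ν p * ENNReal.ofReal s := by
  rw [momentExp, dualExp, ENNReal.ofReal_mul hν]; ring

lemma ofReal_le_dualExp {ν : ℝ} (p : ℝ≥0∞) : ENNReal.ofReal ν ≤ dualExp ν p := by
  rw [dualExp]
  refine le_mul_of_one_le_right (by positivity) (ENNReal.one_le_inv.2 tsub_le_self)

lemma holderTriple_dualExp {ν : ℝ} (hν : 0 < ν) {p : ℝ≥0∞} (hp : 1 < p) :
    ENNReal.HolderTriple (dualExp ν p) (ENNReal.ofReal ν * p) (ENNReal.ofReal ν) := by
  have h0 : ENNReal.ofReal ν ≠ 0 := by simpa using hν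
  constructor
  rw [dualExp, ENNReal.mul_inv (Or.inl h0) (Or.inl ENNReal.ofReal_ne_top),
    ENNReal.mul_inv (Or.inl h0) (Or.inl ENNReal.ofReal_ne_top), inv_inv, ← mul_add,
    tsub_add_cancel_of_le (ENNReal.inv_le_one.2 hp.le), mul_one]

/-- Hölder's inequality for real functions. -/
lemma eLpNorm_mul_le_mul {α : Type*} [MeasurableSpace α] {μ : Measure α} {p q r : ℝ≥0∞}
    [ENNReal.HolderTriple p q r] {f g : α → ℝ} (hf : AEStronglyMeasurable f μ)
    (hg : AEStronglyMeasurable g μ) :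
    eLpNorm (fun a => f a * g a) r μ ≤ eLpNorm f p μ * eLpNorm g q μ := by
  have h := eLpNorm_le_eLpNorm_mul_eLpNorm'_of_norm (p := p) (q := q) (r := r) hf hg
    (fun a b => a * b) 1 (Filter.Eventually.of_forall fun a => by simp)
  simpa using h

variable [MeasurableSpace Ω] {P : Measure Ω} [IsProbabilityMeasure P] {d n : ℕ}
  {ε : ℤ → Ω → Fin dt → ℝ} {X : ℤ → Ω → Fin d → ℝ} {F : Set (Fn d)}
  {D : Fn d → unitInterval → ℝ} {fbar : Fn d → Fn d} {ν Dn : ℝ} {Δ : ℕ → ℝ}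
  {J : ℤ → Seq dt → Fin dO → ℝ} {mu : ℕ → Fn d → ℕ → Fn dO} {L : ℕ → ℝ} {s : ℝ} {R : Fn dO}
  {CR Cf : ℝ} {p : ℝ≥0∞} {CX : ℝ}

lemma measurable_couplingBound (hε : ∀ k, Measurable (ε k)) (hJ : ∀ i, Measurable (J i))
    (hR : ∀ u, Measurable fun z => R z u) (u : unitInterval) (i : ℤ) (k : ℕ) :
    Measurable (couplingBound ε J L s R u i k) := by
  have h1 : Measurable fun w : Ω × Ω => shiftPast J i (past ε i w.1) :=
    (measurable_shiftPast hJ i).comp ((measurable_past hε i).comp measurable_fst)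
  have h2 : Measurable fun w : Ω × Ω => shiftPast J i (coupledPast ε i k w) :=
    (measurable_shiftPast hJ i).comp (measurable_coupledPast hε i k)
  exact ((measurable_weightedSum L s).comp (h1.sub h2)).ennreal_toReal.mul
    (((hR u).comp h1).add ((hR u).comp h2))

lemma measurable_couplingBoundSq (hε : ∀ k, Measurable (ε k)) (hJ : ∀ i, Measurable (J i))
    (hR : ∀ u, Measurable fun z => R z u) (u : unitInterval) (i : ℤ) (k : ℕ) :
    Measurable (couplingBoundSq ε J L s R CR Cf u i k) := by
  have h1 : Measurable fun w : Ω × Ω => shiftPast J i (past ε i w.1) :=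
    (measurable_shiftPast hJ i).comp ((measurable_past hε i).comp measurable_fst)
  have h2 : Measurable fun w : Ω × Ω => shiftPast J i (coupledPast ε i k w) :=
    (measurable_shiftPast hJ i).comp (measurable_coupledPast hε i k)
  exact (measurable_couplingBound hε hJ hR u i k).mul
    (((measurable_sizeBound hR CR Cf u).comp h1).add ((measurable_sizeBound hR CR Cf u).comp h2))

lemma eLpNorm_past_eq (hε : ∀ k, Measurable (ε k)) {H : Seq dt → ℝ} (hH : Measurable H) (i : ℤ)
    (r : ℝ≥0∞) :
    eLpNorm (fun w : Ω × Ω => H (past ε i w.1)) r (P.prod P) = eLpNorm (fun ω => H (past ε i ω)) r P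
    := by
  have h : (P.prod P).map Prod.fst = P := by simp
  have h1 := eLpNorm_map_measure (p := r) (μ := P.prod P) (f := Prod.fst)
    (g := fun ω => H (past ε i ω)) (hH.comp (measurable_past hε i)).aestronglyMeasurable
    measurable_fst.aemeasurable
  rw [h] at h1
  exact h1.symm

lemma eLpNorm_coupledPast_eq (hε : IsInnovation P ε) {H : Seq dt → ℝ} (hH : Measurable H) (i : ℤ)
    (k : ℕ) (r : ℝ≥0∞) :
    eLpNorm (fun w : Ω × Ω => H (coupledPast ε i k w)) r (P.prod P)
      = eLpNorm (fun ω => H (past ε i ω)) r P := by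
  have h1 := eLpNorm_map_measure (p := r) (μ := P.prod P) (f := coupledPast ε i k) (g := H)
    hH.aestronglyMeasurable (measurable_coupledPast hε.measurable i k).aemeasurable
  have h2 := eLpNorm_map_measure (p := r) (μ := P) (f := past ε i) (g := H)
    hH.aestronglyMeasurable (measurable_past hε.measurable i).aemeasurable
  rw [map_coupledPast hε, h2] at h1
  exact h1.symm

lemma eLpNorm_couplingBound_le (hε : IsInnovation P ε)
    (hc : Compatibility P ε X n F D fbar ν Δ Dn J mu L s R CR Cf p CX)
    {i : ℕ} (hi : i ∈ Finset.Icc 1 n) (u : unitInterval) (k : ℕ) :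
    eLpNorm (couplingBound ε J L s R u ((i : ℤ) - 1) k) 2 (P.prod P)
      ≤ ENNReal.ofReal (Δ (k + 1)) := by
  have hsm := hc.smooth 1 (by simp)
  have hν : 0 < ν := by linarith [hc.two_le_nu]
  have hν2 : (2 : ℝ≥0∞) ≤ ENNReal.ofReal ν := by
    simpa using ENNReal.ofReal_le_ofReal hc.two_le_nu
  have hr1 : 1 ≤ dualExp ν p := (by norm_num : (1 : ℝ≥0∞) ≤ 2).trans
    (hν2.trans (ofReal_le_dualExp p))
  have hνp : 1 ≤ ENNReal.ofReal ν * p := by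
    calc (1 : ℝ≥0∞) = 1 * 1 := by simp
      _ ≤ ENNReal.ofReal ν * p :=
        mul_le_mul' ((by norm_num : (1 : ℝ≥0∞) ≤ 2).trans hν2) hc.one_lt_p.le
  have hJ := hc.JO_measurable
  have hR := hsm.R_measurable
  have hi' := Finset.mem_Icc.1 hi
  set i' : ℤ := (i : ℤ) - 1 with hi0
  have h1 : Measurable fun w : Ω × Ω => shiftPast J i' (past ε i' w.1) :=
    (measurable_shiftPast hJ i').comp ((measurable_past hε.measurable i').comp measurable_fst)
  have h2 : Measurable fun w : Ω × Ω => shiftPast J i' (coupledPast ε i' k w) :=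
    (measurable_shiftPast hJ i').comp (measurable_coupledPast hε.measurable i' k)
  have hRm : Measurable fun e => R (shiftPast J i' e) u := (hR u).comp (measurable_shiftPast hJ i')
  have hRmom := hc.R_moment i hi u
  simp only [past_bernoulliShift] at hRmom
  have hRsum : eLpNorm (fun w => R (shiftPast J i' (past ε i' w.1)) u
      + R (shiftPast J i' (coupledPast ε i' k w)) u) (ENNReal.ofReal ν * p) (P.prod P)
      ≤ ENNReal.ofReal (2 * CR) := by
    refine (eLpNorm_add_le ((hR u).comp h1).aestronglyMeasurable
      ((hR u).comp h2).aestronglyMeasurable hνp).trans ?_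
    have e1 := eLpNorm_past_eq (P := P) hε.measurable hRm i' (ENNReal.ofReal ν * p)
    have e2 := eLpNorm_coupledPast_eq hε hRm i' k (ENNReal.ofReal ν * p)
    refine (add_le_add (e1.le.trans hRmom) (e2.le.trans hRmom)).trans_eq ?_
    rw [← ENNReal.ofReal_add hsm.CR_pos.le hsm.CR_pos.le, two_mul]
  have hW := eLpNorm_weightedSum_coupling_le (P := P) hε.measurable hJ hsm.L_nonneg hsm.s_pos hr1
    (n := n) (i := i') (by omega) k
  have hWm : Measurable fun w : Ω × Ω => (weightedSum L s
      (shiftPast J i' (past ε i' w.1) - shiftPast J i' (coupledPast ε i' k w))).toReal :=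
    ((measurable_weightedSum L s).comp (h1.sub h2)).ennreal_toReal
  have := holderTriple_dualExp hν hc.one_lt_p
  have hdec := hc.decay (k + 1)
  rw [momentExp_eq hν.le] at hdec
  calc _ ≤ eLpNorm (couplingBound ε J L s R u i' k) (ENNReal.ofReal ν) (P.prod P) :=
        eLpNorm_le_eLpNorm_of_exponent_le hν2
          (measurable_couplingBound hε.measurable hJ hR u i' k).aestronglyMeasurable
    _ ≤ _ * _ := eLpNorm_mul_le_mul (p := dualExp ν p) (q := ENNReal.ofReal ν * p)
        hWm.aestronglyMeasurable (((hR u).comp h1).add ((hR u).comp h2)).aestronglyMeasurable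
    _ ≤ _ * _ := mul_le_mul' hW hRsum
    _ ≤ ENNReal.ofReal (Δ (k + 1)) := by
        refine le_trans (le_of_eq ?_) hdec
        rw [mul_comm, ← mul_assoc]
        congr 1
        · rw [← ENNReal.ofReal_natCast, ← ENNReal.ofReal_mul (by linarith [hsm.CR_pos])]
          congr 1; ring
        · refine Finset.sum_congr rfl fun l _ => ?_
          congr 3
          omega

lemma weightedSum_shiftPast_moment (hε : IsInnovation P ε)
    (hc : Compatibility P ε X n F D fbar ν Δ Dn J mu L s R CR Cf p CX)
    {i : ℕ} (hi : i ∈ Finset.Icc 1 n) :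
    (∀ᵐ ω ∂P, weightedSum L s (shiftPast J ((i : ℤ) - 1) (past ε ((i : ℤ) - 1) ω)) ≠ ⊤) ∧
      eLpNorm (fun ω => (weightedSum L s
        (shiftPast J ((i : ℤ) - 1) (past ε ((i : ℤ) - 1) ω))).toReal) (dualExp ν p) P
        ≤ ENNReal.ofReal (dO * (∑' l, L l) * CX ^ s) := by
  have hsm := hc.smooth 1 (by simp)
  have hν : 0 < ν := by linarith [hc.two_le_nu]
  have hν2 : (2 : ℝ≥0∞) ≤ ENNReal.ofReal ν := by
    simpa using ENNReal.ofReal_le_ofReal hc.two_le_nu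
  have hr1 : 1 ≤ dualExp ν p := (by norm_num : (1 : ℝ≥0∞) ≤ 2).trans
    (hν2.trans (ofReal_le_dualExp p))
  have hi' := Finset.mem_Icc.1 hi
  have hX : ∀ i, Measurable (bernoulliShift J ε i) := fun i =>
    (hc.JO_measurable i).comp (measurable_past hε.measurable i)
  have := weightedSum_past_moment (P := P) hX hsm.L_nonneg hsm.L_summable hsm.s_pos hr1
    hc.CX_pos.le (i := (i : ℤ) - 1) (fun l j => by
      rw [← momentExp_eq hν.le]
      exact hc.X_moment _ (by omega) j)
  simpa only [past_bernoulliShift] using this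

lemma eLpNorm_sizeBound_le (hε : IsInnovation P ε)
    (hc : Compatibility P ε X n F D fbar ν Δ Dn J mu L s R CR Cf p CX)
    {i : ℕ} (hi : i ∈ Finset.Icc 1 n) (u : unitInterval) :
    eLpNorm (fun ω => sizeBound L s R CR Cf u (shiftPast J ((i : ℤ) - 1) (past ε ((i : ℤ) - 1) ω)))
      2 P ≤ ENNReal.ofReal (CDelta dO L s CX CR Cf) := by
  have hsm := hc.smooth 1 (by simp)
  have hν : 0 < ν := by linarith [hc.two_le_nu]
  have hν2 : (2 : ℝ≥0∞) ≤ ENNReal.ofReal ν := by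
    simpa using ENNReal.ofReal_le_ofReal hc.two_le_nu
  have hνp : 1 ≤ ENNReal.ofReal ν * p := by
    calc (1 : ℝ≥0∞) = 1 * 1 := by simp
      _ ≤ ENNReal.ofReal ν * p :=
        mul_le_mul' ((by norm_num : (1 : ℝ≥0∞) ≤ 2).trans hν2) hc.one_lt_p.le
  have hJ := hc.JO_measurable
  have hR := hsm.R_measurable
  have hCR := hsm.CR_pos
  have hCf := hsm.Cf_pos
  obtain ⟨-, hW⟩ := weightedSum_shiftPast_moment hε hc hi
  have hRmom := hc.R_moment i hi u
  simp only [past_bernoulliShift] at hRmom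
  set i' : ℤ := (i : ℤ) - 1 with hi0
  have h1 : Measurable fun ω => shiftPast J i' (past ε i' ω) :=
    (measurable_shiftPast hJ i').comp (measurable_past hε.measurable i')
  have hWm := ((measurable_weightedSum L s).comp h1).ennreal_toReal
  have hRsum : eLpNorm (fun ω => R (shiftPast J i' (past ε i' ω)) u + CR)
      (ENNReal.ofReal ν * p) P ≤ ENNReal.ofReal (2 * CR) := by
    refine (eLpNorm_add_le ((hR u).comp h1).aestronglyMeasurable
      aestronglyMeasurable_const hνp).trans ?_
    have e2 : eLpNorm (fun _ : Ω => CR) (ENNReal.ofReal ν * p) P ≤ ENNReal.ofReal CR := by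
      rw [eLpNorm_const CR (by positivity) (IsProbabilityMeasure.ne_zero P)]
      simp [Real.enorm_eq_ofReal hCR.le]
    refine (add_le_add hRmom e2).trans_eq ?_
    rw [← ENNReal.ofReal_add hCR.le hCR.le, two_mul]
  have := holderTriple_dualExp hν hc.one_lt_p
  have hprod : eLpNorm (fun ω => (weightedSum L s (shiftPast J i' (past ε i' ω))).toReal
      * (R (shiftPast J i' (past ε i' ω)) u + CR)) 2 P
      ≤ ENNReal.ofReal (dO * (∑' l, L l) * CX ^ s) * ENNReal.ofReal (2 * CR) :=
    calc _ ≤ _ := eLpNorm_le_eLpNorm_of_exponent_le hν2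
          (hWm.mul (((hR u).comp h1).add_const _)).aestronglyMeasurable
      _ ≤ _ * _ := eLpNorm_mul_le_mul (p := dualExp ν p) (q := ENNReal.ofReal ν * p)
          hWm.aestronglyMeasurable (((hR u).comp h1).add_const _).aestronglyMeasurable
      _ ≤ _ := mul_le_mul' hW hRsum
  have hconst : eLpNorm (fun _ : Ω => Cf) 2 P ≤ ENNReal.ofReal Cf := by
    rw [eLpNorm_const Cf (by norm_num) (IsProbabilityMeasure.ne_zero P)]
    simp [Real.enorm_eq_ofReal hCf.le]
  have hLs : 0 ≤ ∑' l, L l := tsum_nonneg hsm.L_nonneg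
  have hCX := hc.CX_pos
  calc _ ≤ eLpNorm (fun _ : Ω => Cf) 2 P + _ :=
        eLpNorm_add_le aestronglyMeasurable_const
          (hWm.mul (((hR u).comp h1).add_const _)).aestronglyMeasurable (by norm_num)
    _ ≤ ENNReal.ofReal Cf
        + ENNReal.ofReal (dO * (∑' l, L l) * CX ^ s) * ENNReal.ofReal (2 * CR) :=
        add_le_add hconst hprod
    _ = ENNReal.ofReal (CDelta dO L s CX CR Cf) := by
        rw [← ENNReal.ofReal_mul (by positivity), ← ENNReal.ofReal_add hCf.le (by positivity),
          CDelta]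
        congr 1; ring

lemma eLpNorm_couplingBoundSq_le (hε : IsInnovation P ε)
    (hc : Compatibility P ε X n F D fbar ν Δ Dn J mu L s R CR Cf p CX)
    {i : ℕ} (hi : i ∈ Finset.Icc 1 n) (u : unitInterval) (k : ℕ) :
    eLpNorm (couplingBoundSq ε J L s R CR Cf u ((i : ℤ) - 1) k) 1 (P.prod P)
      ≤ ENNReal.ofReal (Δ (k + 1)) * ENNReal.ofReal (2 * CDelta dO L s CX CR Cf) := by
  have hsm := hc.smooth 1 (by simp)
  have hJ := hc.JO_measurable
  have hR := hsm.R_measurable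
  have hC := hsm.CDelta_nonneg hc.CX_pos
  have hsz := eLpNorm_sizeBound_le hε hc hi u
  have hcb := eLpNorm_couplingBound_le hε hc hi u k
  set i' : ℤ := (i : ℤ) - 1 with hi0
  have h1 : Measurable fun w : Ω × Ω => shiftPast J i' (past ε i' w.1) :=
    (measurable_shiftPast hJ i').comp ((measurable_past hε.measurable i').comp measurable_fst)
  have h2 : Measurable fun w : Ω × Ω => shiftPast J i' (coupledPast ε i' k w) :=
    (measurable_shiftPast hJ i').comp (measurable_coupledPast hε.measurable i' k)
  have hS := measurable_sizeBound (L := L) (s := s) hR CR Cf u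
  have hSm := hS.comp (measurable_shiftPast hJ i')
  have hsum : eLpNorm (fun w => sizeBound L s R CR Cf u (shiftPast J i' (past ε i' w.1))
      + sizeBound L s R CR Cf u (shiftPast J i' (coupledPast ε i' k w))) 2 (P.prod P)
      ≤ ENNReal.ofReal (2 * CDelta dO L s CX CR Cf) := by
    refine (eLpNorm_add_le (hS.comp h1).aestronglyMeasurable
      (hS.comp h2).aestronglyMeasurable (by norm_num)).trans ?_
    have e1 := eLpNorm_past_eq (P := P) hε.measurable hSm i' 2
    have e2 := eLpNorm_coupledPast_eq hε hSm i' k 2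
    refine (add_le_add (e1.le.trans hsz) (e2.le.trans hsz)).trans_eq ?_
    rw [← ENNReal.ofReal_add hC hC, two_mul]
  exact (eLpNorm_mul_le_mul (p := 2) (q := 2)
    (measurable_couplingBound hε.measurable hJ hR u i' k).aestronglyMeasurable
    ((hS.comp h1).add (hS.comp h2)).aestronglyMeasurable).trans (mul_le_mul' hcb hsum)

end Envelope

/-! ### The conditional moments of the summands as functions of the past -/

section ConditionalMoments

variable {Ω : Type*} {dt dO : ℕ} [MeasurableSpace Ω] {P : Measure Ω} [IsProbabilityMeasure P]
  {d n : ℕ} {ε : ℤ → Ω → Fin dt → ℝ} {X : ℤ → Ω → Fin d → ℝ} {F : Set (Fn d)}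
  {D : Fn d → unitInterval → ℝ} {fbar : Fn d → Fn d} {M ν Dn : ℝ} {Δ : ℕ → ℝ}
  {J : ℤ → Seq dt → Fin dO → ℝ} {mu : ℕ → Fn d → ℕ → Fn dO} {L : ℕ → ℝ} {s : ℝ} {R : Fn dO}
  {CR Cf : ℝ} {p : ℝ≥0∞} {CX : ℝ}

/-- The function `μ̄^{(κ)}` of the past of the innovations, set to zero where the weighted norm is
infinite; unlike `μ̄^{(κ)}` itself it is measurable. -/
noncomputable def cutMu (J : ℤ → Seq dt → Fin dO → ℝ) (L : ℕ → ℝ) (s : ℝ) (g : Fn dO)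
    (u : unitInterval) (i : ℤ) (e : Seq dt) : ℝ :=
  {z | weightedSum L s z ≠ ⊤}.indicator (fun z => g z u) (shiftPast J i e)

lemma cutMu_of_ne_top {J : ℤ → Seq dt → Fin dO → ℝ} {L : ℕ → ℝ} {s : ℝ} {g : Fn dO}
    {u : unitInterval} {i : ℤ} {e : Seq dt} (h : weightedSum L s (shiftPast J i e) ≠ ⊤) :
    cutMu J L s g u i e = g (shiftPast J i e) u :=
  Set.indicator_of_mem (s := {z | weightedSum L s z ≠ ⊤}) h _

lemma IsSmoothClass.measurable_cutMu {A : Set (Fn dO)} (h : IsSmoothClass A L s R CR Cf)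
    {J : ℤ → Seq dt → Fin dO → ℝ} (hJ : ∀ i, Measurable (J i)) {g : Fn dO} (hg : g ∈ A)
    (u : unitInterval) (i : ℤ) : Measurable (cutMu J L s g u i) :=
  (measurable_indicator_of_holder h.s_pos h.s_le_one (h.R_measurable u)
    fun _ _ hz => h.abs_sub_le hg u hz).comp (measurable_shiftPast hJ i)

lemma ae_weightedSum_coupled (hε : IsInnovation P ε)
    (hc : Compatibility P ε X n F D fbar ν Δ Dn J mu L s R CR Cf p CX)
    {i : ℕ} (hi : i ∈ Finset.Icc 1 n) (k : ℕ) :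
    ∀ᵐ w ∂(P.prod P), weightedSum L s (shiftPast J ((i : ℤ) - 1) (past ε ((i : ℤ) - 1) w.1)) ≠ ⊤ ∧
      weightedSum L s (shiftPast J ((i : ℤ) - 1) (coupledPast ε ((i : ℤ) - 1) k w)) ≠ ⊤ := by
  obtain ⟨h, -⟩ := weightedSum_shiftPast_moment hε hc hi
  set i' : ℤ := (i : ℤ) - 1
  have hT : MeasurableSet {e : Seq dt | weightedSum L s (shiftPast J i' e) ≠ ⊤} :=
    ((measurable_weightedSum L s).comp (measurable_shiftPast hc.JO_measurable i'))
      (measurableSet_singleton ⊤).compl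
  have h1 : ∀ᵐ e ∂(P.map (past ε i')), weightedSum L s (shiftPast J i' e) ≠ ⊤ :=
    (ae_map_iff (measurable_past hε.measurable i').aemeasurable hT).2 h
  have h2 := h1
  rw [← map_coupledPast hε i' k] at h2
  have h3 := (ae_map_iff (measurable_coupledPast hε.measurable i' k).aemeasurable hT).1 h2
  have h4 : ∀ᵐ w ∂(P.prod P), weightedSum L s (shiftPast J i' (past ε i' w.1)) ≠ ⊤ :=
    Measure.quasiMeasurePreserving_fst.ae h
  exact h4.and h3

lemma abs_cutMu_sub_le (hε : IsInnovation P ε)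
    (hc : Compatibility P ε X n F D fbar ν Δ Dn J mu L s R CR Cf p CX) {κ : ℕ}
    (hκ : κ ∈ ({1, 2} : Finset ℕ)) {f : Fn d} (hf : f ∈ F)
    {i : ℕ} (hi : i ∈ Finset.Icc 1 n) (u : unitInterval) (k : ℕ) :
    ∀ᵐ w ∂(P.prod P), |cutMu J L s (mu κ f i) u ((i : ℤ) - 1) (past ε ((i : ℤ) - 1) w.1)
        - cutMu J L s (mu κ f i) u ((i : ℤ) - 1) (coupledPast ε ((i : ℤ) - 1) k w)|
      ≤ couplingBound ε J L s R u ((i : ℤ) - 1) k w := by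
  have hsm := hc.smooth κ hκ
  filter_upwards [ae_weightedSum_coupled hε hc hi k] with w hw
  rw [cutMu_of_ne_top hw.1, cutMu_of_ne_top hw.2]
  exact hsm.abs_sub_le ⟨f, hf, i, hi, rfl⟩ u
    (weightedSum_coupling_ne_top J ε hsm.L_nonneg hsm.s_pos _ k w)

lemma abs_cutMu_sq_sub_le (hε : IsInnovation P ε)
    (hc : Compatibility P ε X n F D fbar ν Δ Dn J mu L s R CR Cf p CX) {κ : ℕ}
    (hκ : κ ∈ ({1, 2} : Finset ℕ)) {f : Fn d} (hf : f ∈ F)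
    {i : ℕ} (hi : i ∈ Finset.Icc 1 n) (u : unitInterval) (k : ℕ) :
    ∀ᵐ w ∂(P.prod P), |cutMu J L s (mu κ f i) u ((i : ℤ) - 1) (past ε ((i : ℤ) - 1) w.1) ^ 2
        - cutMu J L s (mu κ f i) u ((i : ℤ) - 1) (coupledPast ε ((i : ℤ) - 1) k w) ^ 2|
      ≤ couplingBoundSq ε J L s R CR Cf u ((i : ℤ) - 1) k w := by
  have hsm := hc.smooth κ hκ
  have hmem : mu κ f i ∈ {g | ∃ f ∈ F, ∃ i ∈ Finset.Icc 1 n, g = mu κ f i} := ⟨f, hf, i, hi, rfl⟩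
  filter_upwards [ae_weightedSum_coupled hε hc hi k, abs_cutMu_sub_le hε hc hκ hf hi u k]
    with w hw h1
  have h2 := hsm.abs_le_sizeBound hmem u hw.1
  have h3 := hsm.abs_le_sizeBound hmem u hw.2
  rw [← cutMu_of_ne_top (g := mu κ f i) (u := u) hw.1] at h2
  rw [← cutMu_of_ne_top (g := mu κ f i) (u := u) hw.2] at h3
  rw [sq_sub_sq, abs_mul, mul_comm, couplingBoundSq]
  exact mul_le_mul h1 ((abs_add_le _ _).trans (add_le_add h2 h3)) (abs_nonneg _)
    ((abs_nonneg _).trans h1)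

/-- The `κ`-th conditional moment of `f(Z_i, u)` given the past is `(D_f(u) μ̄^{(κ)})^κ`. -/
lemma cutMu_pow_eq_condExp (hε : IsInnovation P ε) (hF : IsFunctionClass F D fbar M)
    (hc : Compatibility P ε X n F D fbar ν Δ Dn J mu L s R CR Cf p CX) {κ : ℕ}
    (hκ : κ ∈ ({1, 2} : Finset ℕ)) {f : Fn d} (hf : f ∈ F)
    {i : ℕ} (hi : i ∈ Finset.Icc 1 n) (u : unitInterval) :
    (fun ω => (D f u * cutMu J L s (mu κ f i) u ((i : ℤ) - 1) (past ε ((i : ℤ) - 1) ω)) ^ κ)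
      =ᵐ[P] P[fun ω => f (past X i ω) u ^ κ | sig ε (Set.Iic ((i : ℤ) - 1))] := by
  obtain ⟨h, -⟩ := weightedSum_shiftPast_moment hε hc hi
  have hmu := hc.mu_eq κ hκ f hf i hi u
  simp only [past_bernoulliShift] at hmu
  rw [pastSigma_eq_sig] at hmu
  have hκ' : κ = 1 ∨ κ = 2 := by simpa using hκ
  have hκ0 : κ ≠ 0 := by omega
  have e : (fun ω => f (past X i ω) u ^ κ)
      = (D f u ^ κ) • fun ω => fbar f (past X i ω) u ^ κ := by
    funext ω
    rw [hF.decomp f hf, mul_pow]; rfl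
  have hpos : ∀ᵐ ω ∂P, κ = 2 → 0 ≤
      (P[fun ω => fbar f (past X i ω) u ^ κ | sig ε (Set.Iic ((i : ℤ) - 1))]) ω := by
    rcases hκ' with rfl | rfl
    · exact Filter.Eventually.of_forall fun ω h => by omega
    · filter_upwards [condExp_nonneg (μ := P) (m := sig ε (Set.Iic ((i : ℤ) - 1)))
        (f := fun ω => fbar f (past X i ω) u ^ 2)
        (Filter.Eventually.of_forall fun ω => sq_nonneg (fbar f (past X i ω) u))] with ω hω _
      exact hω
  have hsmul := condExp_smul (μ := P) (D f u ^ κ) (fun ω => fbar f (past X i ω) u ^ κ)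
    (sig ε (Set.Iic ((i : ℤ) - 1)))
  rw [e]
  filter_upwards [h, hmu, hpos, hsmul] with ω h1 h2 h3 h4
  rw [h4, cutMu_of_ne_top h1, h2, mul_pow, Pi.smul_apply, smul_eq_mul]
  congr 1
  rcases hκ' with rfl | rfl
  · simp
  · rw [← Real.rpow_natCast, ← Real.rpow_mul (h3 rfl)]
    norm_num

end ConditionalMoments

/-! ### Exponential supermartingales -/

section Exponential

/-- The inequality behind self-normalized exponential supermartingales: it holds for all `x`, so
that no bound on the increments is needed. -/
lemma exp_sub_sq_le (x : ℝ) : Real.exp (x - x ^ 2) ≤ 1 + x + x ^ 2 := by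
  have h1 : 0 < 1 - x + x ^ 2 := by nlinarith [sq_nonneg (x - 1)]
  have h2 : 1 - x + x ^ 2 ≤ Real.exp (-(x - x ^ 2)) := by
    have := Real.add_one_le_exp (-(x - x ^ 2)); linarith
  rw [Real.exp_neg] at h2
  refine (le_inv_of_le_inv₀ h1 h2).trans ?_
  rw [inv_le_iff_one_le_mul₀ h1]
  nlinarith [sq_nonneg x, sq_nonneg (x ^ 2)]

lemma exp_le_of_abs_le_one {x : ℝ} (hx : |x| ≤ 1) : Real.exp x ≤ 1 + x + x ^ 2 := by
  have := (abs_le.1 (Real.abs_exp_sub_one_sub_id_le hx)).2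
  linarith

variable {Ω : Type*}

lemma integrable_exp_of_ae_le {m0 : MeasurableSpace Ω} {P : Measure Ω} [IsProbabilityMeasure P]
    {Y : Ω → ℝ} (hY : AEStronglyMeasurable Y P) {C : ℝ} (hC : ∀ᵐ ω ∂P, Y ω ≤ C) :
    Integrable (fun ω => Real.exp (Y ω)) P := by
  refine Integrable.of_bound (Real.continuous_exp.comp_aestronglyMeasurable hY) (Real.exp C) ?_
  filter_upwards [hC] with ω hω
  rw [Real.norm_of_nonneg (Real.exp_pos _).le]
  exact Real.exp_le_exp.2 hω

/-- A product of exponentials with conditional mean at most one has mean at most one. -/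
lemma integral_exp_sum_le_one {m0 : MeasurableSpace Ω} {P : Measure Ω} [IsProbabilityMeasure P]
    {G : ℕ → MeasurableSpace Ω} (hmono : Monotone G) (hle : ∀ k, G k ≤ m0) {A : ℕ → Ω → ℝ}
    (hA : ∀ k, StronglyMeasurable[G (k + 1)] (A k)) {C : ℕ → ℝ} (hC : ∀ k, ∀ᵐ ω ∂P, A k ω ≤ C k)
    (hc : ∀ k, P[fun ω => Real.exp (A k ω) | G k] ≤ᵐ[P] 1) (N : ℕ) :
    ∫ ω, Real.exp (∑ k ∈ Finset.range N, A k ω) ∂P ≤ 1 := by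
  have hSm : ∀ N, StronglyMeasurable[G N] fun ω => ∑ k ∈ Finset.range N, A k ω := fun N =>
    Finset.stronglyMeasurable_fun_sum _ fun k hk => (hA k).mono
      (hmono (Nat.succ_le_of_lt (Finset.mem_range.1 hk)))
  have hSb : ∀ N, ∀ᵐ ω ∂P, ∑ k ∈ Finset.range N, A k ω ≤ ∑ k ∈ Finset.range N, C k := fun N => by
    filter_upwards [ae_all_iff.2 hC] with ω hω
    exact Finset.sum_le_sum fun k _ => hω k
  have hint : ∀ N, Integrable (fun ω => Real.exp (∑ k ∈ Finset.range N, A k ω)) P := fun N =>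
    integrable_exp_of_ae_le ((hSm N).mono (hle N)).aestronglyMeasurable (hSb N)
  induction N with
  | zero => simp
  | succ N ih =>
    have hAi : Integrable (fun ω => Real.exp (A N ω)) P :=
      integrable_exp_of_ae_le ((hA N).mono (hle _)).aestronglyMeasurable (hC N)
    have e : (fun ω => Real.exp (∑ k ∈ Finset.range (N + 1), A k ω))
        = (fun ω => Real.exp (∑ k ∈ Finset.range N, A k ω)) * fun ω => Real.exp (A N ω) := by
      funext ω
      rw [Finset.sum_range_succ, Real.exp_add]; rfl
    have hp := condExp_mul_of_stronglyMeasurable_left (μ := P) (m := G N)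
      (Real.continuous_exp.comp_stronglyMeasurable (hSm N)) (e ▸ hint (N + 1)) hAi
    calc ∫ ω, Real.exp (∑ k ∈ Finset.range (N + 1), A k ω) ∂P
        = ∫ ω, (P[(fun ω => Real.exp (∑ k ∈ Finset.range N, A k ω)) *
            fun ω => Real.exp (A N ω) | G N]) ω ∂P := by
          rw [integral_condExp (hle N), ← e]
      _ ≤ ∫ ω, Real.exp (∑ k ∈ Finset.range N, A k ω) ∂P := by
          refine integral_mono_ae integrable_condExp (hint N) ?_
          filter_upwards [hp, hc N] with ω h1 h2
          rw [h1]
          exact mul_le_of_le_one_right (Real.exp_pos _).le h2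
      _ ≤ 1 := ih

/-- The compensated exponential of a bounded martingale increment has conditional mean at most
one. -/
lemma condExp_exp_sub_le_one {m m0 : MeasurableSpace Ω} (hm : m ≤ m0) {P : Measure Ω}
    [IsProbabilityMeasure P] {ξ Y : Ω → ℝ} (hξ : AEStronglyMeasurable ξ P) {C : ℝ}
    (hC : ∀ᵐ ω ∂P, |ξ ω| ≤ C) (h0 : P[ξ | m] =ᵐ[P] 0) (hY : AEStronglyMeasurable Y P) {θ : ℝ}
    (hle : ∀ᵐ ω ∂P, Real.exp (Y ω) ≤ 1 + θ * ξ ω + θ ^ 2 * ξ ω ^ 2) :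
    P[fun ω => Real.exp (Y ω - θ ^ 2 * (P[fun ω => ξ ω ^ 2 | m]) ω) | m] ≤ᵐ[P] 1 := by
  set Q : Ω → ℝ := P[fun ω => ξ ω ^ 2 | m] with hQ
  have hξi : Integrable ξ P := Integrable.of_bound hξ C hC
  have hξ2 : Integrable (fun ω => ξ ω ^ 2) P := by
    refine Integrable.of_bound (hξ.pow 2) (C ^ 2) ?_
    filter_upwards [hC] with ω hω
    rw [Real.norm_of_nonneg (sq_nonneg _), ← sq_abs]
    exact pow_le_pow_left₀ (abs_nonneg _) hω 2
  have hQ0 : 0 ≤ᵐ[P] Q := condExp_nonneg (Filter.Eventually.of_forall fun ω => sq_nonneg _)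
  have hQm : StronglyMeasurable[m] Q := stronglyMeasurable_condExp
  have hrhs : Integrable (fun ω => 1 + θ * ξ ω + θ ^ 2 * ξ ω ^ 2) P :=
    ((integrable_const 1).add (hξi.const_mul θ)).add (hξ2.const_mul _)
  have hYi : Integrable (fun ω => Real.exp (Y ω)) P := by
    refine hrhs.mono' (Real.continuous_exp.comp_aestronglyMeasurable hY) ?_
    filter_upwards [hle] with ω hω
    rwa [Real.norm_of_nonneg (Real.exp_pos _).le]
  have hEm : StronglyMeasurable[m] fun ω => Real.exp (-(θ ^ 2 * Q ω)) :=
    Real.continuous_exp.comp_stronglyMeasurable ((hQm.const_mul _).neg)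
  have e : (fun ω => Real.exp (Y ω - θ ^ 2 * Q ω))
      = (fun ω => Real.exp (-(θ ^ 2 * Q ω))) * fun ω => Real.exp (Y ω) := by
    funext ω
    rw [Pi.mul_apply, ← Real.exp_add]; congr 1; ring
  have hprod : Integrable ((fun ω => Real.exp (-(θ ^ 2 * Q ω))) * fun ω => Real.exp (Y ω)) P := by
    refine hYi.mono ((hEm.mono hm).aestronglyMeasurable.mul hYi.1) ?_
    filter_upwards [hQ0] with ω hω
    have hω' : 0 ≤ Q ω := hω
    rw [Pi.mul_apply, norm_mul]
    refine mul_le_of_le_one_left (norm_nonneg _) ?_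
    rw [Real.norm_of_nonneg (Real.exp_pos _).le, Real.exp_le_one_iff]
    have := mul_nonneg (sq_nonneg θ) hω'
    linarith
  rw [e]
  have h1 := condExp_mul_of_stronglyMeasurable_left hEm hprod hYi
  have h2 := condExp_mono (m := m) hYi hrhs hle
  have h3 : P[fun ω => 1 + θ * ξ ω + θ ^ 2 * ξ ω ^ 2 | m]
      =ᵐ[P] fun ω => 1 + θ ^ 2 * Q ω := by
    have a1 := condExp_add ((integrable_const (1 : ℝ)).add (hξi.const_mul θ))
      (hξ2.const_mul (θ ^ 2)) m
    have a2 := condExp_add (integrable_const (1 : ℝ)) (hξi.const_mul θ) (μ := P) m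
    have a3 := condExp_smul (μ := P) θ ξ m
    have a4 := condExp_smul (μ := P) (θ ^ 2) (fun ω => ξ ω ^ 2) m
    filter_upwards [a1, a2, a3, a4, h0] with ω b1 b2 b3 b4 b5
    refine b1.trans ?_
    rw [Pi.add_apply, b2, Pi.add_apply, condExp_const hm]
    refine (congrArg₂ (fun x y => 1 + x + y) b3 b4).trans ?_
    simp [b5, hQ]
  filter_upwards [h1, h2, h3, hQ0] with ω b1 b2 b3 b4
  rw [b1, Pi.mul_apply, Pi.one_apply]
  rw [b3] at b2
  have h4 := Real.add_one_le_exp (θ ^ 2 * Q ω)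
  calc Real.exp (-(θ ^ 2 * Q ω)) * (P[fun ω => Real.exp (Y ω) | m]) ω
      ≤ Real.exp (-(θ ^ 2 * Q ω)) * Real.exp (θ ^ 2 * Q ω) :=
        mul_le_mul_of_nonneg_left (by linarith) (Real.exp_pos _).le
    _ = 1 := by rw [← Real.exp_add]; simp

/-- Chernoff's bound on an event, with the variance proxy `v` and the scale `A`. -/
lemma measureReal_inter_le_of_mgf {m0 : MeasurableSpace Ω} {P : Measure Ω} [IsProbabilityMeasure P]
    {W : Ω → ℝ} {B : Set Ω} (hB : MeasurableSet B) {K v A κ : ℝ} (hv : 0 ≤ v)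
    (hA : 0 < A) (hκ : 0 < κ)
    (hint : ∀ l, 0 < l → l ≤ 1 / A → Integrable (fun ω => Real.exp (l * W ω)) P)
    (hmgf : ∀ l, 0 < l → l ≤ 1 / A → ∫ ω in B, Real.exp (l * W ω) ∂P ≤ K * Real.exp (κ * l ^ 2 * v))
    {t : ℝ} (ht : 0 < t) :
    P.real ({ω | t < W ω} ∩ B) ≤ K * Real.exp (-(t ^ 2 / (4 * κ * v + 2 * A * t))) := by
  set l := t / (2 * κ * v + A * t) with hl
  have hden : 0 < 2 * κ * v + A * t := by positivity
  have hl0 : 0 < l := div_pos ht hden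
  have hlA : l ≤ 1 / A := by
    rw [hl, div_le_div_iff₀ hden hA]
    nlinarith [mul_nonneg hκ.le hv]
  have h1 : Real.exp (l * t) * P.real ({ω | t < W ω} ∩ B) ≤ ∫ ω in B, Real.exp (l * W ω) ∂P := by
    have h2 := mul_meas_ge_le_integral_of_nonneg (μ := P.restrict B)
      (f := fun ω => Real.exp (l * W ω)) (Filter.Eventually.of_forall fun ω => (Real.exp_pos _).le)
      (hint l hl0 hlA).integrableOn (Real.exp (l * t))
    refine le_trans (mul_le_mul_of_nonneg_left ?_ (Real.exp_pos _).le) h2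
    rw [Measure.real, Measure.real, Measure.restrict_apply' hB]
    refine ENNReal.toReal_mono (measure_ne_top _ _) (measure_mono ?_)
    rintro ω ⟨h3, h4⟩
    refine ⟨?_, h4⟩
    exact Real.exp_le_exp.2 (mul_le_mul_of_nonneg_left (le_of_lt h3) hl0.le)
  have h2 := h1.trans (hmgf l hl0 hlA)
  have h3 : P.real ({ω | t < W ω} ∩ B) ≤ K * Real.exp (κ * l ^ 2 * v) * Real.exp (-(l * t)) := by
    rw [Real.exp_neg, ← div_eq_mul_inv, le_div_iff₀ (Real.exp_pos _), mul_comm]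
    exact h2
  rw [mul_assoc, ← Real.exp_add] at h3
  refine h3.trans ?_
  have hK : 0 ≤ K := by
    have h4 : 0 ≤ K * Real.exp (κ * l ^ 2 * v) :=
      (integral_nonneg fun ω => (Real.exp_pos _).le).trans (hmgf l hl0 hlA)
    exact nonneg_of_mul_nonneg_left h4 (Real.exp_pos _)
  refine mul_le_mul_of_nonneg_left (Real.exp_le_exp.2 ?_) hK
  have h5 : l * (2 * κ * v + A * t) = t := div_mul_cancel₀ _ hden.ne'
  have h6 : t ^ 2 / (4 * κ * v + 2 * A * t) = l * t / 2 := by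
    rw [hl]; field_simp; ring
  rw [h6]
  nlinarith [mul_pos hl0 ht, mul_pos hl0 hA]

end Exponential

/-! ### Exponential moments of sums of finitely dependent variables -/

section Blocks

variable {Ω : Type*} {dt : ℕ} {ε : ℤ → Ω → Fin dt → ℝ}

/-- The `b`-th block of length `k` of the index set `{1, …, n}`. -/
def block (n k b : ℕ) : Finset ℕ := (Finset.Icc 1 n).filter fun i => i / k = b

lemma card_block_le {k : ℕ} (hk : 1 ≤ k) (n b : ℕ) : (block n k b).card ≤ k := by
  have h : block n k b ⊆ Finset.Ico (b * k) (b * k + k) := by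
    intro i hi
    obtain ⟨-, rfl⟩ := Finset.mem_filter.1 hi
    rw [Finset.mem_Ico]
    have h1 := Nat.div_add_mod i k
    have h2 := Nat.mod_lt i (by omega : k > 0)
    rw [mul_comm] at h1
    omega
  simpa using Finset.card_le_card h

lemma sum_block {β : Type*} [AddCommMonoid β] (n k : ℕ) (g : ℕ → β) :
    ∑ b ∈ Finset.range (n / k + 1), ∑ i ∈ block n k b, g i = ∑ i ∈ Finset.Icc 1 n, g i := by
  refine Finset.sum_fiberwise_of_maps_to (fun i hi => ?_) g
  rw [Finset.mem_range, Nat.lt_succ_iff]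
  exact Nat.div_le_div_right (Finset.mem_Icc.1 hi).2

lemma stronglyMeasurable_sum_block (n : ℕ) {k : ℕ} (hk : 1 ≤ k) {V : ℕ → Ω → ℝ}
    (hV : ∀ i ∈ Finset.Icc 1 n, StronglyMeasurable[sig ε (Set.Ico ((i : ℤ) - k) i)] (V i))
    (b : ℕ) :
    StronglyMeasurable[sig ε (Set.Ico (((b : ℤ) - 1) * k) (((b : ℤ) + 1) * k))]
      fun ω => ∑ i ∈ block n k b, V i ω := by
  refine Finset.stronglyMeasurable_fun_sum _ fun i hi =>
    (hV i (Finset.mem_filter.1 hi).1).mono (sig_mono ε ?_)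
  obtain ⟨-, rfl⟩ := Finset.mem_filter.1 hi
  have h1 := Nat.div_add_mod i k
  have h2 := Nat.mod_lt i (by omega : k > 0)
  have h3 : (k : ℤ) * ((i / k : ℕ) : ℤ) + ((i % k : ℕ) : ℤ) = i := by exact_mod_cast h1
  refine Set.Ico_subset_Ico ?_ ?_
  · nlinarith
  · have : ((i % k : ℕ) : ℤ) < k := by exact_mod_cast h2
    nlinarith

variable [MeasurableSpace Ω] {P : Measure Ω} [IsProbabilityMeasure P]

/-- Blocks of equal parity are independent. -/
lemma integral_exp_parity_blocks_le (hε : IsInnovation P ε) (k : ℕ) {T : ℕ → Ω → ℝ}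
    (hT : ∀ b : ℕ,
      StronglyMeasurable[sig ε (Set.Ico (((b : ℤ) - 1) * k) (((b : ℤ) + 1) * k))] (T b))
    {a : ℕ → ℝ}
    (hexp : ∀ b, ∫ ω, Real.exp (2 * T b ω) ∂P ≤ Real.exp (a b)) (r N : ℕ) :
    ∫ ω, Real.exp (∑ b ∈ (Finset.range N).filter (fun b => b % 2 = r), 2 * T b ω) ∂P
      ≤ Real.exp (∑ b ∈ (Finset.range N).filter (fun b => b % 2 = r), a b) := by
  induction N with
  | zero => simp
  | succ N ih =>
    rw [Finset.range_add_one, Finset.filter_insert]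
    split_ifs with hN
    · have hnot : N ∉ (Finset.range N).filter (fun b => b % 2 = r) := by simp
      simp only [Finset.sum_insert hnot, Real.exp_add]
      have hm1 : StronglyMeasurable[sig ε (Set.Ici (((N : ℤ) - 1) * k))]
          fun ω => Real.exp (2 * T N ω) :=
        Real.continuous_exp.comp_stronglyMeasurable
          (((hT N).mono (sig_mono ε fun x hx => hx.1)).const_mul 2)
      have hm2 : StronglyMeasurable[sig ε (Set.Iio (((N : ℤ) - 1) * k))]
          fun ω => Real.exp (∑ b ∈ (Finset.range N).filter (fun b => b % 2 = r), 2 * T b ω) := by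
        refine Real.continuous_exp.comp_stronglyMeasurable
          (Finset.stronglyMeasurable_fun_sum _ fun b hb => ?_)
        refine ((hT b).mono (sig_mono ε fun x hx => ?_)).const_mul 2
        obtain ⟨hb1, hb2⟩ := Finset.mem_filter.1 hb
        have hb3 : b + 1 ≤ N - 1 ∧ 1 ≤ N := by
          have := Finset.mem_range.1 hb1
          omega
        have hb4 : ((b : ℤ) + 1) ≤ (N : ℤ) - 1 := by omega
        exact lt_of_lt_of_le hx.2 (mul_le_mul_of_nonneg_right hb4 (by positivity))
      have hind : IndepFun (fun ω => Real.exp (2 * T N ω))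
          (fun ω => Real.exp (∑ b ∈ (Finset.range N).filter (fun b => b % 2 = r), 2 * T b ω))
            P := by
        have h := indep_sig hε (S := Set.Ici (((N : ℤ) - 1) * k))
          (T := Set.Iio (((N : ℤ) - 1) * k)) (Set.disjoint_left.2 fun x hx hx' =>
            (not_lt.2 (show _ ≤ x from hx)) hx')
        exact indep_of_indep_of_le_left (indep_of_indep_of_le_right h hm2.measurable.comap_le)
          hm1.measurable.comap_le
      rw [hind.integral_fun_mul_eq_mul_integral
        (hm1.mono (sig_le hε.measurable _)).aestronglyMeasurable
        (hm2.mono (sig_le hε.measurable _)).aestronglyMeasurable]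
      exact mul_le_mul (hexp N) ih (integral_nonneg fun _ => (Real.exp_pos _).le)
        (Real.exp_pos _).le
    · exact ih

/-- Sums of blocks each of which shares innovations only with its two neighbours. -/
lemma integral_exp_sum_blocks_le (hε : IsInnovation P ε) (k : ℕ) {T : ℕ → Ω → ℝ}
    (hT : ∀ b : ℕ,
      StronglyMeasurable[sig ε (Set.Ico (((b : ℤ) - 1) * k) (((b : ℤ) + 1) * k))] (T b))
    {C : ℕ → ℝ} (hC : ∀ b, ∀ᵐ ω ∂P, |T b ω| ≤ C b) {a : ℕ → ℝ} (ha : ∀ b, 0 ≤ a b)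
    (hexp : ∀ b, ∫ ω, Real.exp (2 * T b ω) ∂P ≤ Real.exp (a b)) (N : ℕ) :
    ∫ ω, Real.exp (∑ b ∈ Finset.range N, T b ω) ∂P ≤ Real.exp (∑ b ∈ Finset.range N, a b) := by
  let s : ℕ → Finset ℕ := fun r => (Finset.range N).filter (fun b => b % 2 = r)
  have hm : ∀ b, AEStronglyMeasurable (T b) P := fun b =>
    ((hT b).mono (sig_le hε.measurable _)).aestronglyMeasurable
  have hint : ∀ r, Integrable (fun ω => Real.exp (∑ b ∈ s r, 2 * T b ω)) P := by
    intro r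
    refine integrable_exp_of_ae_le (C := ∑ b ∈ s r, 2 * C b)
      (Finset.aestronglyMeasurable_fun_sum _ fun b _ => (hm b).const_mul 2) ?_
    filter_upwards [ae_all_iff.2 hC] with ω hω
    exact Finset.sum_le_sum fun b _ => by linarith [(abs_le.1 (hω b)).2]
  have hsplit : ∀ g : ℕ → ℝ, ∑ b ∈ Finset.range N, g b = ∑ b ∈ s 0, g b + ∑ b ∈ s 1, g b := by
    intro g
    rw [← Finset.sum_filter_add_sum_filter_not (Finset.range N) (fun b => b % 2 = 0) g]
    congr 2
    exact Finset.filter_congr fun b _ => by omega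
  have hle : ∀ r, ∑ b ∈ s r, a b ≤ ∑ b ∈ Finset.range N, a b := fun r =>
    Finset.sum_le_sum_of_subset_of_nonneg (Finset.filter_subset _ _) fun b _ _ => ha b
  have hpt : ∀ ω, Real.exp (∑ b ∈ Finset.range N, T b ω)
      ≤ (Real.exp (∑ b ∈ s 0, 2 * T b ω) + Real.exp (∑ b ∈ s 1, 2 * T b ω)) / 2 := by
    intro ω
    rw [hsplit, ← Finset.mul_sum, ← Finset.mul_sum, Real.exp_add, two_mul, two_mul, Real.exp_add,
      Real.exp_add]
    nlinarith [sq_nonneg (Real.exp (∑ b ∈ s 0, T b ω) - Real.exp (∑ b ∈ s 1, T b ω))]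
  calc ∫ ω, Real.exp (∑ b ∈ Finset.range N, T b ω) ∂P
      ≤ ∫ ω, (Real.exp (∑ b ∈ s 0, 2 * T b ω) + Real.exp (∑ b ∈ s 1, 2 * T b ω)) / 2 ∂P :=
        integral_mono_of_nonneg (Filter.Eventually.of_forall fun ω => (Real.exp_pos _).le)
          (((hint 0).add (hint 1)).div_const 2) (Filter.Eventually.of_forall hpt)
    _ = ((∫ ω, Real.exp (∑ b ∈ s 0, 2 * T b ω) ∂P) + ∫ ω, Real.exp (∑ b ∈ s 1, 2 * T b ω) ∂P)
        / 2 := by rw [integral_div, integral_add (hint 0) (hint 1)]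
    _ ≤ (Real.exp (∑ b ∈ Finset.range N, a b) + Real.exp (∑ b ∈ Finset.range N, a b)) / 2 := by
        have h0 := (integral_exp_parity_blocks_le hε k hT hexp 0 N).trans
          (Real.exp_le_exp.2 (hle 0))
        have h1 := (integral_exp_parity_blocks_le hε k hT hexp 1 N).trans
          (Real.exp_le_exp.2 (hle 1))
        have h0' : ∫ ω, Real.exp (∑ b ∈ s 0, 2 * T b ω) ∂P ≤ _ := h0
        have h1' : ∫ ω, Real.exp (∑ b ∈ s 1, 2 * T b ω) ∂P ≤ _ := h1
        linarith
    _ = _ := by ring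

/-- Exponential moments of a sum of nonnegative bounded `k`-dependent variables. -/
lemma integral_exp_sum_le_of_nonneg (hε : IsInnovation P ε) (n : ℕ) {k : ℕ} (hk : 1 ≤ k)
    {V : ℕ → Ω → ℝ}
    (hV : ∀ i ∈ Finset.Icc 1 n, StronglyMeasurable[sig ε (Set.Ico ((i : ℤ) - k) i)] (V i))
    {K : ℝ} (hK0 : 0 ≤ K) (h0 : ∀ i ∈ Finset.Icc 1 n, 0 ≤ᵐ[P] V i)
    (hK : ∀ i ∈ Finset.Icc 1 n, ∀ᵐ ω ∂P, V i ω ≤ K) {θ : ℝ} (hθ : 0 ≤ θ)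
    (hθK : 2 * θ * (k * K) ≤ 1) :
    ∫ ω, Real.exp (θ * ∑ i ∈ Finset.Icc 1 n, V i ω) ∂P
      ≤ Real.exp (4 * θ * ∑ i ∈ Finset.Icc 1 n, ∫ ω, V i ω ∂P) := by
  have hVm : ∀ i ∈ Finset.Icc 1 n, AEStronglyMeasurable (V i) P := fun i hi =>
    ((hV i hi).mono (sig_le hε.measurable _)).aestronglyMeasurable
  have hVi : ∀ i ∈ Finset.Icc 1 n, Integrable (V i) P := fun i hi => by
    refine Integrable.of_bound (hVm i hi) K ?_
    filter_upwards [h0 i hi, hK i hi] with ω h1 h2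
    rwa [Real.norm_of_nonneg h1]
  have hblk : ∀ {i b}, i ∈ block n k b → i ∈ Finset.Icc 1 n := fun h => (Finset.mem_filter.1 h).1
  have hbd : ∀ b, ∀ᵐ ω ∂P, 0 ≤ ∑ i ∈ block n k b, V i ω ∧ ∑ i ∈ block n k b, V i ω ≤ k * K := by
    intro b
    filter_upwards [(Finset.eventually_all _).2 h0, (Finset.eventually_all _).2 hK] with ω h1 h2
    refine ⟨Finset.sum_nonneg fun i hi => h1 i (hblk hi), ?_⟩
    calc ∑ i ∈ block n k b, V i ω ≤ ∑ i ∈ block n k b, K :=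
          Finset.sum_le_sum fun i hi => h2 i (hblk hi)
      _ = (block n k b).card * K := by simp
      _ ≤ k * K := by
        have := card_block_le hk n b
        gcongr
  have key := integral_exp_sum_blocks_le hε k (T := fun b ω => θ * ∑ i ∈ block n k b, V i ω)
    (fun b => (stronglyMeasurable_sum_block n hk hV b).const_mul θ)
    (C := fun _ => θ * (k * K)) (fun b => ?_)
    (a := fun b => 4 * θ * ∑ i ∈ block n k b, ∫ ω, V i ω ∂P) (fun b => ?_) (fun b => ?_)
    (n / k + 1)
  · rw [← Finset.mul_sum, sum_block] at key
    refine le_trans (le_of_eq (integral_congr_ae (Filter.Eventually.of_forall fun ω => ?_))) key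
    simp only
    rw [← Finset.mul_sum, sum_block]
  · filter_upwards [hbd b] with ω hω
    rw [abs_of_nonneg (mul_nonneg hθ hω.1)]
    exact mul_le_mul_of_nonneg_left hω.2 hθ
  · exact mul_nonneg (by positivity) (Finset.sum_nonneg fun i hi =>
      integral_nonneg_of_ae (h0 i (hblk hi)))
  · have hsum : Integrable (fun ω => ∑ i ∈ block n k b, V i ω) P :=
      integrable_finsetSum _ fun i hi => hVi i (hblk hi)
    have hpt : ∀ᵐ ω ∂P, Real.exp (2 * (θ * ∑ i ∈ block n k b, V i ω))
        ≤ 1 + 4 * θ * ∑ i ∈ block n k b, V i ω := by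
      filter_upwards [hbd b] with ω hω
      have h1 : 0 ≤ 2 * (θ * ∑ i ∈ block n k b, V i ω) := by
        have := mul_nonneg hθ hω.1; linarith
      have h2 : 2 * (θ * ∑ i ∈ block n k b, V i ω) ≤ 1 := by
        have := mul_le_mul_of_nonneg_left hω.2 hθ; linarith
      have h3 := exp_le_of_abs_le_one (abs_le.2 ⟨by linarith, h2⟩)
      nlinarith
    calc ∫ ω, Real.exp (2 * (θ * ∑ i ∈ block n k b, V i ω)) ∂P
        ≤ ∫ ω, (1 + 4 * θ * ∑ i ∈ block n k b, V i ω) ∂P :=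
          integral_mono_of_nonneg (Filter.Eventually.of_forall fun ω => (Real.exp_pos _).le)
            ((integrable_const 1).add (hsum.const_mul _)) hpt
      _ = 1 + 4 * θ * ∑ i ∈ block n k b, ∫ ω, V i ω ∂P := by
          rw [integral_add (integrable_const 1) (hsum.const_mul _), integral_const_mul,
            integral_finsetSum _ fun i hi => hVi i (hblk hi)]
          simp
      _ ≤ _ := by
          rw [add_comm]; exact Real.add_one_le_exp _

/-- Exponential moments of a sum of bounded centred `k`-dependent variables, in terms of the
variances of the sums over blocks of length `k`. -/
lemma integral_exp_sum_le_of_centered (hε : IsInnovation P ε) (n : ℕ) {k : ℕ} (hk : 1 ≤ k)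
    {V : ℕ → Ω → ℝ}
    (hV : ∀ i ∈ Finset.Icc 1 n, StronglyMeasurable[sig ε (Set.Ico ((i : ℤ) - k) i)] (V i))
    {K : ℝ} (hK0 : 0 ≤ K) (hK : ∀ i ∈ Finset.Icc 1 n, ∀ᵐ ω ∂P, |V i ω| ≤ K)
    (hmean : ∀ i ∈ Finset.Icc 1 n, ∫ ω, V i ω ∂P = 0) {l : ℝ}
    (hlK : 2 * |l| * (k * K) ≤ 1) :
    ∫ ω, Real.exp (l * ∑ i ∈ Finset.Icc 1 n, V i ω) ∂P
      ≤ Real.exp (4 * l ^ 2 * ∑ b ∈ Finset.range (n / k + 1),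
          ∫ ω, (∑ i ∈ block n k b, V i ω) ^ 2 ∂P) := by
  have hVm : ∀ i ∈ Finset.Icc 1 n, AEStronglyMeasurable (V i) P := fun i hi =>
    ((hV i hi).mono (sig_le hε.measurable _)).aestronglyMeasurable
  have hVi : ∀ i ∈ Finset.Icc 1 n, Integrable (V i) P := fun i hi =>
    Integrable.of_bound (hVm i hi) K (hK i hi)
  have hblk : ∀ {i b}, i ∈ block n k b → i ∈ Finset.Icc 1 n := fun h => (Finset.mem_filter.1 h).1
  have hbd : ∀ b, ∀ᵐ ω ∂P, |∑ i ∈ block n k b, V i ω| ≤ k * K := by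
    intro b
    filter_upwards [(Finset.eventually_all _).2 hK] with ω h2
    calc |∑ i ∈ block n k b, V i ω| ≤ ∑ i ∈ block n k b, |V i ω| := Finset.abs_sum_le_sum_abs _ _
      _ ≤ ∑ i ∈ block n k b, K := Finset.sum_le_sum fun i hi => h2 i (hblk hi)
      _ = (block n k b).card * K := by simp
      _ ≤ k * K := by
        have := card_block_le hk n b
        gcongr
  have key := integral_exp_sum_blocks_le hε k (T := fun b ω => l * ∑ i ∈ block n k b, V i ω)
    (fun b => (stronglyMeasurable_sum_block n hk hV b).const_mul l)
    (C := fun _ => |l| * (k * K)) (fun b => ?_)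
    (a := fun b => 4 * l ^ 2 * ∫ ω, (∑ i ∈ block n k b, V i ω) ^ 2 ∂P) (fun b => ?_) (fun b => ?_)
    (n / k + 1)
  · rw [← Finset.mul_sum] at key
    refine le_trans (le_of_eq (integral_congr_ae (Filter.Eventually.of_forall fun ω => ?_))) key
    simp only
    rw [← Finset.mul_sum, sum_block]
  · filter_upwards [hbd b] with ω hω
    rw [abs_mul]
    exact mul_le_mul_of_nonneg_left hω (abs_nonneg _)
  · exact mul_nonneg (by positivity) (integral_nonneg fun _ => sq_nonneg _)
  · have hsum : Integrable (fun ω => ∑ i ∈ block n k b, V i ω) P :=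
      integrable_finsetSum _ fun i hi => hVi i (hblk hi)
    have hsq : Integrable (fun ω => (∑ i ∈ block n k b, V i ω) ^ 2) P := by
      refine Integrable.of_bound (hsum.1.pow 2) ((k * K) ^ 2) ?_
      filter_upwards [hbd b] with ω hω
      rw [Real.norm_of_nonneg (sq_nonneg _), ← sq_abs]
      exact pow_le_pow_left₀ (abs_nonneg _) hω 2
    have hpt : ∀ᵐ ω ∂P, Real.exp (2 * (l * ∑ i ∈ block n k b, V i ω))
        ≤ 1 + 2 * l * (∑ i ∈ block n k b, V i ω) + 4 * l ^ 2 * (∑ i ∈ block n k b, V i ω) ^ 2 := by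
      filter_upwards [hbd b] with ω hω
      have h2 : |2 * (l * ∑ i ∈ block n k b, V i ω)| ≤ 1 := by
        rw [abs_mul, abs_mul, abs_two]
        have := mul_le_mul_of_nonneg_left hω (abs_nonneg l)
        linarith
      have h3 := exp_le_of_abs_le_one h2
      nlinarith
    calc ∫ ω, Real.exp (2 * (l * ∑ i ∈ block n k b, V i ω)) ∂P
        ≤ ∫ ω, (1 + 2 * l * (∑ i ∈ block n k b, V i ω)
            + 4 * l ^ 2 * (∑ i ∈ block n k b, V i ω) ^ 2) ∂P :=
          integral_mono_of_nonneg (Filter.Eventually.of_forall fun ω => (Real.exp_pos _).le)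
            (((integrable_const 1).add (hsum.const_mul _)).add (hsq.const_mul _)) hpt
      _ = 1 + 4 * l ^ 2 * ∫ ω, (∑ i ∈ block n k b, V i ω) ^ 2 ∂P := by
          have hadd : Integrable (fun ω => 1 + 2 * l * ∑ i ∈ block n k b, V i ω) P :=
            (integrable_const 1).add (hsum.const_mul _)
          rw [integral_add hadd (hsq.const_mul _),
            integral_add (integrable_const 1) (hsum.const_mul _), integral_const_mul,
            integral_const_mul, integral_finsetSum _ fun i hi => hVi i (hblk hi)]
          rw [Finset.sum_eq_zero fun i hi => hmean i (hblk hi)]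
          simp
      _ ≤ _ := by
          rw [add_comm]; exact Real.add_one_le_exp _

end Blocks

/-! ### The good event and its probability -/

section GoodEvent

/-- Schur's test for the squared `ℓ²` norm of a convolution. -/
lemma tsum_sq_sum_mul_le {I : Finset ℕ} {a : ℕ → ℝ} {δ : ℕ → ℕ → ℝ}
    (hδ : ∀ i k, 0 ≤ δ i k) {β : ℝ} (hβ : 0 ≤ β) (hrow : ∀ k, ∑ i ∈ I, δ i k ≤ β)
    (hcol : ∀ i ∈ I, ∑' k, ENNReal.ofReal (δ i k) ≤ ENNReal.ofReal β) :
    ∑' k, ENNReal.ofReal ((∑ i ∈ I, a i * δ i k) ^ 2)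
      ≤ ENNReal.ofReal (β ^ 2 * ∑ i ∈ I, a i ^ 2) := by
  have hpt : ∀ k, (∑ i ∈ I, a i * δ i k) ^ 2 ≤ ∑ i ∈ I, β * a i ^ 2 * δ i k := by
    intro k
    have h1 := Finset.sum_sq_le_sum_mul_sum_of_sq_le_mul I (r := fun i => a i * δ i k)
      (f := fun i => δ i k) (g := fun i => a i ^ 2 * δ i k) (fun i _ => hδ i k)
      (fun i _ => mul_nonneg (sq_nonneg _) (hδ i k)) (fun i _ => le_of_eq (by ring))
    have h2 : 0 ≤ ∑ i ∈ I, a i ^ 2 * δ i k :=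
      Finset.sum_nonneg fun i _ => mul_nonneg (sq_nonneg _) (hδ i k)
    refine h1.trans ((mul_le_mul_of_nonneg_right (hrow k) h2).trans_eq ?_)
    rw [Finset.mul_sum]
    exact Finset.sum_congr rfl fun i _ => by ring
  have hnn : ∀ i, 0 ≤ β * a i ^ 2 := fun i => mul_nonneg hβ (sq_nonneg _)
  calc ∑' k, ENNReal.ofReal ((∑ i ∈ I, a i * δ i k) ^ 2)
      ≤ ∑' k, ∑ i ∈ I, ENNReal.ofReal (β * a i ^ 2) * ENNReal.ofReal (δ i k) := by
        refine ENNReal.tsum_le_tsum fun k => ?_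
        refine (ENNReal.ofReal_le_ofReal (hpt k)).trans_eq ?_
        rw [ENNReal.ofReal_sum_of_nonneg fun i _ => mul_nonneg (hnn i) (hδ i k)]
        exact Finset.sum_congr rfl fun i _ => ENNReal.ofReal_mul (hnn i)
    _ = ∑ i ∈ I, ENNReal.ofReal (β * a i ^ 2) * ∑' k, ENNReal.ofReal (δ i k) := by
        rw [Summable.tsum_finsetSum fun i _ => ENNReal.summable]
        simp only [ENNReal.tsum_mul_left]
    _ ≤ ∑ i ∈ I, ENNReal.ofReal (β * a i ^ 2) * ENNReal.ofReal β :=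
        Finset.sum_le_sum fun i hi => mul_le_mul_right (hcol i hi) _
    _ = ENNReal.ofReal (β ^ 2 * ∑ i ∈ I, a i ^ 2) := by
        simp only [← ENNReal.ofReal_mul (hnn _)]
        rw [← ENNReal.ofReal_sum_of_nonneg fun i _ => mul_nonneg (hnn i) hβ, Finset.mul_sum]
        congr 1
        exact Finset.sum_congr rfl fun i _ => by ring

/-- The coefficients `Δ(i - m) 1{i - m > q}`, where `m = n - 1 - k`. -/
def tailCoeff (n q : ℕ) (Δ : ℕ → ℝ) (i k : ℕ) : ℝ :=
  if n + q ≤ i + k then Δ (i + k - n + 1) else 0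

lemma tailCoeff_nonneg {n q : ℕ} {Δ : ℕ → ℝ} (hΔ : ∀ k, 0 ≤ Δ k) (i k : ℕ) :
    0 ≤ tailCoeff n q Δ i k := by
  unfold tailCoeff; split_ifs; exacts [hΔ _, le_rfl]

lemma sum_tailCoeff_le {n q : ℕ} {Δ : ℕ → ℝ} (hΔ : ∀ k, 0 ≤ Δ k)
    (hs : Summable fun j => Δ (q + 1 + j)) (k : ℕ) :
    ∑ i ∈ Finset.Icc 1 n, tailCoeff n q Δ i k ≤ ∑' j, Δ (q + 1 + j) := by
  have e : ∑ i ∈ Finset.Icc 1 n, tailCoeff n q Δ i k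
      = ∑ i ∈ (Finset.Icc 1 n).filter (fun i => n + q ≤ i + k), Δ (q + 1 + (i + k - n - q)) := by
    rw [Finset.sum_filter]
    refine Finset.sum_congr rfl fun i _ => ?_
    unfold tailCoeff
    split_ifs with h
    · congr 1; omega
    · rfl
  have hinj : Set.InjOn (fun i => i + k - n - q)
      ((Finset.Icc 1 n).filter (fun i => n + q ≤ i + k) : Finset ℕ) := by
    intro i hi j hj hij
    simp only [Finset.coe_filter, Set.mem_ofPred_eq] at hi hj hij
    omega
  rw [e, ← Finset.sum_image (f := fun j => Δ (q + 1 + j)) hinj]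
  exact hs.sum_le_tsum _ fun j _ => hΔ _

lemma tsum_tailCoeff_le {n q : ℕ} {Δ : ℕ → ℝ} (hΔ : ∀ k, 0 ≤ Δ k)
    (hs : Summable fun j => Δ (q + 1 + j)) {i : ℕ} (hi : i ∈ Finset.Icc 1 n) :
    ∑' k, ENNReal.ofReal (tailCoeff n q Δ i k) ≤ ENNReal.ofReal (∑' j, Δ (q + 1 + j)) := by
  have hi' := Finset.mem_Icc.1 hi
  rw [ENNReal.ofReal_tsum_of_nonneg (fun j => hΔ _) hs,
    ← Summable.sum_add_tsum_nat_add' (k := n - i + q) ENNReal.summable,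
    Finset.sum_eq_zero fun k hk => ?_, zero_add]
  · refine ENNReal.tsum_le_tsum fun j => le_of_eq ?_
    rw [tailCoeff, if_pos (by omega)]
    congr 2; omega
  · have := Finset.mem_range.1 hk
    rw [tailCoeff, if_neg (by omega), ENNReal.ofReal_zero]

lemma lintegral_ofReal_condExp {Ω : Type*} {m m0 : MeasurableSpace Ω} {Q : Measure Ω} (hm : m ≤ m0)
    [IsProbabilityMeasure Q] {f : Ω → ℝ} (hf : Integrable f Q) (h0 : 0 ≤ᵐ[Q] f) :
    ∫⁻ ω, ENNReal.ofReal ((Q[f | m]) ω) ∂Q = ∫⁻ ω, ENNReal.ofReal (f ω) ∂Q := by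
  rw [← ofReal_integral_eq_lintegral_ofReal integrable_condExp (condExp_nonneg h0),
    integral_condExp hm, ofReal_integral_eq_lintegral_ofReal hf h0]

lemma lintegral_ofReal_sq {α : Type*} [MeasurableSpace α] (μ : Measure α) (f : α → ℝ) :
    ∫⁻ a, ENNReal.ofReal (f a ^ 2) ∂μ = eLpNorm f 2 μ ^ 2 := by
  have h := eLpNorm_nnreal_pow_eq_lintegral (μ := μ) (f := f) (p := 2) (by norm_num)
  simp only [NNReal.coe_ofNat, ENNReal.coe_ofNat, ENNReal.rpow_ofNat] at h
  rw [h]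
  refine lintegral_congr fun a => ?_
  rw [Real.enorm_eq_ofReal_abs, ← ENNReal.ofReal_pow (abs_nonneg _), sq_abs]

variable {Ω : Type*} {dt : ℕ} [MeasurableSpace Ω] {P : Measure Ω} {ε : ℤ → Ω → Fin dt → ℝ}

/-- The `E`-weighted functions `ψ_{i,k}` and `χ_{i,k}` bound, simultaneously over a class of
functions, the effect of resampling `ε_{i-1-k}` on the first and on the second conditional moment
of the `i`-th summand. -/
structure IsEnvelope (P : Measure Ω) (n : ℕ) (Δ : ℕ → ℝ) (C : ℝ) (E : ℕ → ℝ)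
    (ψ χ : ℕ → ℕ → Ω × Ω → ℝ) : Prop where
  weight_nonneg : ∀ i, 0 ≤ E i
  Δ_nonneg : ∀ k, 0 ≤ Δ k
  C_nonneg : 0 ≤ C
  ψ_measurable : ∀ i k, Measurable (ψ i k)
  χ_measurable : ∀ i k, Measurable (χ i k)
  ψ_nonneg : ∀ i k w, 0 ≤ ψ i k w
  χ_nonneg : ∀ i k w, 0 ≤ χ i k w
  ψ_le : ∀ i ∈ Finset.Icc 1 n, ∀ k, eLpNorm (ψ i k) 2 (P.prod P) ≤ ENNReal.ofReal (Δ (k + 1))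
  χ_le : ∀ i ∈ Finset.Icc 1 n, ∀ k,
    eLpNorm (χ i k) 1 (P.prod P) ≤ ENNReal.ofReal (Δ (k + 1)) * ENNReal.ofReal C

/-- The conditional expectation, given the innovations from time `m` on, of a function of the past
and of an independent copy, after integrating out the copy. -/
noncomputable def projBound (P : Measure Ω) (ε : ℤ → Ω → Fin dt → ℝ) (ψ : Ω × Ω → ℝ) (m : ℤ) :
    Ω → ℝ :=
  P[fun ω => ∫ ω', ψ (ω, ω') ∂P | sig ε (Set.Ici m)]

/-- The bound on the martingale increment that reveals the innovation at time `m = n - 1 - k`; only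
the summands `i` with `i - m > q` contribute. -/
noncomputable def tailSize (P : Measure Ω) (ε : ℤ → Ω → Fin dt → ℝ) (n q : ℕ) (E : ℕ → ℝ)
    (ψ : ℕ → ℕ → Ω × Ω → ℝ) (k : ℕ) (ω : Ω) : ℝ :=
  ∑ i ∈ Finset.Icc 1 n,
    if n + q ≤ i + k then E i * projBound P ε (ψ i (i + k - n)) ((n : ℤ) - (k + 1)) ω else 0

/-- On the good event the martingale increments with lags beyond `q` have quadratic variation and
predictable quadratic variation at most `c²`, and the conditional second moments are within `c²`,
in total, of their finite-range approximations of range `r`. -/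
def goodEvent (P : Measure Ω) (ε : ℤ → Ω → Fin dt → ℝ) (n q r : ℕ) (c : ℝ) (E : ℕ → ℝ)
    (ψ χ : ℕ → ℕ → Ω × Ω → ℝ) : Set Ω :=
  {ω | ∑' k : ℕ, ENNReal.ofReal (tailSize P ε n q E ψ k ω ^ 2) ≤ ENNReal.ofReal (c ^ 2)} ∩
  {ω | ∑' k : ℕ, ENNReal.ofReal
    ((P[fun ω => tailSize P ε n q E ψ k ω ^ 2 | sig ε (Set.Ici ((n : ℤ) - k))]) ω)
      ≤ ENNReal.ofReal (c ^ 2)} ∩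
  {ω | ∑' k : ℕ, ∑ i ∈ Finset.Icc 1 n,
    ENNReal.ofReal (E i ^ 2 * projBound P ε (χ i (r + k)) ((i : ℤ) - 1 - (r + k : ℕ)) ω)
      ≤ ENNReal.ofReal (c ^ 2)}

lemma stronglyMeasurable_projBound (ψ : Ω × Ω → ℝ) (m : ℤ) :
    StronglyMeasurable[sig ε (Set.Ici m)] (projBound P ε ψ m) :=
  stronglyMeasurable_condExp

lemma projBound_nonneg {ψ : Ω × Ω → ℝ} (hψ : ∀ w, 0 ≤ ψ w) (m : ℤ) : 0 ≤ᵐ[P] projBound P ε ψ m :=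
  condExp_nonneg (Filter.Eventually.of_forall fun _ => integral_nonneg fun _ => hψ _)

lemma measurable_projBound (hε : ∀ k, Measurable (ε k)) (ψ : Ω × Ω → ℝ) (m : ℤ) :
    Measurable (projBound P ε ψ m) :=
  ((stronglyMeasurable_projBound ψ m).mono (sig_le hε _)).measurable

lemma measurable_tailSize (hε : ∀ k, Measurable (ε k)) (n q : ℕ) (E : ℕ → ℝ)
    (ψ : ℕ → ℕ → Ω × Ω → ℝ) (k : ℕ) : Measurable (tailSize P ε n q E ψ k) := by
  refine Finset.measurable_fun_sum _ fun i _ => ?_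
  split_ifs
  · exact (measurable_projBound hε _ _).const_mul _
  · exact measurable_const

lemma measurableSet_goodEvent (hε : ∀ k, Measurable (ε k)) (n q r : ℕ) (c : ℝ) (E : ℕ → ℝ)
    (ψ χ : ℕ → ℕ → Ω × Ω → ℝ) : MeasurableSet (goodEvent P ε n q r c E ψ χ) := by
  refine (MeasurableSet.inter ?_ ?_).inter ?_
  · exact measurableSet_le (Measurable.tsum fun k =>
      ((measurable_tailSize hε n q E ψ k).pow_const 2).ennreal_ofReal) measurable_const
  · exact measurableSet_le (Measurable.tsum fun k =>
      (stronglyMeasurable_condExp.mono (sig_le hε _)).measurable.ennreal_ofReal) measurable_const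
  · exact measurableSet_le (Measurable.tsum fun k => Finset.measurable_fun_sum _ fun i _ =>
      ((measurable_projBound hε _ _).const_mul _).ennreal_ofReal) measurable_const

/-- Markov's inequality for the complement of a sublevel set. -/
lemma measure_compl_le_of_lintegral {Y : Ω → ℝ≥0∞} (hY : Measurable Y) {c A : ℝ} (hc : 0 < c)
    (hA : ∫⁻ ω, Y ω ∂P ≤ ENNReal.ofReal A) :
    P {ω | Y ω ≤ ENNReal.ofReal c}ᶜ ≤ ENNReal.ofReal (A / c) := by
  have h1 : P {ω | Y ω ≤ ENNReal.ofReal c}ᶜ ≤ P {ω | ENNReal.ofReal c ≤ Y ω} :=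
    measure_mono fun ω hω => (not_le.1 (show ¬ Y ω ≤ ENNReal.ofReal c from hω)).le
  refine h1.trans ((meas_ge_le_lintegral_div hY.aemeasurable (by simpa using hc)
    ENNReal.ofReal_ne_top).trans ?_)
  rw [ENNReal.ofReal_div_of_pos hc]
  exact ENNReal.div_le_div_right hA _

variable [IsProbabilityMeasure P]

/-- Integrating out the second variable does not increase the `L²` norm. -/
lemma eLpNorm_integral_snd_le {ψ : Ω × Ω → ℝ} (hψ : Measurable ψ) :
    eLpNorm (fun ω => ∫ ω', ψ (ω, ω') ∂P) 2 P ≤ eLpNorm ψ 2 (P.prod P) := by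
  rw [← ENNReal.pow_le_pow_left_iff two_ne_zero, ← lintegral_ofReal_sq, ← lintegral_ofReal_sq,
    lintegral_prod _ (hψ.pow_const 2).ennreal_ofReal.aemeasurable]
  refine lintegral_mono fun ω => ?_
  have h1 : ENNReal.ofReal ((∫ ω', ψ (ω, ω') ∂P) ^ 2) = ‖∫ ω', ψ (ω, ω') ∂P‖ₑ ^ 2 := by
    rw [Real.enorm_eq_ofReal_abs, ← ENNReal.ofReal_pow (abs_nonneg _), sq_abs]
  rw [h1, lintegral_ofReal_sq]
  refine pow_le_pow_left' ?_ 2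
  calc ‖∫ ω', ψ (ω, ω') ∂P‖ₑ ≤ ∫⁻ ω', ‖ψ (ω, ω')‖ₑ ∂P := enorm_integral_le_lintegral_enorm _
    _ = eLpNorm (fun ω' => ψ (ω, ω')) 1 P := eLpNorm_one_eq_lintegral_enorm.symm
    _ ≤ _ := eLpNorm_le_eLpNorm_of_exponent_le (by norm_num)
        (hψ.comp measurable_prodMk_left).aestronglyMeasurable

lemma eLpNorm_projBound_le {ψ : Ω × Ω → ℝ} (hψ : Measurable ψ) (m : ℤ) :
    eLpNorm (projBound P ε ψ m) 2 P ≤ eLpNorm ψ 2 (P.prod P) :=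
  (eLpNorm_condExp_le_eLpNorm _ (by norm_num)).trans (eLpNorm_integral_snd_le hψ)

lemma IsEnvelope.eLpNorm_tailSize_le {n : ℕ} {Δ : ℕ → ℝ} {C : ℝ} {E : ℕ → ℝ}
    {ψ χ : ℕ → ℕ → Ω × Ω → ℝ} (h : IsEnvelope P n Δ C E ψ χ) (hε : ∀ k, Measurable (ε k))
    (q k : ℕ) :
    eLpNorm (tailSize P ε n q E ψ k) 2 P
      ≤ ENNReal.ofReal (∑ i ∈ Finset.Icc 1 n, E i * tailCoeff n q Δ i k) := by
  let Y : ℕ → Ω → ℝ := fun i ω =>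
    if n + q ≤ i + k then E i * projBound P ε (ψ i (i + k - n)) ((n : ℤ) - (k + 1)) ω else 0
  have hY : ∀ i, Measurable (Y i) := by
    intro i
    by_cases hc : n + q ≤ i + k
    · simp only [Y, hc, if_true]; exact (measurable_projBound hε _ _).const_mul _
    · simp only [Y, hc, if_false]; exact measurable_const
  have e : tailSize P ε n q E ψ k = ∑ i ∈ Finset.Icc 1 n, Y i := by
    funext ω; simp [tailSize, Y]
  rw [e, ENNReal.ofReal_sum_of_nonneg fun i _ =>
    mul_nonneg (h.weight_nonneg i) (tailCoeff_nonneg h.Δ_nonneg i k)]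
  refine (eLpNorm_sum_le (fun i _ => (hY i).aestronglyMeasurable) (by norm_num)).trans
    (Finset.sum_le_sum fun i hi => ?_)
  by_cases hc : n + q ≤ i + k
  · have e2 : Y i = E i • projBound P ε (ψ i (i + k - n)) ((n : ℤ) - (k + 1)) := by
      funext ω; simp [Y, hc]
    rw [e2, eLpNorm_const_smul, Real.enorm_eq_ofReal (h.weight_nonneg i), tailCoeff, if_pos hc,
      ENNReal.ofReal_mul (h.weight_nonneg i)]
    exact mul_le_mul_right ((eLpNorm_projBound_le (h.ψ_measurable _ _) _).trans (h.ψ_le i hi _)) _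
  · have e2 : Y i = 0 := by funext ω; simp [Y, hc]
    rw [e2, eLpNorm_zero]; exact bot_le

lemma IsEnvelope.memLp_tailSize {n : ℕ} {Δ : ℕ → ℝ} {C : ℝ} {E : ℕ → ℝ}
    {ψ χ : ℕ → ℕ → Ω × Ω → ℝ} (h : IsEnvelope P n Δ C E ψ χ) (hε : ∀ k, Measurable (ε k))
    (q k : ℕ) : MemLp (tailSize P ε n q E ψ k) 2 P :=
  ⟨(measurable_tailSize hε n q E ψ k).aestronglyMeasurable,
    (h.eLpNorm_tailSize_le hε q k).trans_lt ENNReal.ofReal_lt_top⟩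

/-- The expected total quadratic variation of the martingale increments with lags beyond `q`. -/
lemma IsEnvelope.lintegral_tsum_tailSize_le {n : ℕ} {Δ : ℕ → ℝ} {C : ℝ} {E : ℕ → ℝ}
    {ψ χ : ℕ → ℕ → Ω × Ω → ℝ} (h : IsEnvelope P n Δ C E ψ χ) (hε : ∀ k, Measurable (ε k))
    {q : ℕ} (hs : Summable fun j => Δ (q + 1 + j)) :
    ∑' k, ∫⁻ ω, ENNReal.ofReal (tailSize P ε n q E ψ k ω ^ 2) ∂P
      ≤ ENNReal.ofReal ((∑' j, Δ (q + 1 + j)) ^ 2 * ∑ i ∈ Finset.Icc 1 n, E i ^ 2) := by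
  refine le_trans (ENNReal.tsum_le_tsum fun k => ?_)
    (tsum_sq_sum_mul_le (tailCoeff_nonneg h.Δ_nonneg)
      (tsum_nonneg fun j => h.Δ_nonneg _) (sum_tailCoeff_le h.Δ_nonneg hs)
      fun i hi => tsum_tailCoeff_le h.Δ_nonneg hs hi)
  rw [lintegral_ofReal_sq, ENNReal.ofReal_pow (Finset.sum_nonneg fun i _ =>
    mul_nonneg (h.weight_nonneg i) (tailCoeff_nonneg h.Δ_nonneg i k))]
  exact pow_le_pow_left' (h.eLpNorm_tailSize_le hε q k) 2

lemma IsEnvelope.measureReal_compl_goodEvent_le {n : ℕ} {Δ : ℕ → ℝ} {C : ℝ} {E : ℕ → ℝ}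
    {ψ χ : ℕ → ℕ → Ω × Ω → ℝ} (h : IsEnvelope P n Δ C E ψ χ) (hε : ∀ k, Measurable (ε k))
    {q r : ℕ} (hs : Summable fun j => Δ (q + 1 + j)) (hr : Summable fun j => Δ (r + 1 + j))
    {c : ℝ} (hc : 0 < c) :
    P.real (goodEvent P ε n q r c E ψ χ)ᶜ
      ≤ (2 * (∑' j, Δ (q + 1 + j)) ^ 2 + C * ∑' j, Δ (r + 1 + j))
        * (∑ i ∈ Finset.Icc 1 n, E i ^ 2) / c ^ 2 := by
  set S := ∑ i ∈ Finset.Icc 1 n, E i ^ 2 with hS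
  have hS0 : 0 ≤ S := Finset.sum_nonneg fun i _ => sq_nonneg _
  set βq := ∑' j, Δ (q + 1 + j) with hβq
  set βr := ∑' j, Δ (r + 1 + j) with hβr
  have hβr0 : 0 ≤ βr := tsum_nonneg fun j => h.Δ_nonneg _
  have hC := h.C_nonneg
  have hc2 : 0 < c ^ 2 := by positivity
  have m1 : ∀ k, Measurable fun ω => ENNReal.ofReal (tailSize P ε n q E ψ k ω ^ 2) := fun k =>
    ((measurable_tailSize hε n q E ψ k).pow_const 2).ennreal_ofReal
  have m2 : ∀ k : ℕ, Measurable fun ω => ENNReal.ofReal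
      ((P[fun ω => tailSize P ε n q E ψ k ω ^ 2 | sig ε (Set.Ici ((n : ℤ) - k))]) ω) := fun k =>
    (stronglyMeasurable_condExp.mono (sig_le hε _)).measurable.ennreal_ofReal
  have m3 : ∀ (i k : ℕ), Measurable fun ω => ENNReal.ofReal
      (E i ^ 2 * projBound P ε (χ i (r + k)) ((i : ℤ) - 1 - (r + k : ℕ)) ω) := fun i k =>
    ((measurable_projBound hε _ _).const_mul _).ennreal_ofReal
  have b1 := measure_compl_le_of_lintegral (P := P) (Measurable.tsum m1) hc2
    (A := βq ^ 2 * S) (by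
      rw [lintegral_tsum fun k => (m1 k).aemeasurable]
      exact h.lintegral_tsum_tailSize_le hε hs)
  have b2 := measure_compl_le_of_lintegral (P := P) (Measurable.tsum m2) hc2
    (A := βq ^ 2 * S) (by
      rw [lintegral_tsum fun k => (m2 k).aemeasurable]
      refine le_trans (le_of_eq (tsum_congr fun k => ?_)) (h.lintegral_tsum_tailSize_le hε hs)
      exact lintegral_ofReal_condExp (sig_le hε _) (h.memLp_tailSize hε q k).integrable_sq
        (Filter.Eventually.of_forall fun ω => sq_nonneg _))
  have b3 := measure_compl_le_of_lintegral (P := P)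
    (Measurable.tsum fun k => Finset.measurable_fun_sum (Finset.Icc 1 n) fun i _ => m3 i k) hc2
    (A := C * βr * S) (by
      rw [lintegral_tsum fun k => (Finset.measurable_fun_sum _ fun i _ => m3 i k).aemeasurable]
      have e : C * βr * S = ∑ i ∈ Finset.Icc 1 n, E i ^ 2 * C * βr := by
        rw [hS, Finset.mul_sum]; exact Finset.sum_congr rfl fun i _ => by ring
      calc _ = ∑' k, ∑ i ∈ Finset.Icc 1 n, ∫⁻ ω, ENNReal.ofReal
              (E i ^ 2 * projBound P ε (χ i (r + k)) ((i : ℤ) - 1 - (r + k : ℕ)) ω) ∂P :=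
            tsum_congr fun k => lintegral_finsetSum _ fun i _ => m3 i k
        _ ≤ ∑' k, ∑ i ∈ Finset.Icc 1 n,
              ENNReal.ofReal (E i ^ 2 * C) * ENNReal.ofReal (Δ (r + 1 + k)) := by
            refine ENNReal.tsum_le_tsum fun k => Finset.sum_le_sum fun i hi => ?_
            simp only [ENNReal.ofReal_mul (sq_nonneg (E i))]
            rw [lintegral_const_mul _ (measurable_projBound hε _ _).ennreal_ofReal, mul_assoc]
            refine mul_le_mul_right ?_ _
            have hχi : Integrable (χ i (r + k)) (P.prod P) := memLp_one_iff_integrable.1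
              ⟨(h.χ_measurable _ _).aestronglyMeasurable, (h.χ_le i hi _).trans_lt
                (by finiteness)⟩
            rw [projBound, lintegral_ofReal_condExp (sig_le hε _) hχi.integral_prod_left
              (Filter.Eventually.of_forall fun ω => integral_nonneg fun _ => h.χ_nonneg _ _ _)]
            have e1 : eLpNorm (χ i (r + k)) 1 (P.prod P)
                = ∫⁻ ω, ∫⁻ ω', ENNReal.ofReal (χ i (r + k) (ω, ω')) ∂P ∂P := by
              rw [eLpNorm_one_eq_lintegral_enorm, lintegral_prod _
                (h.χ_measurable _ _).enorm.aemeasurable]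
              simp only [Real.enorm_eq_ofReal (h.χ_nonneg _ _ _)]
            have h3 := h.χ_le i hi (r + k)
            rw [e1, mul_comm, show r + k + 1 = r + 1 + k by ring] at h3
            refine le_trans (lintegral_mono_ae ?_) h3
            filter_upwards [hχi.prod_right_ae] with ω hω
            rw [ofReal_integral_eq_lintegral_ofReal hω
              (Filter.Eventually.of_forall fun _ => h.χ_nonneg _ _ _)]
        _ = ∑ i ∈ Finset.Icc 1 n, ENNReal.ofReal (E i ^ 2 * C) * ENNReal.ofReal βr := by
            rw [Summable.tsum_finsetSum fun i _ => ENNReal.summable]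
            simp only [ENNReal.tsum_mul_left]
            rw [hβr, ENNReal.ofReal_tsum_of_nonneg (fun j => h.Δ_nonneg _) hr]
        _ = ENNReal.ofReal (C * βr * S) := by
            rw [e, ENNReal.ofReal_sum_of_nonneg fun i _ => by positivity]
            exact Finset.sum_congr rfl fun i _ => (ENNReal.ofReal_mul (by positivity)).symm
        _ ≤ _ := le_rfl)
  have hun : P (goodEvent P ε n q r c E ψ χ)ᶜ
      ≤ ENNReal.ofReal (βq ^ 2 * S / c ^ 2) + ENNReal.ofReal (βq ^ 2 * S / c ^ 2)
        + ENNReal.ofReal (C * βr * S / c ^ 2) := by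
    rw [goodEvent, Set.compl_inter, Set.compl_inter]
    exact (measure_union_le _ _).trans (add_le_add
      ((measure_union_le _ _).trans (add_le_add b1 b2)) b3)
  rw [← ENNReal.ofReal_add (by positivity) (by positivity),
    ← ENNReal.ofReal_add (by positivity) (by positivity)] at hun
  refine (ENNReal.toReal_le_of_le_ofReal (by positivity) hun).trans_eq ?_
  ring

end GoodEvent

/-! ### Projections of the conditional moments -/

section Projections

variable {Ω : Type*} {dt : ℕ} [MeasurableSpace Ω]

/-- The bounded summands `W_i`, their first two conditional moments `H_i`, `G_i` given the past (as
functions of the past of the innovations), and the weights `d_i` with which the envelope dominates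
the effect of resampling on these moments. -/
structure IsDominated (P : Measure Ω) (ε : ℤ → Ω → Fin dt → ℝ) (n : ℕ) (M : ℝ) (E : ℕ → ℝ)
    (ψ χ : ℕ → ℕ → Ω × Ω → ℝ) (d : ℕ → ℝ) (W : ℕ → Ω → ℝ) (H G : ℕ → Seq dt → ℝ) : Prop where
  M_pos : 0 < M
  W_measurable : ∀ i ∈ Finset.Icc 1 n, StronglyMeasurable[sig ε (Set.Iic i)] (W i)
  W_bdd : ∀ i ∈ Finset.Icc 1 n, ∀ ω, |W i ω| ≤ M
  H_measurable : ∀ i ∈ Finset.Icc 1 n, Measurable (H i)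
  G_measurable : ∀ i ∈ Finset.Icc 1 n, Measurable (G i)
  H_eq : ∀ i ∈ Finset.Icc 1 n, (fun ω => H i (past ε ((i : ℤ) - 1) ω))
    =ᵐ[P] P[W i | sig ε (Set.Iic ((i : ℤ) - 1))]
  G_eq : ∀ i ∈ Finset.Icc 1 n, (fun ω => G i (past ε ((i : ℤ) - 1) ω))
    =ᵐ[P] P[fun ω => W i ω ^ 2 | sig ε (Set.Iic ((i : ℤ) - 1))]
  d_nonneg : ∀ i, 0 ≤ d i
  d_le : ∀ i ∈ Finset.Icc 1 n, d i ≤ E i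
  H_sub : ∀ i ∈ Finset.Icc 1 n, ∀ k, ∀ᵐ w ∂(P.prod P),
    |H i (past ε ((i : ℤ) - 1) w.1) - H i (coupledPast ε ((i : ℤ) - 1) k w)| ≤ d i * ψ i k w
  G_sub : ∀ i ∈ Finset.Icc 1 n, ∀ k, ∀ᵐ w ∂(P.prod P),
    |G i (past ε ((i : ℤ) - 1) w.1) - G i (coupledPast ε ((i : ℤ) - 1) k w)| ≤ d i ^ 2 * χ i k w

variable {P : Measure Ω} {ε : ℤ → Ω → Fin dt → ℝ}

lemma projBound_const_mul (a : ℝ) (ψ : Ω × Ω → ℝ) (m : ℤ) :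
    projBound P ε (fun w => a * ψ w) m =ᵐ[P] fun ω => a * projBound P ε ψ m ω := by
  simp only [projBound, integral_const_mul]
  exact condExp_smul a (fun ω => ∫ ω', ψ (ω, ω') ∂P) _

lemma IsEnvelope.ψ_memLp {n : ℕ} {Δ : ℕ → ℝ} {C : ℝ} {E : ℕ → ℝ}
    {ψ χ : ℕ → ℕ → Ω × Ω → ℝ} (h : IsEnvelope P n Δ C E ψ χ) {i : ℕ} (hi : i ∈ Finset.Icc 1 n)
    (k : ℕ) : MemLp (ψ i k) 2 (P.prod P) :=
  ⟨(h.ψ_measurable i k).aestronglyMeasurable, (h.ψ_le i hi k).trans_lt ENNReal.ofReal_lt_top⟩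

lemma IsEnvelope.χ_integrable {n : ℕ} {Δ : ℕ → ℝ} {C : ℝ} {E : ℕ → ℝ}
    {ψ χ : ℕ → ℕ → Ω × Ω → ℝ} (h : IsEnvelope P n Δ C E ψ χ) {i : ℕ} (hi : i ∈ Finset.Icc 1 n)
    (k : ℕ) : Integrable (χ i k) (P.prod P) :=
  memLp_one_iff_integrable.1
    ⟨(h.χ_measurable i k).aestronglyMeasurable, (h.χ_le i hi k).trans_lt (by finiteness)⟩

variable {n : ℕ} {M : ℝ} {Δ : ℕ → ℝ} {C : ℝ} {E d : ℕ → ℝ} {ψ χ : ℕ → ℕ → Ω × Ω → ℝ}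
  {W : ℕ → Ω → ℝ} {H G : ℕ → Seq dt → ℝ}

lemma IsDominated.stronglyMeasurable_H (h : IsDominated P ε n M E ψ χ d W H G) {i : ℕ}
    (hi : i ∈ Finset.Icc 1 n) :
    StronglyMeasurable[sig ε (Set.Iic ((i : ℤ) - 1))] fun ω => H i (past ε ((i : ℤ) - 1) ω) :=
  ((h.H_measurable i hi).comp (measurable_past_sig ε _)).stronglyMeasurable

lemma IsDominated.stronglyMeasurable_G (h : IsDominated P ε n M E ψ χ d W H G) {i : ℕ}
    (hi : i ∈ Finset.Icc 1 n) :
    StronglyMeasurable[sig ε (Set.Iic ((i : ℤ) - 1))] fun ω => G i (past ε ((i : ℤ) - 1) ω) :=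
  ((h.G_measurable i hi).comp (measurable_past_sig ε _)).stronglyMeasurable

lemma IsDominated.abs_H_le (h : IsDominated P ε n M E ψ χ d W H G) {i : ℕ}
    (hi : i ∈ Finset.Icc 1 n) : ∀ᵐ ω ∂P, |H i (past ε ((i : ℤ) - 1) ω)| ≤ M := by
  filter_upwards [h.H_eq i hi, ae_bdd_abs_condExp_of_ae_bdd_abs (μ := P)
    (m := sig ε (Set.Iic ((i : ℤ) - 1))) (Filter.Eventually.of_forall (h.W_bdd i hi))] with ω h1 h2
  rwa [h1]

lemma IsDominated.G_nonneg (h : IsDominated P ε n M E ψ χ d W H G) {i : ℕ}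
    (hi : i ∈ Finset.Icc 1 n) : ∀ᵐ ω ∂P, 0 ≤ G i (past ε ((i : ℤ) - 1) ω) := by
  filter_upwards [h.G_eq i hi, condExp_nonneg (μ := P) (m := sig ε (Set.Iic ((i : ℤ) - 1)))
    (Filter.Eventually.of_forall fun ω => sq_nonneg (W i ω))] with ω h1 h2
  rw [h1]; exact h2

lemma IsDominated.abs_G_le (h : IsDominated P ε n M E ψ χ d W H G) {i : ℕ}
    (hi : i ∈ Finset.Icc 1 n) : ∀ᵐ ω ∂P, |G i (past ε ((i : ℤ) - 1) ω)| ≤ M ^ 2 := by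
  have hb : ∀ᵐ ω ∂P, |W i ω ^ 2| ≤ M ^ 2 := Filter.Eventually.of_forall fun ω => by
    rw [abs_pow]; exact pow_le_pow_left₀ (abs_nonneg _) (h.W_bdd i hi ω) 2
  filter_upwards [h.G_eq i hi, ae_bdd_abs_condExp_of_ae_bdd_abs (μ := P)
    (m := sig ε (Set.Iic ((i : ℤ) - 1))) hb] with ω h1 h2
  rwa [h1]

variable [IsProbabilityMeasure P]

/-- Conditional expectations given more and more innovations from the past converge. -/
lemma tendsto_condExp_sig_Ici (hε : IsInnovation P ε) (a : ℤ) {X : Ω → ℝ} (hX : Integrable X P)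
    (hXm : StronglyMeasurable[sig ε Set.univ] X) :
    ∀ᵐ ω ∂P, Filter.Tendsto (fun k : ℕ => (P[X | sig ε (Set.Ici (a - k))]) ω) Filter.atTop
      (nhds (X ω)) := by
  let ℱ : Filtration ℕ ‹MeasurableSpace Ω› :=
    { seq := fun k => sig ε (Set.Ici (a - k))
      mono' := fun k l hkl => sig_mono ε (Set.Ici_subset_Ici.2 (by
        have : (k : ℤ) ≤ l := by exact_mod_cast hkl
        omega))
      le' := fun k => sig_le hε.measurable _ }
  have hle : sig ε Set.univ ≤ ⨆ k, ℱ k := by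
    refine iSup₂_le fun j _ => ?_
    have h1 : MeasurableSpace.comap (ε j) inferInstance ≤ ℱ (a - j).toNat := by
      refine (measurable_sig ε ?_).comap_le
      simp only [Set.mem_Ici]
      omega
    exact h1.trans (le_iSup (fun k => (ℱ k : MeasurableSpace Ω)) _)
  exact hX.tendsto_ae_condExp (ℱ := ℱ) (hXm.mono hle)

lemma IsDominated.integrable_H (hε : IsInnovation P ε) (h : IsDominated P ε n M E ψ χ d W H G)
    {i : ℕ} (hi : i ∈ Finset.Icc 1 n) : Integrable (fun ω => H i (past ε ((i : ℤ) - 1) ω)) P :=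
  Integrable.of_bound ((h.stronglyMeasurable_H hi).mono
    (sig_le hε.measurable _)).aestronglyMeasurable M (h.abs_H_le hi)

lemma IsDominated.integrable_G (hε : IsInnovation P ε) (h : IsDominated P ε n M E ψ χ d W H G)
    {i : ℕ} (hi : i ∈ Finset.Icc 1 n) : Integrable (fun ω => G i (past ε ((i : ℤ) - 1) ω)) P :=
  Integrable.of_bound ((h.stronglyMeasurable_G hi).mono
    (sig_le hε.measurable _)).aestronglyMeasurable (M ^ 2) (h.abs_G_le hi)

lemma IsDominated.abs_proj_H_le (hε : IsInnovation P ε) (he : IsEnvelope P n Δ C E ψ χ)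
    (h : IsDominated P ε n M E ψ χ d W H G) {i : ℕ} (hi : i ∈ Finset.Icc 1 n) (k : ℕ) :
    ∀ᵐ ω ∂P, |(P[fun ω => H i (past ε ((i : ℤ) - 1) ω) | sig ε (Set.Ici ((i : ℤ) - 1 - k))]) ω
        - (P[fun ω => H i (past ε ((i : ℤ) - 1) ω) | sig ε (Set.Ici ((i : ℤ) - 1 - k + 1))]) ω|
      ≤ d i * projBound P ε (ψ i k) ((i : ℤ) - 1 - k) ω := by
  filter_upwards [abs_condExp_sub_le hε ((i : ℤ) - 1) k (h.H_measurable i hi) (h.integrable_H hε hi)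
    (((he.ψ_memLp hi k).integrable (by norm_num)).const_mul (d i)) (h.H_sub i hi k),
    projBound_const_mul (P := P) (ε := ε) (d i) (ψ i k) ((i : ℤ) - 1 - k)] with ω h1 h2
  exact h1.trans_eq h2

lemma IsDominated.abs_proj_G_le (hε : IsInnovation P ε) (he : IsEnvelope P n Δ C E ψ χ)
    (h : IsDominated P ε n M E ψ χ d W H G) {i : ℕ} (hi : i ∈ Finset.Icc 1 n) (k : ℕ) :
    ∀ᵐ ω ∂P, |(P[fun ω => G i (past ε ((i : ℤ) - 1) ω) | sig ε (Set.Ici ((i : ℤ) - 1 - k))]) ω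
        - (P[fun ω => G i (past ε ((i : ℤ) - 1) ω) | sig ε (Set.Ici ((i : ℤ) - 1 - k + 1))]) ω|
      ≤ d i ^ 2 * projBound P ε (χ i k) ((i : ℤ) - 1 - k) ω := by
  filter_upwards [abs_condExp_sub_le hε ((i : ℤ) - 1) k (h.G_measurable i hi) (h.integrable_G hε hi)
    ((he.χ_integrable hi k).const_mul (d i ^ 2)) (h.G_sub i hi k),
    projBound_const_mul (P := P) (ε := ε) (d i ^ 2) (χ i k) ((i : ℤ) - 1 - k)] with ω h1 h2
  exact h1.trans_eq h2

end Projections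

/-! ### The long-range part of the conditional means -/

section Tail

variable {Ω : Type*} {dt : ℕ} [MeasurableSpace Ω] {P : Measure Ω}
  {ε : ℤ → Ω → Fin dt → ℝ} {n : ℕ} {M : ℝ} {Δ : ℕ → ℝ} {C : ℝ} {E d : ℕ → ℝ}
  {ψ χ : ℕ → ℕ → Ω × Ω → ℝ} {W : ℕ → Ω → ℝ} {H G : ℕ → Seq dt → ℝ}

/-- The martingale increment that reveals the innovation at time `n - 1 - k`, summed over the
indices `i` whose distance to this time exceeds `q`. -/
noncomputable def tailIncrement (P : Measure Ω) (ε : ℤ → Ω → Fin dt → ℝ) (n q : ℕ)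
    (H : ℕ → Seq dt → ℝ) (k : ℕ) (ω : Ω) : ℝ :=
  ∑ i ∈ Finset.Icc 1 n, if n + q ≤ i + k then
    (P[fun ω => H i (past ε ((i : ℤ) - 1) ω) | sig ε (Set.Ici ((n : ℤ) - (k + 1 : ℕ)))]) ω
      - (P[fun ω => H i (past ε ((i : ℤ) - 1) ω) | sig ε (Set.Ici ((n : ℤ) - k))]) ω
  else 0

lemma sum_range_ite_sub (φ : ℕ → ℝ) (k₀ K : ℕ) :
    ∑ k ∈ Finset.range K, (if k₀ ≤ k then φ (k + 1) - φ k else 0) = φ (max K k₀) - φ k₀ := by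
  induction K with
  | zero => simp
  | succ K ih =>
    rw [Finset.sum_range_succ, ih]
    split_ifs with h
    · rw [max_eq_left h, max_eq_left (by omega)]; ring
    · rw [max_eq_right (by omega), max_eq_right (by omega)]; ring

lemma sum_tailIncrement (q : ℕ) {K : ℕ} (hK : n + q ≤ K) (ω : Ω) :
    ∑ k ∈ Finset.range K, tailIncrement P ε n q H k ω = ∑ i ∈ Finset.Icc 1 n,
      ((P[fun ω => H i (past ε ((i : ℤ) - 1) ω) | sig ε (Set.Ici ((n : ℤ) - K))]) ω
        - (P[fun ω => H i (past ε ((i : ℤ) - 1) ω) | sig ε (Set.Ici ((i : ℤ) - q))]) ω) := by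
  simp only [tailIncrement]
  rw [Finset.sum_comm]
  refine Finset.sum_congr rfl fun i hi => ?_
  have hi' := Finset.mem_Icc.1 hi
  have h1 := sum_range_ite_sub (fun k : ℕ => (P[fun ω => H i (past ε ((i : ℤ) - 1) ω) |
    sig ε (Set.Ici ((n : ℤ) - k))]) ω) (n - i + q) K
  rw [max_eq_left (by omega)] at h1
  have h2 : (n : ℤ) - ((n - i + q : ℕ) : ℤ) = i - q := by omega
  rw [h2] at h1
  rw [← h1]
  refine Finset.sum_congr rfl fun k _ => if_congr (by omega) rfl rfl

lemma stronglyMeasurable_tailIncrement (q k : ℕ) :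
    StronglyMeasurable[sig ε (Set.Ici ((n : ℤ) - (k + 1 : ℕ)))] (tailIncrement P ε n q H k) := by
  refine Finset.stronglyMeasurable_fun_sum _ fun i _ => ?_
  split_ifs
  · refine stronglyMeasurable_condExp.sub (stronglyMeasurable_condExp.mono (sig_mono ε ?_))
    exact Set.Ici_subset_Ici.2 (by push_cast; omega)
  · exact stronglyMeasurable_const

lemma IsDominated.abs_tailIncrement_le_const (h : IsDominated P ε n M E ψ χ d W H G) (q k : ℕ) :
    ∀ᵐ ω ∂P, |tailIncrement P ε n q H k ω| ≤ n * (2 * M) := by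
  have hb : ∀ m : ℤ, ∀ᵐ ω ∂P, ∀ i ∈ Finset.Icc 1 n,
      |(P[fun ω => H i (past ε ((i : ℤ) - 1) ω) | sig ε (Set.Ici m)]) ω| ≤ M := fun m =>
    (Finset.eventually_all _).2 fun i hi => ae_bdd_abs_condExp_of_ae_bdd_abs (h.abs_H_le hi)
  filter_upwards [hb ((n : ℤ) - (k + 1 : ℕ)), hb ((n : ℤ) - k)] with ω h1 h2
  have hM := h.M_pos
  calc |tailIncrement P ε n q H k ω| ≤ ∑ i ∈ Finset.Icc 1 n, 2 * M := by
        refine (Finset.abs_sum_le_sum_abs _ _).trans (Finset.sum_le_sum fun i hi => ?_)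
        split_ifs
        · exact (abs_sub _ _).trans (by linarith [h1 i hi, h2 i hi])
        · rw [abs_zero]; linarith
    _ = n * (2 * M) := by simp

variable [IsProbabilityMeasure P]

lemma condExp_tailIncrement (hε : IsInnovation P ε) (q k : ℕ) :
    P[tailIncrement P ε n q H k | sig ε (Set.Ici ((n : ℤ) - k))] =ᵐ[P] 0 := by
  let Y : ℕ → Ω → ℝ := fun i => if n + q ≤ i + k then
    P[fun ω => H i (past ε ((i : ℤ) - 1) ω) | sig ε (Set.Ici ((n : ℤ) - (k + 1 : ℕ)))]
      - P[fun ω => H i (past ε ((i : ℤ) - 1) ω) | sig ε (Set.Ici ((n : ℤ) - k))] else 0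
  have e : tailIncrement P ε n q H k = ∑ i ∈ Finset.Icc 1 n, Y i := by
    funext ω
    simp only [tailIncrement, Finset.sum_apply, Y]
    refine Finset.sum_congr rfl fun i _ => ?_
    split_ifs <;> rfl
  have hYi : ∀ i, Integrable (Y i) P := by
    intro i; simp only [Y]; split_ifs
    · exact integrable_condExp.sub integrable_condExp
    · exact integrable_zero _ _ _
  have hY0 : ∀ i, P[Y i | sig ε (Set.Ici ((n : ℤ) - k))] =ᵐ[P] 0 := by
    intro i; simp only [Y]; split_ifs
    · have hsub : sig ε (Set.Ici ((n : ℤ) - k)) ≤ sig ε (Set.Ici ((n : ℤ) - (k + 1 : ℕ))) :=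
        sig_mono ε (Set.Ici_subset_Ici.2 (by push_cast; omega))
      have h1 := condExp_sub (μ := P) (integrable_condExp (μ := P)
        (m := sig ε (Set.Ici ((n : ℤ) - (k + 1 : ℕ))))
        (f := fun ω => H i (past ε ((i : ℤ) - 1) ω)))
        (integrable_condExp (μ := P) (m := sig ε (Set.Ici ((n : ℤ) - k)))
          (f := fun ω => H i (past ε ((i : ℤ) - 1) ω))) (sig ε (Set.Ici ((n : ℤ) - k)))
      have h2 := condExp_condExp_of_le (μ := P) (f := fun ω => H i (past ε ((i : ℤ) - 1) ω))
        hsub (sig_le hε.measurable _)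
      have h3 := condExp_condExp_of_le (μ := P) (f := fun ω => H i (past ε ((i : ℤ) - 1) ω))
        (le_refl (sig ε (Set.Ici ((n : ℤ) - k)))) (sig_le hε.measurable _)
      filter_upwards [h1, h2, h3] with ω a1 a2 a3
      rw [a1, Pi.sub_apply, a2, a3, sub_self]; rfl
    · rw [condExp_zero]
  rw [e]
  have h1 := condExp_finsetSum (μ := P) (s := Finset.Icc 1 n) (fun i _ => hYi i)
    (sig ε (Set.Ici ((n : ℤ) - k)))
  filter_upwards [h1, ae_all_iff.2 hY0] with ω a1 a2
  rw [a1, Finset.sum_apply]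
  exact Finset.sum_eq_zero fun i _ => a2 i

lemma IsDominated.abs_tailIncrement_le (hε : IsInnovation P ε) (he : IsEnvelope P n Δ C E ψ χ)
    (h : IsDominated P ε n M E ψ χ d W H G) (q k : ℕ) :
    ∀ᵐ ω ∂P, |tailIncrement P ε n q H k ω| ≤ tailSize P ε n q E ψ k ω := by
  have h1 : ∀ i ∈ Finset.Icc 1 n, ∀ᵐ ω ∂P, n + q ≤ i + k →
      |(P[fun ω => H i (past ε ((i : ℤ) - 1) ω) | sig ε (Set.Ici ((n : ℤ) - (k + 1 : ℕ)))]) ω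
        - (P[fun ω => H i (past ε ((i : ℤ) - 1) ω) | sig ε (Set.Ici ((n : ℤ) - k))]) ω|
        ≤ E i * projBound P ε (ψ i (i + k - n)) ((n : ℤ) - (k + 1)) ω := by
    intro i hi
    by_cases hc : n + q ≤ i + k
    · have e1 : (i : ℤ) - 1 - ((i + k - n : ℕ) : ℤ) = n - (k + 1 : ℕ) := by omega
      have e2 : (i : ℤ) - 1 - ((i + k - n : ℕ) : ℤ) + 1 = n - k := by omega
      have e3 : (n : ℤ) - (k + 1 : ℕ) = n - (k + 1) := by push_cast; ring
      have h2 := h.abs_proj_H_le hε he hi (i + k - n)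
      rw [e2, e1] at h2
      filter_upwards [h2, projBound_nonneg (P := P) (ε := ε) (he.ψ_nonneg i (i + k - n))
        ((n : ℤ) - (k + 1))] with ω a1 a2 _
      rw [e3] at a1 ⊢
      exact a1.trans (mul_le_mul_of_nonneg_right (h.d_le i hi) a2)
    · exact Filter.Eventually.of_forall fun ω hc' => absurd hc' hc
  filter_upwards [(Finset.eventually_all _).2 h1] with ω hω
  refine (Finset.abs_sum_le_sum_abs _ _).trans (Finset.sum_le_sum fun i hi => ?_)
  split_ifs with hc
  · exact hω i hi hc
  · simp

lemma sum_le_of_tsum_ofReal_le {x : ℕ → ℝ} {a : ℝ} (ha : 0 ≤ a)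
    (h : ∑' k, ENNReal.ofReal (x k) ≤ ENNReal.ofReal a) (s : Finset ℕ) : ∑ k ∈ s, x k ≤ a := by
  have h1 : ENNReal.ofReal (∑ k ∈ s, x k) ≤ ENNReal.ofReal a :=
    (Finset.le_sum_of_subadditive ENNReal.ofReal ENNReal.ofReal_zero.le
      (fun _ _ => ENNReal.ofReal_add_le) s x).trans ((ENNReal.sum_le_tsum s).trans h)
  exact (ENNReal.ofReal_le_ofReal_iff ha).1 h1

/-- On the good event the long-range part of the conditional means, a reversed martingale whose
increments and conditional variances are controlled there, has bounded exponential moments. -/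
lemma IsDominated.setIntegral_exp_tail_le (hε : IsInnovation P ε) (he : IsEnvelope P n Δ C E ψ χ)
    (h : IsDominated P ε n M E ψ χ d W H G) (q r : ℕ) {c l : ℝ} (hlc : 2 * l ^ 2 * c ^ 2 ≤ 1) :
    ∫ ω in goodEvent P ε n q r c E ψ χ, Real.exp (l * ∑ i ∈ Finset.Icc 1 n,
      (H i (past ε ((i : ℤ) - 1) ω)
        - (P[fun ω => H i (past ε ((i : ℤ) - 1) ω) | sig ε (Set.Ici ((i : ℤ) - q))]) ω)) ∂P
      ≤ Real.exp 1 := by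
  set B := goodEvent P ε n q r c E ψ χ with hB
  have hBm : MeasurableSet B := measurableSet_goodEvent hε.measurable n q r c E ψ χ
  let T : ℕ → Ω → ℝ := fun k => tailIncrement P ε n q H k
  let Q : ℕ → Ω → ℝ := fun k => P[fun ω => T k ω ^ 2 | sig ε (Set.Ici ((n : ℤ) - k))]
  let A : ℕ → Ω → ℝ := fun k ω => (l * T k ω - (l * T k ω) ^ 2) - l ^ 2 * Q k ω
  have hTm : ∀ k : ℕ, StronglyMeasurable[sig ε (Set.Ici ((n : ℤ) - (k + 1 : ℕ)))] (T k) :=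
    stronglyMeasurable_tailIncrement q
  have hT' : ∀ k, AEStronglyMeasurable (T k) P := fun k =>
    ((hTm k).mono (sig_le hε.measurable _)).aestronglyMeasurable
  have hmono : Monotone fun k : ℕ => sig ε (Set.Ici ((n : ℤ) - k)) := fun k k' hk =>
    sig_mono ε (Set.Ici_subset_Ici.2 (by
      have : (k : ℤ) ≤ k' := by exact_mod_cast hk
      omega))
  have hQ0 : ∀ k, 0 ≤ᵐ[P] Q k := fun k =>
    condExp_nonneg (Filter.Eventually.of_forall fun ω => sq_nonneg (T k ω))
  have hone := integral_exp_sum_le_one (P := P) (G := fun k : ℕ => sig ε (Set.Ici ((n : ℤ) - k)))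
    hmono (fun k => sig_le hε.measurable _) (A := A)
    (fun k => (((hTm k).const_mul l).sub (((hTm k).const_mul l).pow 2)).sub
      ((stronglyMeasurable_condExp.mono (hmono (Nat.le_succ k))).const_mul (l ^ 2)))
    (C := fun _ => 1) (fun k => by
      filter_upwards [hQ0 k] with ω hω
      have h1 : 0 ≤ l ^ 2 * Q k ω := mul_nonneg (sq_nonneg l) hω
      simp only [A]
      nlinarith [sq_nonneg (l * T k ω - 1)])
    (fun k => condExp_exp_sub_le_one (sig_le hε.measurable _) (hT' k)
      (h.abs_tailIncrement_le_const q k) (condExp_tailIncrement hε q k)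
      (Y := fun ω => l * T k ω - (l * T k ω) ^ 2)
      (((hT' k).const_mul l).sub (((hT' k).const_mul l).pow 2)) (θ := l)
      (Filter.Eventually.of_forall fun ω => by
        refine (exp_sub_sq_le (l * T k ω)).trans_eq ?_
        simp only [T]; ring))
  -- the compensator is at most one on the good event
  have hcomp : ∀ K, ∀ᵐ ω ∂P, ω ∈ B → l * ∑ k ∈ Finset.range K, T k ω
      ≤ 1 + ∑ k ∈ Finset.range K, A k ω := by
    intro K
    have hTU : ∀ᵐ ω ∂P, ∀ k, |T k ω| ≤ tailSize P ε n q E ψ k ω :=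
      ae_all_iff.2 fun k => h.abs_tailIncrement_le hε he q k
    have hQU : ∀ᵐ ω ∂P, ∀ k : ℕ, Q k ω ≤ (P[fun ω => tailSize P ε n q E ψ k ω ^ 2 |
        sig ε (Set.Ici ((n : ℤ) - k))]) ω := by
      refine ae_all_iff.2 fun k => ?_
      refine condExp_mono ?_ (he.memLp_tailSize hε.measurable q k).integrable_sq ?_
      · refine (he.memLp_tailSize hε.measurable q k).integrable_sq.mono' ((hT' k).pow 2) ?_
        filter_upwards [h.abs_tailIncrement_le hε he q k] with ω hω
        rw [Real.norm_of_nonneg (sq_nonneg _), ← sq_abs]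
        exact pow_le_pow_left₀ (abs_nonneg _) hω 2
      · filter_upwards [h.abs_tailIncrement_le hε he q k] with ω hω
        rw [← sq_abs]
        exact pow_le_pow_left₀ (abs_nonneg _) hω 2
    filter_upwards [hTU, hQU] with ω h1 h2 hω
    have e1 : ∑ k ∈ Finset.range K, T k ω ^ 2 ≤ c ^ 2 :=
      (Finset.sum_le_sum fun k _ => by
        rw [← sq_abs]; exact pow_le_pow_left₀ (abs_nonneg _) (h1 k) 2).trans
        (sum_le_of_tsum_ofReal_le (sq_nonneg c) hω.1.1 _)
    have e2 : ∑ k ∈ Finset.range K, Q k ω ≤ c ^ 2 :=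
      (Finset.sum_le_sum fun k _ => h2 k).trans
        (sum_le_of_tsum_ofReal_le (sq_nonneg c) hω.1.2 _)
    have e3 : ∑ k ∈ Finset.range K, A k ω = l * ∑ k ∈ Finset.range K, T k ω
        - l ^ 2 * ∑ k ∈ Finset.range K, T k ω ^ 2 - l ^ 2 * ∑ k ∈ Finset.range K, Q k ω := by
      simp only [A, Finset.sum_sub_distrib, Finset.mul_sum, mul_pow]
    rw [e3]
    nlinarith [mul_le_mul_of_nonneg_left e1 (sq_nonneg l), mul_le_mul_of_nonneg_left e2
      (sq_nonneg l)]
  have hAint : ∀ K, Integrable (fun ω => Real.exp (∑ k ∈ Finset.range K, A k ω)) P := by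
    intro K
    refine integrable_exp_of_ae_le (C := ∑ k ∈ Finset.range K, (1 : ℝ))
      (Finset.aestronglyMeasurable_fun_sum _ fun k _ => ?_) ?_
    · exact (((hT' k).const_mul l).sub (((hT' k).const_mul l).pow 2)).sub
        (integrable_condExp.1.const_mul (l ^ 2))
    · filter_upwards [ae_all_iff.2 hQ0] with ω hω
      refine Finset.sum_le_sum fun k _ => ?_
      have h1 : 0 ≤ l ^ 2 * Q k ω := mul_nonneg (sq_nonneg l) (hω k)
      simp only [A]
      nlinarith [sq_nonneg (l * T k ω - 1)]
  have hK : ∀ K, ∫ ω in B, Real.exp (l * ∑ k ∈ Finset.range K, T k ω) ∂P ≤ Real.exp 1 := by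
    intro K
    calc ∫ ω in B, Real.exp (l * ∑ k ∈ Finset.range K, T k ω) ∂P
        ≤ ∫ ω in B, Real.exp 1 * Real.exp (∑ k ∈ Finset.range K, A k ω) ∂P := by
          refine integral_mono_of_nonneg (Filter.Eventually.of_forall fun ω => (Real.exp_pos _).le)
            ((hAint K).integrableOn.const_mul _) ?_
          filter_upwards [(ae_restrict_iff' hBm).2 (hcomp K)] with ω hω
          rw [← Real.exp_add]
          exact Real.exp_le_exp.2 hω
      _ ≤ ∫ ω, Real.exp 1 * Real.exp (∑ k ∈ Finset.range K, A k ω) ∂P :=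
          setIntegral_le_integral ((hAint K).const_mul _)
            (Filter.Eventually.of_forall fun ω => by positivity)
      _ = Real.exp 1 * ∫ ω, Real.exp (∑ k ∈ Finset.range K, A k ω) ∂P := integral_const_mul _ _
      _ ≤ Real.exp 1 := mul_le_of_le_one_right (Real.exp_pos _).le (hone K)
  -- let the number of revealed innovations tend to infinity
  have hlim : Filter.Tendsto (fun K => ∫ ω in B, Real.exp (l * ∑ k ∈ Finset.range K, T k ω) ∂P)
      Filter.atTop (nhds (∫ ω in B, Real.exp (l * ∑ i ∈ Finset.Icc 1 n,
      (H i (past ε ((i : ℤ) - 1) ω)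
        - (P[fun ω => H i (past ε ((i : ℤ) - 1) ω) | sig ε (Set.Ici ((i : ℤ) - q))]) ω)) ∂P)) := by
    have hb : ∀ m : ℤ, ∀ᵐ ω ∂P, ∀ i ∈ Finset.Icc 1 n,
        |(P[fun ω => H i (past ε ((i : ℤ) - 1) ω) | sig ε (Set.Ici m)]) ω| ≤ M := fun m =>
      (Finset.eventually_all _).2 fun i hi => ae_bdd_abs_condExp_of_ae_bdd_abs (h.abs_H_le hi)
    refine tendsto_integral_filter_of_dominated_convergence
      (fun _ => Real.exp (|l| * (n * (2 * M)))) (Filter.Eventually.of_forall fun K => ?_) ?_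
      (integrable_const _) ?_
    · exact (Real.continuous_exp.comp_aestronglyMeasurable
        ((Finset.aestronglyMeasurable_fun_sum _ fun k _ => hT' k).const_mul l)).restrict
    · filter_upwards [Filter.eventually_ge_atTop (n + q)] with K hKq
      refine ae_restrict_of_ae ?_
      filter_upwards [hb ((n : ℤ) - K), (Finset.eventually_all (Finset.Icc 1 n)).2 fun i hi =>
        ae_bdd_abs_condExp_of_ae_bdd_abs (μ := P) (m := sig ε (Set.Ici ((i : ℤ) - q)))
          (h.abs_H_le hi)] with ω h1 h2
      rw [Real.norm_of_nonneg (Real.exp_pos _).le, Real.exp_le_exp]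
      refine (le_abs_self _).trans ?_
      rw [abs_mul]
      refine mul_le_mul_of_nonneg_left ?_ (abs_nonneg l)
      simp only [T]
      rw [sum_tailIncrement q hKq]
      calc _ ≤ ∑ i ∈ Finset.Icc 1 n, 2 * M := by
            refine (Finset.abs_sum_le_sum_abs _ _).trans (Finset.sum_le_sum fun i hi => ?_)
            exact (abs_sub _ _).trans (by linarith [h1 i hi, h2 i hi])
        _ = n * (2 * M) := by simp
    · refine ae_restrict_of_ae ?_
      filter_upwards [(Finset.eventually_all (Finset.Icc 1 n)).2 fun i hi =>
        tendsto_condExp_sig_Ici hε (n : ℤ) (h.integrable_H hε hi)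
          ((h.stronglyMeasurable_H hi).mono (sig_mono ε (Set.subset_univ _)))] with ω hω
      refine (Real.continuous_exp.tendsto _).comp (Filter.Tendsto.const_mul l ?_)
      refine Filter.Tendsto.congr' ?_ (tendsto_finsetSum _ fun i hi => (hω i hi).sub_const _)
      filter_upwards [Filter.eventually_ge_atTop (n + q)] with K hKq
      exact (sum_tailIncrement q hKq ω).symm
  exact le_of_tendsto' hlim hK

end Tail

/-! ### The martingale part -/

section MartingalePart

variable {Ω : Type*} {dt : ℕ} [MeasurableSpace Ω] {P : Measure Ω} [IsProbabilityMeasure P]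
  {ε : ℤ → Ω → Fin dt → ℝ} {n : ℕ} {M : ℝ} {Δ : ℕ → ℝ} {C : ℝ} {E d : ℕ → ℝ}
  {ψ χ : ℕ → ℕ → Ω × Ω → ℝ} {W : ℕ → Ω → ℝ} {H G : ℕ → Seq dt → ℝ}

/-- The third condition that defines the good event compares the conditional second moments with
their finite-range approximations. -/
lemma IsDominated.sum_G_le (hε : IsInnovation P ε) (he : IsEnvelope P n Δ C E ψ χ)
    (h : IsDominated P ε n M E ψ χ d W H G) (q r : ℕ) (c : ℝ) :
    ∀ᵐ ω ∂P, ω ∈ goodEvent P ε n q r c E ψ χ → ∑ i ∈ Finset.Icc 1 n, G i (past ε ((i : ℤ) - 1) ω)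
      ≤ c ^ 2 + ∑ i ∈ Finset.Icc 1 n,
        (P[fun ω => G i (past ε ((i : ℤ) - 1) ω) | sig ε (Set.Ici ((i : ℤ) - r))]) ω := by
  let g : ℕ → ℕ → Ω → ℝ := fun i k =>
    P[fun ω => G i (past ε ((i : ℤ) - 1) ω) | sig ε (Set.Ici ((i : ℤ) - k))]
  have hstep : ∀ᵐ ω ∂P, ∀ i ∈ Finset.Icc 1 n, ∀ k, g i (r + k + 1) ω - g i (r + k) ω
      ≤ E i ^ 2 * projBound P ε (χ i (r + k)) ((i : ℤ) - 1 - (r + k : ℕ)) ω := by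
    refine (Finset.eventually_all _).2 fun i hi => ae_all_iff.2 fun k => ?_
    have e1 : (i : ℤ) - 1 - (r + k : ℕ) = i - (r + k + 1 : ℕ) := by push_cast; ring
    have e2 : (i : ℤ) - (r + k + 1 : ℕ) + 1 = i - (r + k : ℕ) := by push_cast; ring
    have h1 := h.abs_proj_G_le hε he hi (r + k)
    rw [e1, e2] at h1
    rw [e1]
    filter_upwards [h1, projBound_nonneg (P := P) (ε := ε) (he.χ_nonneg i (r + k))
      ((i : ℤ) - (r + k + 1 : ℕ))] with ω a1 a2
    refine (le_abs_self _).trans (a1.trans (mul_le_mul_of_nonneg_right ?_ a2))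
    exact pow_le_pow_left₀ (h.d_nonneg i) (h.d_le i hi) 2
  have hlim : ∀ᵐ ω ∂P, ∀ i ∈ Finset.Icc 1 n, Filter.Tendsto (fun k : ℕ => g i k ω) Filter.atTop
      (nhds (G i (past ε ((i : ℤ) - 1) ω))) :=
    (Finset.eventually_all _).2 fun i hi => tendsto_condExp_sig_Ici hε (i : ℤ)
      (h.integrable_G hε hi) ((h.stronglyMeasurable_G hi).mono (sig_mono ε (Set.subset_univ _)))
  have hnn : ∀ᵐ ω ∂P, ∀ i k,
      0 ≤ projBound P ε (χ i (r + k)) ((i : ℤ) - 1 - (r + k : ℕ)) ω :=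
    ae_all_iff.2 fun i => ae_all_iff.2 fun k => projBound_nonneg (he.χ_nonneg i (r + k)) _
  filter_upwards [hstep, hlim, hnn] with ω h1 h2 h3 hω
  have hsum : ∀ K, ∑ k ∈ Finset.range K, ∑ i ∈ Finset.Icc 1 n,
      E i ^ 2 * projBound P ε (χ i (r + k)) ((i : ℤ) - 1 - (r + k : ℕ)) ω ≤ c ^ 2 := by
    intro K
    refine sum_le_of_tsum_ofReal_le (sq_nonneg c) (le_trans (le_of_eq ?_) hω.2) (Finset.range K)
    refine tsum_congr fun k => ENNReal.ofReal_sum_of_nonneg fun i _ => ?_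
    exact mul_nonneg (sq_nonneg _) (h3 i k)
  refine le_of_tendsto (tendsto_finsetSum _ fun i hi => h2 i hi) ?_
  filter_upwards [Filter.eventually_ge_atTop r] with K hK
  obtain ⟨K, rfl⟩ := Nat.exists_eq_add_of_le hK
  have h4 : ∀ i ∈ Finset.Icc 1 n, g i (r + K) ω - g i r ω ≤ ∑ k ∈ Finset.range K,
      E i ^ 2 * projBound P ε (χ i (r + k)) ((i : ℤ) - 1 - (r + k : ℕ)) ω := by
    intro i hi
    have := Finset.sum_range_sub (fun k => g i (r + k) ω) K
    simp only [add_zero] at this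
    rw [← this]
    exact Finset.sum_le_sum fun k _ => h1 i hi k
  have h5 := Finset.sum_le_sum h4
  rw [Finset.sum_comm, Finset.sum_sub_distrib] at h5
  linarith [hsum K]

/-- On the good event the martingale differences `W_i - E[W_i | 𝒢_{i-1}]` satisfy a Gaussian bound:
their predictable quadratic variation is there at most a sum of finite-range variables, up to a
bounded error. -/
lemma IsDominated.setIntegral_exp_martingale_le (hε : IsInnovation P ε)
    (he : IsEnvelope P n Δ C E ψ χ) (h : IsDominated P ε n M E ψ χ d W H G) (q : ℕ) {r : ℕ}
    (hr : 1 ≤ r) {c l : ℝ} (hlM : 4 * |l| * M ≤ 1) (hlr : 8 * l ^ 2 * (r * M ^ 2) ≤ 1)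
    (hlc : 4 * l ^ 2 * c ^ 2 ≤ 1) :
    ∫ ω in goodEvent P ε n q r c E ψ χ, Real.exp (l * ∑ i ∈ Finset.Icc 1 n,
      (W i ω - H i (past ε ((i : ℤ) - 1) ω))) ∂P
      ≤ Real.exp 1 * Real.exp (16 * l ^ 2 * ∑ i ∈ Finset.Icc 1 n, ∫ ω, W i ω ^ 2 ∂P) := by
  set B := goodEvent P ε n q r c E ψ χ with hB
  have hBm : MeasurableSet B := measurableSet_goodEvent hε.measurable n q r c E ψ χ
  have hM := h.M_pos
  have hsigle := sig_le (ε := ε) hε.measurable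
  let ξ : ℕ → Ω → ℝ := fun i ω => W i ω - H i (past ε ((i : ℤ) - 1) ω)
  let Q : ℕ → Ω → ℝ := fun i => P[fun ω => ξ i ω ^ 2 | sig ε (Set.Iic ((i : ℤ) - 1))]
  let A : ℕ → Ω → ℝ := fun k ω =>
    if k + 1 ≤ n then 2 * l * ξ (k + 1) ω - (2 * l) ^ 2 * Q (k + 1) ω else 0
  have hmem : ∀ {k : ℕ}, k + 1 ≤ n → k + 1 ∈ Finset.Icc 1 n := fun hk =>
    Finset.mem_Icc.2 ⟨by omega, hk⟩
  have hWi : ∀ i ∈ Finset.Icc 1 n, Integrable (W i) P := fun i hi =>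
    Integrable.of_bound ((h.W_measurable i hi).mono (hsigle _)).aestronglyMeasurable M
      (Filter.Eventually.of_forall (h.W_bdd i hi))
  have hξm : ∀ i ∈ Finset.Icc 1 n, StronglyMeasurable[sig ε (Set.Iic (i : ℤ))] (ξ i) := fun i hi =>
    (h.W_measurable i hi).sub ((h.stronglyMeasurable_H hi).mono
      (sig_mono ε (Set.Iic_subset_Iic.2 (by omega))))
  have hξa : ∀ i ∈ Finset.Icc 1 n, AEStronglyMeasurable (ξ i) P := fun i hi =>
    ((hξm i hi).mono (hsigle _)).aestronglyMeasurable
  have hξb : ∀ i ∈ Finset.Icc 1 n, ∀ᵐ ω ∂P, |ξ i ω| ≤ 2 * M := fun i hi => by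
    filter_upwards [h.abs_H_le hi] with ω hω
    exact (abs_sub _ _).trans (by linarith [h.W_bdd i hi ω])
  have hξ0 : ∀ i ∈ Finset.Icc 1 n, P[ξ i | sig ε (Set.Iic ((i : ℤ) - 1))] =ᵐ[P] 0 := fun i hi => by
    have h1 := condExp_sub (hWi i hi) (h.integrable_H hε hi) (sig ε (Set.Iic ((i : ℤ) - 1)))
    have h2 := condExp_of_stronglyMeasurable (hsigle _) (h.stronglyMeasurable_H hi)
      (h.integrable_H hε hi)
    filter_upwards [h1, h.H_eq i hi] with ω a1 a2
    change (P[W i - fun ω => H i (past ε ((i : ℤ) - 1) ω) | sig ε (Set.Iic ((i : ℤ) - 1))]) ω = 0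
    rw [a1, Pi.sub_apply, h2, ← a2, sub_self]
  have hQ0 : ∀ i, 0 ≤ᵐ[P] Q i := fun i =>
    condExp_nonneg (Filter.Eventually.of_forall fun ω => sq_nonneg (ξ i ω))
  have hQG : ∀ i ∈ Finset.Icc 1 n, ∀ᵐ ω ∂P, Q i ω ≤ G i (past ε ((i : ℤ) - 1) ω) := fun i hi => by
    have hW2 : MemLp (W i) 2 P := MemLp.of_bound
      ((h.W_measurable i hi).mono (hsigle _)).aestronglyMeasurable M
      (Filter.Eventually.of_forall (h.W_bdd i hi))
    have h1 := condVar_ae_le_condExp_sq (hsigle (Set.Iic ((i : ℤ) - 1))) hW2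
    have h2 : Q i =ᵐ[P] Var[W i; P | sig ε (Set.Iic ((i : ℤ) - 1))] := by
      refine condExp_congr_ae ?_
      filter_upwards [h.H_eq i hi] with ω hω
      simp only [ξ, hω, Pi.pow_apply, Pi.sub_apply]
    filter_upwards [h1, h2, h.G_eq i hi] with ω a1 a2 a3
    rw [a2, a3]; exact a1
  have hξl : ∀ i ∈ Finset.Icc 1 n, ∀ᵐ ω ∂P, |2 * l * ξ i ω| ≤ 1 := fun i hi => by
    filter_upwards [hξb i hi] with ω hω
    rw [abs_mul, abs_mul, abs_two]
    nlinarith [mul_le_mul_of_nonneg_left hω (abs_nonneg l)]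
  have hmono : Monotone fun k : ℕ => sig ε (Set.Iic (k : ℤ)) := fun k k' hk =>
    sig_mono ε (Set.Iic_subset_Iic.2 (by exact_mod_cast hk))
  have hcast : ∀ k : ℕ, ((k + 1 : ℕ) : ℤ) - 1 = k := fun k => by push_cast; ring
  have hAb : ∀ k, ∀ᵐ ω ∂P, A k ω ≤ 1 := fun k => by
    by_cases hk : k + 1 ≤ n
    · filter_upwards [hξl _ (hmem hk), hQ0 (k + 1)] with ω a1 a2
      have h1 : 0 ≤ (2 * l) ^ 2 * Q (k + 1) ω := mul_nonneg (sq_nonneg _) a2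
      simp only [A, if_pos hk]
      linarith [le_abs_self (2 * l * ξ (k + 1) ω)]
    · exact Filter.Eventually.of_forall fun ω => by simp only [A, if_neg hk]; norm_num
  have hAm : ∀ k, StronglyMeasurable[sig ε (Set.Iic ((k + 1 : ℕ) : ℤ))] (A k) := fun k => by
    by_cases hk : k + 1 ≤ n
    · simp only [A, if_pos hk]
      exact ((hξm _ (hmem hk)).const_mul _).sub ((stronglyMeasurable_condExp.mono
        (sig_mono ε (Set.Iic_subset_Iic.2 (by omega)))).const_mul _)
    · simp only [A, if_neg hk]; exact stronglyMeasurable_const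
  have hone := integral_exp_sum_le_one (P := P) hmono (fun k => hsigle _) hAm
    (C := fun _ => 1) hAb (fun k => by
      by_cases hk : k + 1 ≤ n
      · have h1 := condExp_exp_sub_le_one (P := P) (hsigle (Set.Iic (((k + 1 : ℕ) : ℤ) - 1)))
          (hξa _ (hmem hk)) (hξb _ (hmem hk)) (hξ0 _ (hmem hk))
          (Y := fun ω => 2 * l * ξ (k + 1) ω) ((hξa _ (hmem hk)).const_mul _) (θ := 2 * l) (by
            filter_upwards [hξl _ (hmem hk)] with ω hω
            refine (exp_le_of_abs_le_one hω).trans_eq ?_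
            ring)
        simp only [A, if_pos hk, Q]
        rw [hcast] at h1 ⊢
        exact h1
      · simp only [A, if_neg hk, Real.exp_zero]
        rw [condExp_const (hsigle _)]
        exact Filter.Eventually.of_forall fun _ => le_rfl) n
  have hAsum : ∀ ω, ∑ k ∈ Finset.range n, A k ω = 2 * l * ∑ i ∈ Finset.Icc 1 n, ξ i ω
      - 4 * l ^ 2 * ∑ i ∈ Finset.Icc 1 n, Q i ω := fun ω => by
    have h1 : ∀ f : ℕ → ℝ,
        ∑ i ∈ Finset.Icc 1 n, f i = ∑ k ∈ Finset.range n, f (k + 1) := fun f => by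
      rw [Finset.range_eq_Ico, Finset.sum_Ico_add' f 0 n 1, zero_add]; rfl
    rw [h1, h1, Finset.mul_sum, Finset.mul_sum, ← Finset.sum_sub_distrib]
    refine Finset.sum_congr rfl fun k hk => ?_
    simp only [A, if_pos (show k + 1 ≤ n from Finset.mem_range.1 hk)]
    ring
  have hAint : Integrable (fun ω => Real.exp (∑ k ∈ Finset.range n, A k ω)) P := by
    refine integrable_exp_of_ae_le (C := ∑ k ∈ Finset.range n, (1 : ℝ))
      (Finset.aestronglyMeasurable_fun_sum _ fun k _ =>
        ((hAm k).mono (hsigle _)).aestronglyMeasurable) ?_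
    filter_upwards [ae_all_iff.2 hAb] with ω hω
    exact Finset.sum_le_sum fun k _ => hω k
  -- the finite-range approximation of the compensator
  let V : ℕ → Ω → ℝ := fun i =>
    P[fun ω => G i (past ε ((i : ℤ) - 1) ω) | sig ε (Set.Ico ((i : ℤ) - r) i)]
  have hVg : ∀ i ∈ Finset.Icc 1 n,
      P[fun ω => G i (past ε ((i : ℤ) - 1) ω) | sig ε (Set.Ici ((i : ℤ) - r))] =ᵐ[P] V i :=
    fun i hi => by
      have h1 := condExp_sig_inter hε _ (Set.Ici ((i : ℤ) - r)) (h.stronglyMeasurable_G hi)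
        (h.integrable_G hε hi)
      have e : Set.Iic ((i : ℤ) - 1) ∩ Set.Ici ((i : ℤ) - r) = Set.Ico ((i : ℤ) - r) i := by
        ext j; simp only [Set.mem_inter_iff, Set.mem_Iic, Set.mem_Ici, Set.mem_Ico]; omega
      rwa [e] at h1
  have hVb : ∀ i ∈ Finset.Icc 1 n, ∀ᵐ ω ∂P, V i ω ≤ M ^ 2 := fun i hi => by
    filter_upwards [ae_bdd_abs_condExp_of_ae_bdd_abs (μ := P)
      (m := sig ε (Set.Ico ((i : ℤ) - r) i)) (h.abs_G_le hi)] with ω hω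
    exact (le_abs_self _).trans hω
  have hVint : ∀ i ∈ Finset.Icc 1 n, ∫ ω, V i ω ∂P = ∫ ω, W i ω ^ 2 ∂P := fun i hi => by
    simp only [V]
    rw [integral_condExp (hsigle _), integral_congr_ae (h.G_eq i hi), integral_condExp (hsigle _)]
  have hblocks := integral_exp_sum_le_of_nonneg hε n hr (V := V)
    (fun i _ => stronglyMeasurable_condExp) (sq_nonneg M)
    (fun i hi => condExp_nonneg (h.G_nonneg hi)) hVb (θ := 4 * l ^ 2) (by positivity) (by linarith)
  rw [Finset.sum_congr rfl hVint] at hblocks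
  have hVexp : Integrable (fun ω => Real.exp (4 * l ^ 2 * ∑ i ∈ Finset.Icc 1 n, V i ω)) P := by
    refine integrable_exp_of_ae_le (C := 4 * l ^ 2 * ∑ i ∈ Finset.Icc 1 n, M ^ 2)
      ((Finset.aestronglyMeasurable_fun_sum _ fun i _ => integrable_condExp.1).const_mul _) ?_
    filter_upwards [(Finset.eventually_all _).2 hVb] with ω hω
    exact mul_le_mul_of_nonneg_left (Finset.sum_le_sum hω) (by positivity)
  have hpt : ∀ᵐ ω ∂P, ω ∈ B → Real.exp (l * ∑ i ∈ Finset.Icc 1 n, ξ i ω)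
      ≤ (1 / 2) * Real.exp (∑ k ∈ Finset.range n, A k ω)
        + (Real.exp 1 / 2) * Real.exp (4 * l ^ 2 * ∑ i ∈ Finset.Icc 1 n, V i ω) := by
    filter_upwards [h.sum_G_le hε he q r c, (Finset.eventually_all _).2 hQG,
      (Finset.eventually_all _).2 hVg] with ω h1 h2 h3 hω
    have h4 := h1 hω
    rw [Finset.sum_congr rfl h3] at h4
    have h5 := (Finset.sum_le_sum h2).trans h4
    set a := ∑ k ∈ Finset.range n, A k ω with ha
    set X := 4 * l ^ 2 * ∑ i ∈ Finset.Icc 1 n, Q i ω with hX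
    -- `exp (a/2) exp (X/2) ≤ (exp a + exp X) / 2` separates supermartingale and compensator
    have e1 : l * ∑ i ∈ Finset.Icc 1 n, ξ i ω = a / 2 + X / 2 := by
      rw [ha, hAsum, hX]; ring
    have e2 : Real.exp (a / 2) ^ 2 = Real.exp a := by
      rw [← Real.exp_nat_mul]; congr 1; push_cast; ring
    have e3 : Real.exp (X / 2) ^ 2 = Real.exp X := by
      rw [← Real.exp_nat_mul]; congr 1; push_cast; ring
    have e4 : Real.exp X ≤ Real.exp 1 * Real.exp (4 * l ^ 2 * ∑ i ∈ Finset.Icc 1 n, V i ω) := by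
      rw [← Real.exp_add, Real.exp_le_exp, hX]
      nlinarith [mul_le_mul_of_nonneg_left h5 (show 0 ≤ 4 * l ^ 2 by positivity)]
    rw [e1, Real.exp_add]
    nlinarith [sq_nonneg (Real.exp (a / 2) - Real.exp (X / 2))]
  calc ∫ ω in B, Real.exp (l * ∑ i ∈ Finset.Icc 1 n, ξ i ω) ∂P
      ≤ ∫ ω in B, ((1 / 2) * Real.exp (∑ k ∈ Finset.range n, A k ω)
        + (Real.exp 1 / 2) * Real.exp (4 * l ^ 2 * ∑ i ∈ Finset.Icc 1 n, V i ω)) ∂P := by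
        refine integral_mono_of_nonneg (Filter.Eventually.of_forall fun ω => (Real.exp_pos _).le)
          ((hAint.const_mul _).add (hVexp.const_mul _)).integrableOn ?_
        exact (ae_restrict_iff' hBm).2 hpt
    _ ≤ ∫ ω, ((1 / 2) * Real.exp (∑ k ∈ Finset.range n, A k ω)
        + (Real.exp 1 / 2) * Real.exp (4 * l ^ 2 * ∑ i ∈ Finset.Icc 1 n, V i ω)) ∂P :=
        setIntegral_le_integral ((hAint.const_mul _).add (hVexp.const_mul _))
          (Filter.Eventually.of_forall fun ω => by positivity)
    _ = (1 / 2) * ∫ ω, Real.exp (∑ k ∈ Finset.range n, A k ω) ∂P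
        + (Real.exp 1 / 2) * ∫ ω, Real.exp (4 * l ^ 2 * ∑ i ∈ Finset.Icc 1 n, V i ω) ∂P := by
        rw [integral_add (hAint.const_mul _) (hVexp.const_mul _), integral_const_mul,
          integral_const_mul]
    _ ≤ (1 / 2) * 1 + (Real.exp 1 / 2) *
        Real.exp (16 * l ^ 2 * ∑ i ∈ Finset.Icc 1 n, ∫ ω, W i ω ^ 2 ∂P) := by
        refine add_le_add (mul_le_mul_of_nonneg_left hone (by norm_num))
          (mul_le_mul_of_nonneg_left (hblocks.trans_eq ?_) (by positivity))
        congr 1; ring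
    _ ≤ _ := by
        have h1 : 1 ≤ Real.exp 1 := Real.one_le_exp (by norm_num)
        have h2 : 1 ≤ Real.exp (16 * l ^ 2 * ∑ i ∈ Finset.Icc 1 n, ∫ ω, W i ω ^ 2 ∂P) :=
          Real.one_le_exp (mul_nonneg (by positivity)
            (Finset.sum_nonneg fun i _ => integral_nonneg fun ω => sq_nonneg _))
        nlinarith [mul_le_mul h1 h2 zero_le_one (by positivity)]

end MartingalePart

/-! ### The finite-range part of the conditional means -/

section FiniteRange

lemma integral_sq_eq_toReal {Ω : Type*} [MeasurableSpace Ω] {P : Measure Ω} {f : Ω → ℝ}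
    (hf : AEStronglyMeasurable f P) : ∫ ω, f ω ^ 2 ∂P = (eLpNorm f 2 P).toReal ^ 2 := by
  rw [integral_eq_lintegral_of_nonneg_ae (Filter.Eventually.of_forall fun ω => sq_nonneg (f ω))
    (hf.pow 2), lintegral_ofReal_sq, ENNReal.toReal_pow]

lemma integral_sq_le_of_eLpNorm_le {Ω : Type*} [MeasurableSpace Ω] {P : Measure Ω} {f : Ω → ℝ}
    (hf : AEStronglyMeasurable f P) {a : ℝ} (ha : 0 ≤ a) (h : eLpNorm f 2 P ≤ ENNReal.ofReal a) :
    ∫ ω, f ω ^ 2 ∂P ≤ a ^ 2 := by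
  rw [integral_sq_eq_toReal hf]
  exact pow_le_pow_left₀ ENNReal.toReal_nonneg (ENNReal.toReal_le_of_le_ofReal ha h) 2

lemma integral_condExp_sq_le {Ω : Type*} {m m0 : MeasurableSpace Ω} {P : Measure Ω}
    [IsProbabilityMeasure P] {f : Ω → ℝ} (hf : MemLp f 2 P) :
    ∫ ω, (P[f | m]) ω ^ 2 ∂P ≤ ∫ ω, f ω ^ 2 ∂P := by
  rw [integral_sq_eq_toReal integrable_condExp.1, integral_sq_eq_toReal hf.1]
  exact pow_le_pow_left₀ ENNReal.toReal_nonneg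
    (ENNReal.toReal_mono hf.2.ne (eLpNorm_condExp_le_eLpNorm f (by norm_num))) 2

lemma integral_sub_condExp_sq_le {Ω : Type*} {m m0 : MeasurableSpace Ω} (hm : m ≤ m0)
    {P : Measure Ω} [IsProbabilityMeasure P] {f : Ω → ℝ} (hf : MemLp f 2 P) :
    ∫ ω, (f ω - (P[f | m]) ω) ^ 2 ∂P ≤ ∫ ω, f ω ^ 2 ∂P := by
  have h1 := integral_mono_ae integrable_condExp integrable_condExp
    (condVar_ae_le_condExp_sq hm hf)
  change ∫ ω, (P[(f - P[f | m]) ^ 2 | m]) ω ∂P ≤ _ at h1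
  rw [integral_condExp hm, integral_condExp hm] at h1
  simpa using h1

/-- Pairwise orthogonal sums that are indexed by a second parameter `k`: a weighted Cauchy–Schwarz
inequality in `k`. -/
lemma sum_integral_sum_sum_sq_le {Ω : Type*} [MeasurableSpace Ω] {P : Measure Ω} {n q r : ℕ}
    {Y : ℕ → ℕ → Ω → ℝ} (hY : ∀ i ∈ Finset.Icc 1 n, ∀ k, MemLp (Y i k) 2 P)
    (horth : ∀ i ∈ Finset.Icc 1 n, ∀ j ∈ Finset.Icc 1 n, ∀ k, i < j →
      ∫ ω, Y i k ω * Y j k ω ∂P = 0) {N : ℝ} (hN : 0 ≤ N) {v : ℕ → ℝ} (hv : ∀ k, 0 ≤ v k)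
    (hle : ∀ k, ∑ i ∈ Finset.Icc 1 n, ∫ ω, Y i k ω ^ 2 ∂P ≤ N * v k ^ 2) :
    ∑ b ∈ Finset.range (n / r + 1), ∫ ω, (∑ i ∈ block n r b, ∑ k ∈ Finset.range q, Y i k ω) ^ 2 ∂P
      ≤ N * (∑ k ∈ Finset.range q, v k) ^ 2 := by
  have hblock : ∀ {b i}, i ∈ block n r b → i ∈ Finset.Icc 1 n := fun hi =>
    Finset.filter_subset _ _ hi
  let S : ℕ → ℕ → Ω → ℝ := fun b k ω => ∑ i ∈ block n r b, Y i k ω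
  have hS : ∀ b k, MemLp (S b k) 2 P := fun b k =>
    memLp_finsetSum _ fun i hi => hY i (hblock hi) k
  have hS2 : ∀ b k, ∫ ω, S b k ω ^ 2 ∂P = ∑ i ∈ block n r b, ∫ ω, Y i k ω ^ 2 ∂P := by
    intro b k
    have hint : ∀ i ∈ block n r b, ∀ j ∈ block n r b, Integrable (fun ω => Y i k ω * Y j k ω) P :=
      fun i hi j hj => (hY i (hblock hi) k).integrable_mul (hY j (hblock hj) k)
    have e : ∀ ω, S b k ω ^ 2 = ∑ i ∈ block n r b, ∑ j ∈ block n r b, Y i k ω * Y j k ω := by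
      intro ω; rw [sq, Finset.sum_mul_sum]
    simp only [e]
    rw [integral_finsetSum _ fun i hi => integrable_finsetSum _ fun j hj => hint i hi j hj]
    refine Finset.sum_congr rfl fun i hi => ?_
    rw [integral_finsetSum _ fun j hj => hint i hi j hj,
      Finset.sum_eq_single_of_mem i hi fun j hj hij => ?_]
    · simp only [sq]
    · rcases lt_or_gt_of_ne hij with hlt | hlt
      · rw [← horth j (hblock hj) i (hblock hi) k hlt]
        simp only [mul_comm]
      · exact horth i (hblock hi) j (hblock hj) k hlt
  -- the weights have to be positive for the Cauchy–Schwarz inequality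
  have hη : ∀ η : ℝ, 0 < η → ∑ b ∈ Finset.range (n / r + 1),
      ∫ ω, (∑ i ∈ block n r b, ∑ k ∈ Finset.range q, Y i k ω) ^ 2 ∂P
        ≤ N * (∑ k ∈ Finset.range q, (v k + η)) ^ 2 := by
    intro η hη
    have hw : ∀ k, 0 < v k + η := fun k => add_pos_of_nonneg_of_pos (hv k) hη
    have hw0 : 0 ≤ ∑ k ∈ Finset.range q, (v k + η) := Finset.sum_nonneg fun k _ => (hw k).le
    have hcs : ∀ b, ∫ ω, (∑ i ∈ block n r b, ∑ k ∈ Finset.range q, Y i k ω) ^ 2 ∂P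
        ≤ (∑ k ∈ Finset.range q, (v k + η)) * ∑ k ∈ Finset.range q,
          (∑ i ∈ block n r b, ∫ ω, Y i k ω ^ 2 ∂P) / (v k + η) := by
      intro b
      have hi : ∀ k ∈ Finset.range q, Integrable (fun ω => S b k ω ^ 2 / (v k + η)) P :=
        fun k _ => (hS b k).integrable_sq.div_const _
      calc _ ≤ ∫ ω, (∑ k ∈ Finset.range q, (v k + η))
            * ∑ k ∈ Finset.range q, S b k ω ^ 2 / (v k + η) ∂P := by
            refine integral_mono_of_nonneg (Filter.Eventually.of_forall fun ω => sq_nonneg _)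
              ((integrable_finsetSum _ hi).const_mul _) (Filter.Eventually.of_forall fun ω => ?_)
            simp only
            rw [Finset.sum_comm]
            refine Finset.sum_sq_le_sum_mul_sum_of_sq_le_mul _ (fun k _ => (hw k).le)
              (fun k _ => div_nonneg (sq_nonneg _) (hw k).le) fun k _ => le_of_eq ?_
            rw [mul_div_cancel₀ _ (hw k).ne']
        _ = _ := by
            rw [integral_const_mul, integral_finsetSum _ hi]
            simp only [integral_div, hS2]
    calc _ ≤ ∑ b ∈ Finset.range (n / r + 1), (∑ k ∈ Finset.range q, (v k + η)) *
          ∑ k ∈ Finset.range q, (∑ i ∈ block n r b, ∫ ω, Y i k ω ^ 2 ∂P) / (v k + η) :=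
          Finset.sum_le_sum fun b _ => hcs b
      _ = (∑ k ∈ Finset.range q, (v k + η)) * ∑ k ∈ Finset.range q,
          (∑ i ∈ Finset.Icc 1 n, ∫ ω, Y i k ω ^ 2 ∂P) / (v k + η) := by
          rw [← Finset.mul_sum, Finset.sum_comm]
          congr 1
          refine Finset.sum_congr rfl fun k _ => ?_
          rw [← Finset.sum_div, sum_block]
      _ ≤ (∑ k ∈ Finset.range q, (v k + η)) * ∑ k ∈ Finset.range q, N * (v k + η) := by
          refine mul_le_mul_of_nonneg_left (Finset.sum_le_sum fun k _ => ?_) hw0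
          rw [div_le_iff₀ (hw k), mul_assoc]
          refine (hle k).trans (mul_le_mul_of_nonneg_left ?_ hN)
          nlinarith [hv k]
      _ = _ := by rw [← Finset.mul_sum]; ring
  have hlim : Filter.Tendsto (fun η : ℝ => N * (∑ k ∈ Finset.range q, (v k + η)) ^ 2)
      (nhdsWithin 0 (Set.Ioi 0)) (nhds (N * (∑ k ∈ Finset.range q, v k) ^ 2)) := by
    have hc : Continuous fun η : ℝ => N * (∑ k ∈ Finset.range q, (v k + η)) ^ 2 := by fun_prop
    exact (hc.tendsto' 0 _ (by simp)).mono_left nhdsWithin_le_nhds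
  exact ge_of_tendsto hlim (by filter_upwards [self_mem_nhdsWithin] with η h using hη η h)

lemma sig_Ici_le {Ω : Type*} {dt : ℕ} (ε : ℤ → Ω → Fin dt → ℝ) (i : ℤ) (k : ℕ) :
    sig ε (Set.Ici (i - k)) ≤ sig ε (Set.Ici (i - (k + 1 : ℕ))) :=
  sig_mono ε (Set.Ici_subset_Ici.2 (by push_cast; omega))

variable {Ω : Type*} {dt : ℕ} [MeasurableSpace Ω] {P : Measure Ω} [IsProbabilityMeasure P]
  {ε : ℤ → Ω → Fin dt → ℝ} {n : ℕ} {M : ℝ} {Δ : ℕ → ℝ} {C : ℝ} {E d : ℕ → ℝ}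
  {ψ χ : ℕ → ℕ → Ω × Ω → ℝ} {W : ℕ → Ω → ℝ} {H G : ℕ → Seq dt → ℝ}

/-- The martingale increment that reveals the innovation at time `i - 1 - k` in the `i`-th
conditional mean. -/
noncomputable def meanIncrement (P : Measure Ω) (ε : ℤ → Ω → Fin dt → ℝ)
    (H : ℕ → Seq dt → ℝ) (i k : ℕ) (ω : Ω) : ℝ :=
  (P[fun ω => H i (past ε ((i : ℤ) - 1) ω) | sig ε (Set.Ici ((i : ℤ) - (k + 1 : ℕ)))]) ω
    - (P[fun ω => H i (past ε ((i : ℤ) - 1) ω) | sig ε (Set.Ici ((i : ℤ) - k))]) ω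

lemma IsDominated.memLp_H (hε : IsInnovation P ε) (h : IsDominated P ε n M E ψ χ d W H G) {i : ℕ}
    (hi : i ∈ Finset.Icc 1 n) : MemLp (fun ω => H i (past ε ((i : ℤ) - 1) ω)) 2 P :=
  MemLp.of_bound (h.integrable_H hε hi).1 M (h.abs_H_le hi)

lemma IsDominated.memLp_meanIncrement (hε : IsInnovation P ε)
    (h : IsDominated P ε n M E ψ χ d W H G) {i : ℕ} (hi : i ∈ Finset.Icc 1 n) (k : ℕ) :
    MemLp (meanIncrement P ε H i k) 2 P :=
  ((h.memLp_H hε hi).condExp (by norm_num)).sub ((h.memLp_H hε hi).condExp (by norm_num))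

lemma condExp_meanIncrement (hε : IsInnovation P ε) (i k : ℕ) :
    P[meanIncrement P ε H i k | sig ε (Set.Ici ((i : ℤ) - k))] =ᵐ[P] 0 := by
  set X : Ω → ℝ := fun ω => H i (past ε ((i : ℤ) - 1) ω) with hX
  have hle := sig_le (ε := ε) hε.measurable
  have h1 := condExp_sub (μ := P) (integrable_condExp (μ := P)
    (m := sig ε (Set.Ici ((i : ℤ) - (k + 1 : ℕ)))) (f := X))
    (integrable_condExp (μ := P) (m := sig ε (Set.Ici ((i : ℤ) - k))) (f := X))
    (sig ε (Set.Ici ((i : ℤ) - k)))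
  have h2 := condExp_condExp_of_le (μ := P) (f := X) (sig_Ici_le ε i k) (hle _)
  have h3 := condExp_condExp_of_le (μ := P) (f := X)
    (le_refl (sig ε (Set.Ici ((i : ℤ) - k)))) (hle _)
  filter_upwards [h1, h2, h3] with ω a1 a2 a3
  refine a1.trans ?_
  rw [Pi.sub_apply, a2, a3, sub_self]; rfl

lemma IsDominated.integral_meanIncrement_mul (hε : IsInnovation P ε)
    (h : IsDominated P ε n M E ψ χ d W H G) {i j : ℕ} (hi : i ∈ Finset.Icc 1 n)
    (hj : j ∈ Finset.Icc 1 n) (k : ℕ) (hij : i < j) :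
    ∫ ω, meanIncrement P ε H i k ω * meanIncrement P ε H j k ω ∂P = 0 := by
  have hle := sig_le (ε := ε) hε.measurable
  have hm : StronglyMeasurable[sig ε (Set.Ici ((i : ℤ) - k))] (meanIncrement P ε H j k) := by
    have h1 : StronglyMeasurable[sig ε (Set.Ici ((j : ℤ) - (k + 1 : ℕ)))]
        (meanIncrement P ε H j k) :=
      stronglyMeasurable_condExp.sub (stronglyMeasurable_condExp.mono (sig_Ici_le ε j k))
    exact h1.mono (sig_mono ε (Set.Ici_subset_Ici.2 (by push_cast; omega)))
  have hint := (h.memLp_meanIncrement hε hi k).integrable_mul (h.memLp_meanIncrement hε hj k)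
  have h1 := condExp_mul_of_stronglyMeasurable_right hm hint
    ((h.memLp_meanIncrement hε hi k).integrable (by norm_num))
  have h2 : P[meanIncrement P ε H i k * meanIncrement P ε H j k | sig ε (Set.Ici ((i : ℤ) - k))]
      =ᵐ[P] 0 := by
    filter_upwards [h1, condExp_meanIncrement (P := P) (H := H) hε i k] with ω a1 a2
    rw [a1, Pi.mul_apply, a2]; simp
  change ∫ ω, (meanIncrement P ε H i k * meanIncrement P ε H j k) ω ∂P = 0
  rw [← integral_condExp (hle (Set.Ici ((i : ℤ) - k))), integral_congr_ae h2]
  simp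

lemma IsDominated.integral_meanIncrement_sq_le (hε : IsInnovation P ε)
    (h : IsDominated P ε n M E ψ χ d W H G) {i : ℕ} (hi : i ∈ Finset.Icc 1 n) (k : ℕ) :
    ∫ ω, meanIncrement P ε H i k ω ^ 2 ∂P ≤ ∫ ω, W i ω ^ 2 ∂P := by
  set X : Ω → ℝ := fun ω => H i (past ε ((i : ℤ) - 1) ω) with hX
  have hle := sig_le (ε := ε) hε.measurable
  have hW : MemLp (W i) 2 P := MemLp.of_bound
    ((h.W_measurable i hi).mono (hle _)).aestronglyMeasurable M
    (Filter.Eventually.of_forall (h.W_bdd i hi))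
  have h1 := integral_sub_condExp_sq_le (hle (Set.Ici ((i : ℤ) - k)))
    ((h.memLp_H hε hi).condExp (m := sig ε (Set.Ici ((i : ℤ) - (k + 1 : ℕ)))) (by norm_num))
  have h2 := condExp_condExp_of_le (μ := P) (f := X) (sig_Ici_le ε i k) (hle _)
  have e1 : ∫ ω, meanIncrement P ε H i k ω ^ 2 ∂P
      = ∫ ω, ((P[X | sig ε (Set.Ici ((i : ℤ) - (k + 1 : ℕ)))]) ω
        - (P[P[X | sig ε (Set.Ici ((i : ℤ) - (k + 1 : ℕ)))] | sig ε (Set.Ici ((i : ℤ) - k))]) ω) ^ 2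
        ∂P := by
    refine integral_congr_ae ?_
    filter_upwards [h2] with ω hω
    rw [hω, hX, meanIncrement]
  have e2 : ∫ ω, X ω ^ 2 ∂P = ∫ ω, (P[W i | sig ε (Set.Iic ((i : ℤ) - 1))]) ω ^ 2 ∂P := by
    refine integral_congr_ae ?_
    filter_upwards [h.H_eq i hi] with ω hω
    simp only [hX, hω]
  rw [e1]
  exact h1.trans ((integral_condExp_sq_le (h.memLp_H hε hi)).trans
    (e2.le.trans (integral_condExp_sq_le hW)))

lemma IsDominated.integral_meanIncrement_sq_le_weight (hε : IsInnovation P ε)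
    (he : IsEnvelope P n Δ C E ψ χ) (h : IsDominated P ε n M E ψ χ d W H G) {i : ℕ}
    (hi : i ∈ Finset.Icc 1 n) (k : ℕ) :
    ∫ ω, meanIncrement P ε H i k ω ^ 2 ∂P ≤ (d i * Δ (k + 1)) ^ 2 := by
  refine integral_sq_le_of_eLpNorm_le (h.memLp_meanIncrement hε hi k).1
    (mul_nonneg (h.d_nonneg i) (he.Δ_nonneg _)) ?_
  have e1 : (i : ℤ) - (k + 1 : ℕ) = i - 1 - k := by push_cast; ring
  have e2 : (i : ℤ) - k = i - 1 - k + 1 := by ring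
  have h1 : ∀ᵐ ω ∂P, ‖meanIncrement P ε H i k ω‖
      ≤ ‖(d i • projBound P ε (ψ i k) ((i : ℤ) - 1 - k)) ω‖ := by
    filter_upwards [h.abs_proj_H_le hε he hi k] with ω hω
    rw [meanIncrement, e1, e2, Real.norm_eq_abs]
    exact hω.trans (le_abs_self _)
  refine (eLpNorm_mono_ae h1).trans ?_
  rw [eLpNorm_const_smul, Real.enorm_eq_ofReal (h.d_nonneg i), ENNReal.ofReal_mul (h.d_nonneg i)]
  exact mul_le_mul_right ((eLpNorm_projBound_le (he.ψ_measurable i k) _).trans (he.ψ_le i hi k)) _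

lemma IsDominated.condExp_sig_Ici_self (hε : IsInnovation P ε)
    (h : IsDominated P ε n M E ψ χ d W H G) {i : ℕ} (hi : i ∈ Finset.Icc 1 n) :
    P[fun ω => H i (past ε ((i : ℤ) - 1) ω) | sig ε (Set.Ici (i : ℤ))]
      =ᵐ[P] fun _ => ∫ ω, W i ω ∂P := by
  have hle := sig_le (ε := ε) hε.measurable
  have h1 := condExp_indep_eq (hle _) (hle (Set.Ici (i : ℤ))) (h.stronglyMeasurable_H hi)
    (indep_sig hε (Set.disjoint_left.2 fun j hj hj' => by
      simp only [Set.mem_Iic, Set.mem_Ici] at hj hj'; omega))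
  have h2 : ∫ ω, H i (past ε ((i : ℤ) - 1) ω) ∂P = ∫ ω, W i ω ∂P := by
    rw [integral_congr_ae (h.H_eq i hi), integral_condExp (hle _)]
  rwa [h2] at h1

/-- The finite-range part of the centred conditional means is a sum of `q`-dependent variables. The
variance of a sum over a block is estimated by decomposing every summand into martingale
increments: those of the same lag are orthogonal. -/
lemma IsDominated.integral_exp_finiteRange_le (hε : IsInnovation P ε)
    (he : IsEnvelope P n Δ C E ψ χ) (h : IsDominated P ε n M E ψ χ d W H G) {q : ℕ} (hq : 1 ≤ q)
    {l : ℝ} (hl : 4 * |l| * (q * M) ≤ 1) {N : ℝ} (hN : 0 ≤ N) {v : ℕ → ℝ} (hv : ∀ k, 0 ≤ v k)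
    (hle : ∀ k, min (∑ i ∈ Finset.Icc 1 n, ∫ ω, W i ω ^ 2 ∂P)
      (∑ i ∈ Finset.Icc 1 n, (d i * Δ (k + 1)) ^ 2) ≤ N * v k ^ 2) :
    ∫ ω, Real.exp (l * ∑ i ∈ Finset.Icc 1 n,
      ((P[fun ω => H i (past ε ((i : ℤ) - 1) ω) | sig ε (Set.Ici ((i : ℤ) - q))]) ω
        - ∫ ω', W i ω' ∂P)) ∂P
      ≤ Real.exp (4 * l ^ 2 * (N * (∑ k ∈ Finset.range q, v k) ^ 2)) := by
  have hM := h.M_pos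
  have hsig := sig_le (ε := ε) hε.measurable
  let X : ℕ → Ω → ℝ := fun i ω => H i (past ε ((i : ℤ) - 1) ω)
  let V : ℕ → Ω → ℝ := fun i ω =>
    (P[X i | sig ε (Set.Ico ((i : ℤ) - q) i)]) ω - ∫ ω', W i ω' ∂P
  have hVX : ∀ i ∈ Finset.Icc 1 n, ∀ᵐ ω ∂P,
      (P[X i | sig ε (Set.Ici ((i : ℤ) - q))]) ω - ∫ ω', W i ω' ∂P = V i ω := fun i hi => by
    have h1 := condExp_sig_inter hε _ (Set.Ici ((i : ℤ) - q)) (h.stronglyMeasurable_H hi)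
      (h.integrable_H hε hi)
    have e : Set.Iic ((i : ℤ) - 1) ∩ Set.Ici ((i : ℤ) - q) = Set.Ico ((i : ℤ) - q) i := by
      ext j; simp only [Set.mem_inter_iff, Set.mem_Iic, Set.mem_Ici, Set.mem_Ico]; omega
    rw [e] at h1
    filter_upwards [h1] with ω hω
    simp only [V, X]
    rw [hω]
  have hVY : ∀ i ∈ Finset.Icc 1 n, ∀ᵐ ω ∂P,
      V i ω = ∑ k ∈ Finset.range q, meanIncrement P ε H i k ω := fun i hi => by
    filter_upwards [hVX i hi, h.condExp_sig_Ici_self hε hi] with ω a1 a2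
    have h1 := Finset.sum_range_sub (fun k : ℕ => (P[X i | sig ε (Set.Ici ((i : ℤ) - k))]) ω) q
    simp only [Nat.cast_zero, sub_zero] at h1
    rw [← a1]
    refine Eq.trans ?_ h1.symm
    simp only [X]
    rw [a2]
  have hVm : ∀ i : ℕ, StronglyMeasurable[sig ε (Set.Ico ((i : ℤ) - q) i)] (V i) := fun i =>
    stronglyMeasurable_condExp.sub stronglyMeasurable_const
  have hVb : ∀ i ∈ Finset.Icc 1 n, ∀ᵐ ω ∂P, |V i ω| ≤ 2 * M := fun i hi => by
    have h1 : |∫ ω', W i ω' ∂P| ≤ M := by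
      have := norm_integral_le_of_norm_le_const (μ := P) (f := W i) (C := M)
        (Filter.Eventually.of_forall (h.W_bdd i hi))
      simpa using this
    filter_upwards [ae_bdd_abs_condExp_of_ae_bdd_abs (μ := P)
      (m := sig ε (Set.Ico ((i : ℤ) - q) i)) (h.abs_H_le hi)] with ω hω
    exact (abs_sub _ _).trans (by linarith)
  have hV0 : ∀ i ∈ Finset.Icc 1 n, ∫ ω, V i ω ∂P = 0 := fun i hi => by
    simp only [V, X]
    rw [integral_sub integrable_condExp (integrable_const _), integral_condExp (hsig _),
      integral_congr_ae (h.H_eq i hi), integral_condExp (hsig _)]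
    simp
  have hmain := integral_exp_sum_le_of_centered hε n hq (V := V) (fun i _ => hVm i)
    (K := 2 * M) (by positivity) hVb hV0 (l := l) (by linarith)
  have hvar : ∑ b ∈ Finset.range (n / q + 1), ∫ ω, (∑ i ∈ block n q b, V i ω) ^ 2 ∂P
      ≤ N * (∑ k ∈ Finset.range q, v k) ^ 2 := by
    refine le_trans (le_of_eq (Finset.sum_congr rfl fun b _ => integral_congr_ae ?_))
      (sum_integral_sum_sum_sq_le (P := P) (n := n) (q := q) (r := q)
        (Y := meanIncrement P ε H) (fun i hi k => h.memLp_meanIncrement hε hi k)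
        (fun i hi j hj k hij => h.integral_meanIncrement_mul hε hi hj k hij) hN hv fun k =>
          le_trans (le_min ?_ ?_) (hle k))
    · filter_upwards [(Finset.eventually_all _).2 hVY] with ω hω
      congr 1
      exact Finset.sum_congr rfl fun i hi => hω i (Finset.filter_subset _ _ hi)
    · exact Finset.sum_le_sum fun i hi => h.integral_meanIncrement_sq_le hε hi k
    · exact Finset.sum_le_sum fun i hi => h.integral_meanIncrement_sq_le_weight hε he hi k
  calc _ = ∫ ω, Real.exp (l * ∑ i ∈ Finset.Icc 1 n, V i ω) ∂P := by
        refine integral_congr_ae ?_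
        filter_upwards [(Finset.eventually_all _).2 hVX] with ω hω
        rw [Finset.sum_congr rfl hω]
    _ ≤ _ := hmain.trans (Real.exp_le_exp.2 (mul_le_mul_of_nonneg_left hvar (by positivity)))

end FiniteRange

/-! ### The Bernstein inequality on the good event -/

section Bernstein

/-- The two-sided form of the exponential Markov inequality. -/
lemma measureReal_abs_inter_le_of_mgf {Ω : Type*} [MeasurableSpace Ω] {P : Measure Ω}
    [IsProbabilityMeasure P] {T : Ω → ℝ} {B : Set Ω} (hB : MeasurableSet B)
    (hT : AEStronglyMeasurable T P) {b : ℝ} (hb : ∀ᵐ ω ∂P, |T ω| ≤ b) {K v A κ : ℝ} (hv : 0 ≤ v)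
    (hA : 0 < A) (hκ : 0 < κ)
    (hmgf : ∀ l, |l| ≤ 1 / A →
      ∫ ω in B, Real.exp (l * T ω) ∂P ≤ K * Real.exp (κ * l ^ 2 * v)) {t : ℝ} (ht : 0 < t) :
    P.real ({ω | t < |T ω|} ∩ B) ≤ 2 * (K * Real.exp (-(t ^ 2 / (4 * κ * v + 2 * A * t)))) := by
  have hint : ∀ l, Integrable (fun ω => Real.exp (l * T ω)) P := fun l => by
    refine integrable_exp_of_ae_le (C := |l| * b) (hT.const_mul l) ?_
    filter_upwards [hb] with ω hω
    refine (le_abs_self _).trans ?_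
    rw [abs_mul]
    exact mul_le_mul_of_nonneg_left hω (abs_nonneg l)
  have h1 := measureReal_inter_le_of_mgf (W := T) hB hv hA hκ (fun l _ _ => hint l)
    (fun l h0 hl => hmgf l (by rwa [abs_of_pos h0])) ht
  have h2 := measureReal_inter_le_of_mgf (W := fun ω => -T ω) (K := K) hB hv hA hκ
    (fun l _ _ => by simpa using hint (-l))
    (fun l h0 hl => by simpa using hmgf (-l) (by rwa [abs_neg, abs_of_pos h0])) ht
  have hsub : {ω | t < |T ω|} ∩ B ⊆ ({ω | t < T ω} ∩ B) ∪ ({ω | t < -T ω} ∩ B) := by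
    rintro ω ⟨h, hωB⟩
    rcases lt_abs.1 (show t < |T ω| from h) with h | h
    · exact Or.inl ⟨h, hωB⟩
    · exact Or.inr ⟨h, hωB⟩
  calc _ ≤ _ := measureReal_mono hsub
    _ ≤ _ := measureReal_union_le _ _
    _ ≤ _ := by linarith

variable {Ω : Type*} {dt : ℕ} [MeasurableSpace Ω] {P : Measure Ω} [IsProbabilityMeasure P]
  {ε : ℤ → Ω → Fin dt → ℝ} {n : ℕ} {M : ℝ} {Δ : ℕ → ℝ} {C : ℝ} {E d : ℕ → ℝ}
  {ψ χ : ℕ → ℕ → Ω × Ω → ℝ} {W : ℕ → Ω → ℝ} {H G : ℕ → Seq dt → ℝ}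

/-- The centred sum is split into its martingale part, the finite-range part of the conditional
means, and the long-range part of the conditional means. -/
lemma IsDominated.measureReal_abs_sum_le (hε : IsInnovation P ε)
    (he : IsEnvelope P n Δ C E ψ χ) (h : IsDominated P ε n M E ψ χ d W H G) {q : ℕ} (hq : 1 ≤ q)
    {N : ℝ} (hN : 0 ≤ N) {v : ℕ → ℝ} (hv : ∀ k, 0 ≤ v k)
    (hle : ∀ k, min (∑ i ∈ Finset.Icc 1 n, ∫ ω, W i ω ^ 2 ∂P)
      (∑ i ∈ Finset.Icc 1 n, (d i * Δ (k + 1)) ^ 2) ≤ N * v k ^ 2) {K : ℝ}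
    (hK1 : ∑ i ∈ Finset.Icc 1 n, ∫ ω, W i ω ^ 2 ∂P ≤ K)
    (hK2 : N * (∑ k ∈ Finset.range q, v k) ^ 2 ≤ K) {t : ℝ} (ht : 0 < t) :
    P.real ({ω | 3 * t < |∑ i ∈ Finset.Icc 1 n, (W i ω - ∫ ω', W i ω' ∂P)|}
        ∩ goodEvent P ε n q (q * q) (2 * M * q) E ψ χ)
      ≤ 6 * Real.exp 1 * Real.exp (-(t ^ 2 / (64 * K + 8 * M * q * t))) := by
  set B := goodEvent P ε n q (q * q) (2 * M * q) E ψ χ with hB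
  have hBm : MeasurableSet B := measurableSet_goodEvent hε.measurable _ _ _ _ _ _ _
  have hM := h.M_pos
  have hsig := sig_le (ε := ε) hε.measurable
  have hq1 : (1 : ℝ) ≤ q := by exact_mod_cast hq
  have hA : 0 < 4 * M * q := by positivity
  have hK0 : 0 ≤ K := (mul_nonneg hN (sq_nonneg _)).trans hK2
  let X : ℕ → Ω → ℝ := fun i ω => H i (past ε ((i : ℤ) - 1) ω)
  let U : ℕ → Ω → ℝ := fun i => P[X i | sig ε (Set.Ici ((i : ℤ) - q))]
  have hXa : ∀ i ∈ Finset.Icc 1 n, AEStronglyMeasurable (X i) P := fun i hi =>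
    (h.integrable_H hε hi).1
  have hWa : ∀ i ∈ Finset.Icc 1 n, AEStronglyMeasurable (W i) P := fun i hi =>
    ((h.W_measurable i hi).mono (hsig _)).aestronglyMeasurable
  have hWb : ∀ i ∈ Finset.Icc 1 n, |∫ ω', W i ω' ∂P| ≤ M := fun i hi => by
    have := norm_integral_le_of_norm_le_const (μ := P) (f := W i) (C := M)
      (Filter.Eventually.of_forall (h.W_bdd i hi))
    simpa using this
  have hbd : ∀ᵐ ω ∂P, ∀ i ∈ Finset.Icc 1 n, |X i ω| ≤ M ∧ |U i ω| ≤ M :=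
    (Finset.eventually_all _).2 fun i hi =>
      (h.abs_H_le hi).and (ae_bdd_abs_condExp_of_ae_bdd_abs (h.abs_H_le hi))
  -- the range of parameters for which all three parts have good exponential moments
  have hl : ∀ {l : ℝ}, |l| ≤ 1 / (4 * M * q) →
      4 * |l| * (q * M) ≤ 1 ∧ 16 * l ^ 2 * (M * q) ^ 2 ≤ 1 := by
    intro l hl
    rw [le_div_iff₀ hA] at hl
    have h1 : 4 * |l| * (q * M) ≤ 1 := by linarith
    refine ⟨h1, ?_⟩
    have h2 : (4 * |l| * (q * M)) ^ 2 ≤ 1 := pow_le_one₀ (by positivity) h1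
    rw [← sq_abs l]
    linarith
  have hexp1 : (1 : ℝ) ≤ Real.exp 1 := Real.one_le_exp (by norm_num)
  have hb : ∀ {a : ℕ → ℝ}, (∀ i ∈ Finset.Icc 1 n, |a i| ≤ 2 * M) →
      |∑ i ∈ Finset.Icc 1 n, a i| ≤ n * (2 * M) := fun {a} ha =>
    (Finset.abs_sum_le_sum_abs _ _).trans ((Finset.sum_le_sum ha).trans_eq (by simp))
  have hpart : ∀ {T : Ω → ℝ}, AEStronglyMeasurable T P → (∀ᵐ ω ∂P, |T ω| ≤ n * (2 * M)) →
      (∀ l, |l| ≤ 1 / (4 * M * q) →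
        ∫ ω in B, Real.exp (l * T ω) ∂P ≤ Real.exp 1 * Real.exp (16 * l ^ 2 * K)) →
      P.real ({ω | t < |T ω|} ∩ B)
        ≤ 2 * (Real.exp 1 * Real.exp (-(t ^ 2 / (64 * K + 8 * M * q * t)))) := by
    intro T hT hTb hTl
    refine (measureReal_abs_inter_le_of_mgf hBm hT hTb hK0 hA (by norm_num) hTl ht).trans_eq ?_
    congr 5; ring
  have h1 := hpart (T := fun ω => ∑ i ∈ Finset.Icc 1 n, (W i ω - X i ω))
    (Finset.aestronglyMeasurable_fun_sum _ fun i hi => (hWa i hi).sub (hXa i hi))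
    (by
      filter_upwards [hbd] with ω hω
      exact hb fun i hi => (abs_sub _ _).trans (by linarith [(hω i hi).1, h.W_bdd i hi ω]))
    (fun l hl' => by
      obtain ⟨a1, a2⟩ := hl hl'
      have hlM : 0 ≤ |l| * M := mul_nonneg (abs_nonneg l) hM.le
      refine (h.setIntegral_exp_martingale_le hε he q (r := q * q) (Nat.mul_pos hq hq)
        (by nlinarith) (by push_cast; nlinarith [sq_nonneg (l * (M * q))])
        (by nlinarith)).trans ?_
      gcongr)
  have h2 := hpart (T := fun ω => ∑ i ∈ Finset.Icc 1 n, (U i ω - ∫ ω', W i ω' ∂P))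
    (Finset.aestronglyMeasurable_fun_sum _ fun i _ =>
      integrable_condExp.1.sub aestronglyMeasurable_const)
    (by
      filter_upwards [hbd] with ω hω
      exact hb fun i hi => (abs_sub _ _).trans (by linarith [(hω i hi).2, hWb i hi]))
    (fun l hl' => by
      have hint : Integrable (fun ω => Real.exp (l * ∑ i ∈ Finset.Icc 1 n,
          (U i ω - ∫ ω', W i ω' ∂P))) P := by
        refine integrable_exp_of_ae_le (C := |l| * (n * (2 * M)))
          ((Finset.aestronglyMeasurable_fun_sum _ fun i _ =>
            integrable_condExp.1.sub aestronglyMeasurable_const).const_mul l) ?_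
        filter_upwards [hbd] with ω hω
        refine (le_abs_self _).trans ?_
        rw [abs_mul]
        exact mul_le_mul_of_nonneg_left
          (hb fun i hi => (abs_sub _ _).trans (by linarith [(hω i hi).2, hWb i hi])) (abs_nonneg l)
      refine (setIntegral_le_integral hint (Filter.Eventually.of_forall fun ω =>
        (Real.exp_pos _).le)).trans
        ((h.integral_exp_finiteRange_le hε he hq (hl hl').1 hN hv hle).trans ?_)
      refine le_trans (Real.exp_le_exp.2 ?_) (le_mul_of_one_le_left (Real.exp_pos _).le hexp1)
      nlinarith [mul_le_mul_of_nonneg_left hK2 (sq_nonneg l), mul_nonneg (sq_nonneg l) hK0])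
  have h3 := hpart (T := fun ω => ∑ i ∈ Finset.Icc 1 n, (X i ω - U i ω))
    (Finset.aestronglyMeasurable_fun_sum _ fun i hi => (hXa i hi).sub integrable_condExp.1)
    (by
      filter_upwards [hbd] with ω hω
      exact hb fun i hi => (abs_sub _ _).trans (by linarith [(hω i hi).1, (hω i hi).2]))
    (fun l hl' => by
      obtain ⟨a1, a2⟩ := hl hl'
      refine (h.setIntegral_exp_tail_le hε he q (q * q)
        (by nlinarith [sq_nonneg (l * (M * q))])).trans ?_
      exact le_mul_of_one_le_right (Real.exp_pos _).le (Real.one_le_exp (by positivity)))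
  have hsub : {ω | 3 * t < |∑ i ∈ Finset.Icc 1 n, (W i ω - ∫ ω', W i ω' ∂P)|} ∩ B
      ⊆ ({ω | t < |∑ i ∈ Finset.Icc 1 n, (W i ω - X i ω)|} ∩ B)
        ∪ (({ω | t < |∑ i ∈ Finset.Icc 1 n, (U i ω - ∫ ω', W i ω' ∂P)|} ∩ B)
        ∪ ({ω | t < |∑ i ∈ Finset.Icc 1 n, (X i ω - U i ω)|} ∩ B)) := by
    rintro ω ⟨hω, hωB⟩
    by_contra hcon
    simp only [Set.mem_union, Set.mem_inter_iff, hωB, and_true, not_or, Set.mem_ofPred_eq,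
      not_lt] at hcon hω
    obtain ⟨a1, a2, a3⟩ := hcon
    have e : ∑ i ∈ Finset.Icc 1 n, (W i ω - ∫ ω', W i ω' ∂P)
        = ∑ i ∈ Finset.Icc 1 n, (W i ω - X i ω)
          + ∑ i ∈ Finset.Icc 1 n, (U i ω - ∫ ω', W i ω' ∂P)
          + ∑ i ∈ Finset.Icc 1 n, (X i ω - U i ω) := by
      rw [← Finset.sum_add_distrib, ← Finset.sum_add_distrib]
      exact Finset.sum_congr rfl fun i _ => by ring
    rw [e] at hω
    have := abs_add_three (∑ i ∈ Finset.Icc 1 n, (W i ω - X i ω))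
      (∑ i ∈ Finset.Icc 1 n, (U i ω - ∫ ω', W i ω' ∂P)) (∑ i ∈ Finset.Icc 1 n, (X i ω - U i ω))
    linarith
  calc _ ≤ _ := measureReal_mono hsub
    _ ≤ _ := (measureReal_union_le _ _).trans
      (add_le_add_right (measureReal_union_le _ _) _)
    _ ≤ _ := by linarith

end Bernstein

/-! ### The weights -/

section Weights

lemma one_le_omegaFactor {ν : ℝ} (hν : 0 ≤ ν) {j : ℕ} (hj : 1 ≤ j) : 1 ≤ omegaFactor ν j := by
  have hj1 : (1 : ℝ) ≤ j := by exact_mod_cast hj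
  have h1 : 1 ≤ Real.log (Real.exp 1 * j) := by
    rw [Real.log_mul (Real.exp_pos 1).ne' (by positivity), Real.log_exp]
    linarith [Real.log_nonneg hj1]
  exact one_le_mul_of_one_le_of_one_le (Real.one_le_rpow hj1 (by positivity))
    (Real.one_le_rpow h1 (by norm_num))

lemma logLog_mono {j k : ℕ} (hj : 1 ≤ j) (hjk : j ≤ k) : logLog j ≤ logLog k := by
  have hj1 : (1 : ℝ) ≤ j := by exact_mod_cast hj
  have hjk1 : (j : ℝ) ≤ k := by exact_mod_cast hjk
  have h1 : 1 ≤ Real.exp (Real.exp 1) := Real.one_le_exp (Real.exp_pos 1).le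
  have h2 : Real.exp (Real.exp 1) ≤ Real.exp (Real.exp 1) * j :=
    le_mul_of_one_le_right (by positivity) hj1
  refine Real.log_le_log (Real.log_pos ?_) (Real.log_le_log (by positivity) ?_)
  · exact (Real.one_lt_exp_iff.2 (Real.exp_pos 1)).trans_le h2
  · exact mul_le_mul_of_nonneg_left hjk1 (by positivity)

lemma one_le_logLog {j : ℕ} (hj : 1 ≤ j) : 1 ≤ logLog j := by
  have h1 : logLog 1 = 1 := by simp [logLog]
  rw [← h1]
  exact logLog_mono le_rfl hj

lemma le_Phi {q : ℕ} (hq : 1 ≤ q) : (q : ℝ) ≤ Phi q :=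
  le_mul_of_one_le_right (Nat.cast_nonneg q) (one_le_logLog hq)

variable {ν : ℝ} {Δ : ℕ → ℝ}

lemma weighted_nonneg (hν : 0 ≤ ν) (hΔ : ∀ k, 0 ≤ Δ k) {j : ℕ} (hj : 1 ≤ j) :
    0 ≤ Δ j * omegaFactor ν j * logLog j :=
  mul_nonneg (mul_nonneg (hΔ j) (zero_le_one.trans (one_le_omegaFactor hν hj)))
    (zero_le_one.trans (one_le_logLog hj))

lemma mul_logLog_le_weighted (hν : 0 ≤ ν) (hΔ : ∀ k, 0 ≤ Δ k) {q j : ℕ} (hq : 1 ≤ q)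
    (hqj : q ≤ j) : logLog q * Δ j ≤ Δ j * omegaFactor ν j * logLog j := by
  have h1 := one_le_omegaFactor hν (hq.trans hqj)
  have h2 := logLog_mono hq hqj
  have h3 := one_le_logLog hq
  calc logLog q * Δ j = Δ j * 1 * logLog q := by ring
    _ ≤ Δ j * omegaFactor ν j * logLog j :=
      mul_le_mul (mul_le_mul_of_nonneg_left h1 (hΔ j)) h2 (by linarith)
        (mul_nonneg (hΔ j) (by linarith))

lemma summable_weighted_add
    (hs : Summable fun j : ℕ => Δ (j + 1) * omegaFactor ν (j + 1) * logLog (j + 1)) {q : ℕ}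
    (hq : 1 ≤ q) : Summable fun j : ℕ => Δ (q + j) * omegaFactor ν (q + j) * logLog (q + j) := by
  obtain ⟨k, rfl⟩ := Nat.exists_eq_add_of_le' hq
  refine ((summable_nat_add_iff k).2 hs).congr fun j => ?_
  have e : j + k + 1 = k + 1 + j := by ring
  rw [e]

lemma betaTilde_eq_add
    (hs : Summable fun j : ℕ => Δ (j + 1) * omegaFactor ν (j + 1) * logLog (j + 1)) {q : ℕ}
    (hq : 1 ≤ q) :
    betaTilde ν Δ q = Δ q * omegaFactor ν q * logLog q + betaTilde ν Δ (q + 1) := by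
  rw [betaTilde, (summable_weighted_add hs hq).tsum_eq_zero_add, betaTilde]
  congr 1
  refine tsum_congr fun j => ?_
  have e : q + (j + 1) = q + 1 + j := by ring
  rw [e]

lemma betaTilde_nonneg (hν : 0 ≤ ν) (hΔ : ∀ k, 0 ≤ Δ k) {q : ℕ} (hq : 1 ≤ q) :
    0 ≤ betaTilde ν Δ q :=
  tsum_nonneg fun j => weighted_nonneg hν hΔ (hq.trans (Nat.le_add_right q j))

lemma betaTilde_succ_le (hν : 0 ≤ ν) (hΔ : ∀ k, 0 ≤ Δ k)
    (hs : Summable fun j : ℕ => Δ (j + 1) * omegaFactor ν (j + 1) * logLog (j + 1)) {q : ℕ}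
    (hq : 1 ≤ q) : betaTilde ν Δ (q + 1) ≤ betaTilde ν Δ q := by
  rw [betaTilde_eq_add hs hq]
  linarith [weighted_nonneg hν hΔ hq]

lemma betaTilde_le_one (hν : 0 ≤ ν) (hΔ : ∀ k, 0 ≤ Δ k)
    (hs : Summable fun j : ℕ => Δ (j + 1) * omegaFactor ν (j + 1) * logLog (j + 1)) {q : ℕ}
    (hq : 1 ≤ q) : betaTilde ν Δ q ≤ betaTilde ν Δ 1 := by
  induction q, hq using Nat.le_induction with
  | base => exact le_rfl
  | succ k hk ih => exact (betaTilde_succ_le hν hΔ hs hk).trans ih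

lemma summable_tail (hν : 0 ≤ ν) (hΔ : ∀ k, 0 ≤ Δ k)
    (hs : Summable fun j : ℕ => Δ (j + 1) * omegaFactor ν (j + 1) * logLog (j + 1)) {q : ℕ}
    (hq : 1 ≤ q) : Summable fun j => Δ (q + 1 + j) := by
  refine Summable.of_nonneg_of_le (fun j => hΔ _) (fun j => ?_)
    (summable_weighted_add hs (q := q + 1) (by omega))
  have h1 := mul_logLog_le_weighted hν hΔ (q := q + 1) (j := q + 1 + j) (by omega) (by omega)
  have h2 := one_le_logLog (j := q + 1) (by omega)
  nlinarith [hΔ (q + 1 + j)]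

/-- The factor `ℒ` in `β̃` and in `Φ` cancels. -/
lemma tsum_tail_div_le (hν : 0 ≤ ν) (hΔ : ∀ k, 0 ≤ Δ k)
    (hs : Summable fun j : ℕ => Δ (j + 1) * omegaFactor ν (j + 1) * logLog (j + 1)) {q : ℕ}
    (hq : 1 ≤ q) : (∑' j, Δ (q + 1 + j)) / q ≤ betaTilde ν Δ q / Phi q := by
  have hL := one_le_logLog hq
  have hq0 : (0 : ℝ) < q := by exact_mod_cast hq
  have h1 : logLog q * ∑' j, Δ (q + 1 + j) ≤ betaTilde ν Δ q := by
    rw [← tsum_mul_left]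
    refine le_trans (Summable.tsum_le_tsum (fun j => ?_) ((summable_tail hν hΔ hs hq).mul_left _)
      (summable_weighted_add hs (q := q + 1) (by omega))) (betaTilde_succ_le hν hΔ hs hq)
    exact mul_logLog_le_weighted hν hΔ hq (by omega)
  rw [Phi, div_le_div_iff₀ hq0 (by positivity)]
  nlinarith [mul_le_mul_of_nonneg_right h1 hq0.le]

lemma sum_min_le_VTilde (hν : 0 ≤ ν) (hΔ : ∀ k, 0 ≤ Δ k)
    (hs : Summable fun j : ℕ => Δ (j + 1) * omegaFactor ν (j + 1) * logLog (j + 1)) {Dn a : ℝ}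
    (hD : 0 ≤ Dn) (ha : 0 ≤ a) (q : ℕ) :
    a + ∑ k ∈ Finset.range q, min a (Dn * Δ (k + 1)) ≤ VTilde ν Δ Dn a := by
  have hω : ∀ j : ℕ, 1 ≤ omegaFactor ν (j + 1) := fun j => one_le_omegaFactor hν (by omega)
  have hL : ∀ j : ℕ, 1 ≤ logLog (j + 1) := fun j => one_le_logLog (by omega)
  have hnn : ∀ j : ℕ, 0 ≤ Dn * Δ (j + 1) * omegaFactor ν (j + 1) := fun j =>
    mul_nonneg (mul_nonneg hD (hΔ _)) (zero_le_one.trans (hω j))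
  have hterm : ∀ j : ℕ, 0 ≤ min a (Dn * Δ (j + 1) * omegaFactor ν (j + 1)) * logLog (j + 1) :=
    fun j => mul_nonneg (le_min ha (hnn j)) (zero_le_one.trans (hL j))
  have hsum : Summable fun j : ℕ =>
      min a (Dn * Δ (j + 1) * omegaFactor ν (j + 1)) * logLog (j + 1) := by
    refine Summable.of_nonneg_of_le hterm (fun j => ?_) (hs.mul_left Dn)
    calc _ ≤ Dn * Δ (j + 1) * omegaFactor ν (j + 1) * logLog (j + 1) :=
          mul_le_mul_of_nonneg_right (min_le_right _ _) (zero_le_one.trans (hL j))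
      _ = _ := by ring
  refine add_le_add le_rfl (le_trans (Finset.sum_le_sum fun k _ => ?_)
    (hsum.sum_le_tsum (Finset.range q) fun j _ => hterm j))
  have h1 : min a (Dn * Δ (k + 1)) ≤ min a (Dn * Δ (k + 1) * omegaFactor ν (k + 1)) :=
    min_le_min le_rfl (le_mul_of_one_le_right (mul_nonneg hD (hΔ _)) (hω k))
  exact h1.trans (le_mul_of_one_le_right (le_min ha (hnn k)) (hL k))

/-- The set that defines `q̃*` is nonempty, since `β̃` is bounded and `Φ` is not. -/
lemma qStar_spec (hν : 0 ≤ ν) (hΔ : ∀ k, 0 ≤ Δ k)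
    (hs : Summable fun j : ℕ => Δ (j + 1) * omegaFactor ν (j + 1) * logLog (j + 1)) {z : ℝ}
    (hz : 0 < z) :
    1 ≤ qStar ν Δ z ∧ betaTilde ν Δ (qStar ν Δ z) / Phi (qStar ν Δ z) ≤ z := by
  have hne : {q : ℕ | 1 ≤ q ∧ betaTilde ν Δ q ≤ Phi q * z}.Nonempty := by
    obtain ⟨k, hk⟩ := exists_nat_ge (betaTilde ν Δ 1 / z)
    have hk1 : 1 ≤ k + 1 := by omega
    refine ⟨k + 1, hk1, (betaTilde_le_one hν hΔ hs hk1).trans ?_⟩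
    rw [div_le_iff₀ hz] at hk
    refine hk.trans (mul_le_mul_of_nonneg_right (le_trans ?_ (le_Phi hk1)) hz.le)
    push_cast; linarith
  obtain ⟨h1, h2⟩ := Nat.sInf_mem hne
  refine ⟨h1, ?_⟩
  have hΦ : 0 < Phi (qStar ν Δ z) :=
    lt_of_lt_of_le (by exact_mod_cast h1) (le_Phi h1)
  rw [div_le_iff₀ hΦ]
  exact h2.trans_eq (mul_comm _ _)

end Weights

/-! ### The weighted function class -/

section Assembly

/-- The value `D_n^∞(i/n)`; the supremum is finite under `EnvelopeWeightBound`. -/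
noncomputable def envelopeWeight {d : ℕ} (F : Set (Fn d)) (D : Fn d → unitInterval → ℝ) (n i : ℕ) :
    ℝ :=
  (⨆ f ∈ F, ENNReal.ofReal |D f (gridPoint n i)|).toReal

lemma EnvelopeWeightBound.sum_le {d n : ℕ} {F : Set (Fn d)} {D : Fn d → unitInterval → ℝ}
    {Dinf : ℝ} (h : EnvelopeWeightBound F D n Dinf) (hn : 1 ≤ n) :
    ∑ i ∈ Finset.Icc 1 n, (⨆ f ∈ F, ENNReal.ofReal |D f (gridPoint n i)|) ^ 2
      ≤ n * ENNReal.ofReal Dinf ^ 2 := by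
  have h1 := ENNReal.rpow_le_rpow h (z := 2) (by norm_num)
  rw [← ENNReal.rpow_mul, show (1 / 2 : ℝ) * 2 = 1 by norm_num, ENNReal.rpow_one,
    ENNReal.rpow_ofNat, mul_comm, ← div_eq_mul_inv] at h1
  rw [mul_comm]
  exact (ENNReal.div_le_iff_le_mul (Or.inl (by exact_mod_cast (by omega : n ≠ 0)))
    (Or.inl (ENNReal.natCast_ne_top n))).1 h1

lemma EnvelopeWeightBound.abs_le {d n : ℕ} {F : Set (Fn d)} {D : Fn d → unitInterval → ℝ}
    {Dinf : ℝ} (h : EnvelopeWeightBound F D n Dinf) (hn : 1 ≤ n) {f : Fn d} (hf : f ∈ F) {i : ℕ}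
    (hi : i ∈ Finset.Icc 1 n) : |D f (gridPoint n i)| ≤ envelopeWeight F D n i := by
  have h1 : (⨆ f ∈ F, ENNReal.ofReal |D f (gridPoint n i)|) ^ 2 ≤ n * ENNReal.ofReal Dinf ^ 2 :=
    (Finset.single_le_sum (f := fun i => (⨆ f ∈ F, ENNReal.ofReal |D f (gridPoint n i)|) ^ 2)
      (fun _ _ => bot_le) hi).trans (h.sum_le hn)
  have h2 : (⨆ f ∈ F, ENNReal.ofReal |D f (gridPoint n i)|) ≠ ⊤ := by
    intro htop
    rw [htop] at h1
    exact absurd h1 (not_le.2 (by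
      rw [ENNReal.top_pow two_ne_zero]
      exact ENNReal.mul_lt_top (ENNReal.natCast_lt_top n) (by finiteness)))
  rw [envelopeWeight, ← ENNReal.ofReal_le_iff_le_toReal h2]
  exact le_iSup₂_of_le f hf le_rfl

lemma EnvelopeWeightBound.sum_sq_le {d n : ℕ} {F : Set (Fn d)} {D : Fn d → unitInterval → ℝ}
    {Dinf : ℝ} (h : EnvelopeWeightBound F D n Dinf) (hn : 1 ≤ n) (hD : 0 ≤ Dinf) :
    ∑ i ∈ Finset.Icc 1 n, envelopeWeight F D n i ^ 2 ≤ n * Dinf ^ 2 := by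
  have hfin : n * ENNReal.ofReal Dinf ^ 2 ≠ ⊤ :=
    (ENNReal.mul_lt_top (ENNReal.natCast_lt_top n) (by finiteness)).ne
  have h1 := ENNReal.toReal_mono hfin (h.sum_le hn)
  rw [ENNReal.toReal_mul, ENNReal.toReal_natCast, ENNReal.toReal_pow,
    ENNReal.toReal_ofReal hD, ENNReal.toReal_sum fun i hi => ?_] at h1
  · simpa only [ENNReal.toReal_pow, envelopeWeight] using h1
  · exact ne_top_of_le_ne_top hfin ((Finset.single_le_sum
      (f := fun i => (⨆ f ∈ F, ENNReal.ofReal |D f (gridPoint n i)|) ^ 2)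
      (fun _ _ => bot_le) hi).trans (h.sum_le hn))

variable {Ω : Type*} {dt d dO : ℕ} [MeasurableSpace Ω] {P : Measure Ω} [IsProbabilityMeasure P]
  {n : ℕ} {ε : ℤ → Ω → Fin dt → ℝ} {J : ℤ → Seq dt → Fin d → ℝ} {F : Set (Fn d)}
  {D : Fn d → unitInterval → ℝ} {fbar : Fn d → Fn d} {M ν Dn Dinf : ℝ} {Δ : ℕ → ℝ}
  {JO : ℤ → Seq dt → Fin dO → ℝ} {mu : ℕ → Fn d → ℕ → Fn dO} {L : ℕ → ℝ} {s : ℝ} {R : Fn dO}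
  {CR Cf : ℝ} {p : ℝ≥0∞} {CX Cβ : ℝ}

lemma isEnvelope (hε : IsInnovation P ε) (hΔ : ∀ k, 0 ≤ Δ k)
    (hc : Compatibility P ε (bernoulliShift J ε) n F D fbar ν Δ Dn JO mu L s R CR Cf p CX) :
    IsEnvelope P n Δ (2 * CDelta dO L s CX CR Cf) (envelopeWeight F D n)
      (fun i k => couplingBound ε JO L s R (gridPoint n i) ((i : ℤ) - 1) k)
      (fun i k => couplingBoundSq ε JO L s R CR Cf (gridPoint n i) ((i : ℤ) - 1) k) := by
  have hsm := hc.smooth 1 (by simp)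
  have hψ : ∀ (i k : ℕ) w, 0 ≤ couplingBound ε JO L s R (gridPoint n i) ((i : ℤ) - 1) k w :=
    fun i k w => mul_nonneg ENNReal.toReal_nonneg (add_nonneg (hsm.R_nonneg _ _) (hsm.R_nonneg _ _))
  have hsize : ∀ u z, 0 ≤ sizeBound L s R CR Cf u z := fun u z =>
    add_nonneg hsm.Cf_pos.le (mul_nonneg ENNReal.toReal_nonneg
      (add_nonneg (hsm.R_nonneg _ _) hsm.CR_pos.le))
  exact
    { weight_nonneg := fun i => ENNReal.toReal_nonneg
      Δ_nonneg := hΔ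
      C_nonneg := mul_nonneg zero_le_two (hsm.CDelta_nonneg hc.CX_pos)
      ψ_measurable := fun i k =>
        measurable_couplingBound hε.measurable hc.JO_measurable hsm.R_measurable _ _ _
      χ_measurable := fun i k =>
        measurable_couplingBoundSq hε.measurable hc.JO_measurable hsm.R_measurable _ _ _
      ψ_nonneg := hψ
      χ_nonneg := fun i k w => mul_nonneg (hψ i k w) (add_nonneg (hsize _ _) (hsize _ _))
      ψ_le := fun i hi k => eLpNorm_couplingBound_le hε hc hi _ k
      χ_le := fun i hi k => eLpNorm_couplingBoundSq_le hε hc hi _ k }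

lemma isDominated (hn : 1 ≤ n) (hε : IsInnovation P ε) (hJ : ∀ i, Measurable (J i)) (hM : 0 < M)
    (hF : IsFunctionClass F D fbar M) (hD : EnvelopeWeightBound F D n Dinf)
    (hc : Compatibility P ε (bernoulliShift J ε) n F D fbar ν Δ Dn JO mu L s R CR Cf p CX)
    {f : Fn d} (hf : f ∈ F) :
    IsDominated P ε n M (envelopeWeight F D n)
      (fun i k => couplingBound ε JO L s R (gridPoint n i) ((i : ℤ) - 1) k)
      (fun i k => couplingBoundSq ε JO L s R CR Cf (gridPoint n i) ((i : ℤ) - 1) k)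
      (fun i => |D f (gridPoint n i)|)
      (fun i ω => f (past (bernoulliShift J ε) i ω) (gridPoint n i))
      (fun i e => D f (gridPoint n i)
        * cutMu JO L s (mu 1 f i) (gridPoint n i) ((i : ℤ) - 1) e)
      (fun i e => (D f (gridPoint n i)
        * cutMu JO L s (mu 2 f i) (gridPoint n i) ((i : ℤ) - 1) e) ^ 2) where
  M_pos := hM
  W_measurable i _ := by
    have h1 : Measurable fun e : Seq dt => f (shiftPast J i e) (gridPoint n i) :=
      (hF.measurable f hf).comp ((measurable_shiftPast hJ i).prodMk measurable_const)
    simp only [past_bernoulliShift]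
    exact (h1.comp (measurable_past_sig ε _)).stronglyMeasurable
  W_bdd i _ ω := hF.bounded f hf _ _
  H_measurable i hi :=
    ((hc.smooth 1 (by simp)).measurable_cutMu hc.JO_measurable ⟨f, hf, i, hi, rfl⟩ _ _).const_mul _
  G_measurable i hi :=
    (((hc.smooth 2 (by simp)).measurable_cutMu hc.JO_measurable ⟨f, hf, i, hi, rfl⟩ _
      _).const_mul _).pow_const 2
  H_eq i hi := by
    simpa only [pow_one] using
      cutMu_pow_eq_condExp hε hF hc (κ := 1) (by simp) hf hi (gridPoint n i)
  G_eq i hi := cutMu_pow_eq_condExp hε hF hc (κ := 2) (by simp) hf hi (gridPoint n i)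
  d_nonneg i := abs_nonneg _
  d_le i hi := hD.abs_le hn hf hi
  H_sub i hi k := by
    filter_upwards [abs_cutMu_sub_le hε hc (κ := 1) (by simp) hf hi (gridPoint n i) k] with w hw
    rw [← mul_sub, abs_mul]
    exact mul_le_mul_of_nonneg_left hw (abs_nonneg _)
  G_sub i hi k := by
    filter_upwards [abs_cutMu_sq_sub_le hε hc (κ := 2) (by simp) hf hi (gridPoint n i) k] with w hw
    rw [mul_pow, mul_pow, ← mul_sub, abs_mul, abs_pow]
    exact mul_le_mul_of_nonneg_left hw (sq_nonneg _)

/-- The event on which the Bernstein inequality holds for all functions of the class. -/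
def bernsteinEvent (P : Measure Ω) (ε : ℤ → Ω → Fin dt → ℝ) (n : ℕ) (F : Set (Fn d))
    (D : Fn d → unitInterval → ℝ) (M : ℝ) (JO : ℤ → Seq dt → Fin dO → ℝ) (L : ℕ → ℝ) (s : ℝ)
    (R : Fn dO) (CR Cf : ℝ) (q : ℕ) : Set Ω :=
  goodEvent P ε n q (q * q) (2 * M * q) (envelopeWeight F D n)
    (fun i k => couplingBound ε JO L s R (gridPoint n i) ((i : ℤ) - 1) k)
    (fun i k => couplingBoundSq ε JO L s R CR Cf (gridPoint n i) ((i : ℤ) - 1) k)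

/-- The bound for the good event with `r = q²`; the tail sum of `Δ` at `q²` is estimated by the
submultiplicativity of `β̃ / Φ`. -/
lemma measureReal_compl_bernsteinEvent_le (hn : 1 ≤ n) (hε : IsInnovation P ε) (hM : 0 < M)
    (hΔ : ∀ k, 0 ≤ Δ k) (hDi : 0 ≤ Dinf) (hD : EnvelopeWeightBound F D n Dinf)
    (hc : Compatibility P ε (bernoulliShift J ε) n F D fbar ν Δ Dn JO mu L s R CR Cf p CX)
    (hβ : Submultiplicative ν Δ Cβ) {q : ℕ} (hq : 1 ≤ q) :
    P.real (bernsteinEvent P ε n F D M JO L s R CR Cf q)ᶜ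
      ≤ (4 + CDelta dO L s CX CR Cf * Cβ)
        * (Real.sqrt n * Dinf / M * (betaTilde ν Δ q / Phi q)) ^ 2 := by
  have hν : 0 ≤ ν := by linarith [hc.two_le_nu]
  have hs := hβ.summable
  have hq0 : (0 : ℝ) < q := by exact_mod_cast hq
  have hqq : 1 ≤ q * q := Nat.mul_pos hq hq
  have hC := (hc.smooth 1 (by simp)).CDelta_nonneg hc.CX_pos
  have hCβ := hβ.const_pos
  have h1 := (isEnvelope hε hΔ hc).measureReal_compl_goodEvent_le hε.measurable
    (summable_tail hν hΔ hs hq) (summable_tail hν hΔ hs hqq) (c := 2 * M * q) (by positivity)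
  refine h1.trans ?_
  set b := ∑' j, Δ (q + 1 + j) with hb
  set b' := ∑' j, Δ (q * q + 1 + j) with hb'
  set ρ := betaTilde ν Δ q / Phi q with hρ
  set K := CDelta dO L s CX CR Cf
  have hb0 : 0 ≤ b := tsum_nonneg fun j => hΔ _
  have e1 : b ≤ ρ * q := (div_le_iff₀ hq0).1 (tsum_tail_div_le hν hΔ hs hq)
  have e2 : b' ≤ Cβ * ρ ^ 2 * q ^ 2 := by
    have h2 := (tsum_tail_div_le hν hΔ hs hqq).trans (hβ.submul q q hq hq)
    rw [div_le_iff₀ (by positivity)] at h2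
    refine h2.trans_eq ?_
    push_cast; ring
  have e3 : 2 * b ^ 2 + 2 * K * b' ≤ (2 + 2 * K * Cβ) * (ρ * q) ^ 2 := by
    have h2 := pow_le_pow_left₀ hb0 e1 2
    have h3 := mul_le_mul_of_nonneg_left e2 hC
    nlinarith
  have hE := hD.sum_sq_le hn hDi
  calc (2 * b ^ 2 + 2 * K * b') * (∑ i ∈ Finset.Icc 1 n, envelopeWeight F D n i ^ 2)
        / (2 * M * q) ^ 2
      ≤ ((2 + 2 * K * Cβ) * (ρ * q) ^ 2) * (n * Dinf ^ 2) / (2 * M * q) ^ 2 := by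
        refine div_le_div_of_nonneg_right (mul_le_mul e3 hE (Finset.sum_nonneg fun i _ =>
          sq_nonneg _) (by positivity)) (by positivity)
    _ = (1 / 2 + K * Cβ / 2) * (Real.sqrt n * Dinf / M * ρ) ^ 2 := by
        rw [mul_pow _ ρ, div_pow, mul_pow (Real.sqrt n), Real.sq_sqrt (Nat.cast_nonneg n)]
        field_simp
    _ ≤ _ := by
        refine mul_le_mul_of_nonneg_right ?_ (sq_nonneg _)
        nlinarith [mul_nonneg hC hCβ.le]

/-- The factor `6` counts two signs for each of the three parts of the sum. Every part receives a
third of `x √n`, so that `64` in the exponent becomes `64 · 9 = 576`. -/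
lemma measureReal_bbG_inter_le (hn : 1 ≤ n) (hε : IsInnovation P ε) (hJ : ∀ i, Measurable (J i))
    (hM : 0 < M) (hF : IsFunctionClass F D fbar M) (hΔ : ∀ k, 0 ≤ Δ k) (hDn : 0 ≤ Dn)
    (hD : EnvelopeWeightBound F D n Dinf)
    (hc : Compatibility P ε (bernoulliShift J ε) n F D fbar ν Δ Dn JO mu L s R CR Cf p CX)
    (hβ : Submultiplicative ν Δ Cβ) {q : ℕ} (hq : 1 ≤ q) {f : Fn d} (hf : f ∈ F) {x : ℝ}
    (hx : 0 < x) :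
    P.real ({ω | x < |bbG P (bernoulliShift J ε) n f ω|}
        ∩ bernsteinEvent P ε n F D M JO L s R CR Cf q)
      ≤ 6 * Real.exp 1 * Real.exp (-(1 / 576) * (x ^ 2 /
        (VTilde ν Δ Dn (norm2n P (bernoulliShift J ε) n f) ^ 2
          + M * Phi q / Real.sqrt n * x))) := by
  have hν : 0 ≤ ν := by linarith [hc.two_le_nu]
  have hn0 : (0 : ℝ) < n := by exact_mod_cast hn
  have hq0 : (0 : ℝ) < q := by exact_mod_cast hq
  set a := norm2n P (bernoulliShift J ε) n f with ha
  set V := VTilde ν Δ Dn a with hV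
  have ha0 : 0 ≤ a := Real.sqrt_nonneg _
  have hW : ∑ i ∈ Finset.Icc 1 n, ∫ ω, f (past (bernoulliShift J ε) i ω) (gridPoint n i) ^ 2 ∂P
      = n * a ^ 2 := by
    rw [ha, norm2n, Real.sq_sqrt]
    · field_simp
    · exact mul_nonneg (by positivity)
        (Finset.sum_nonneg fun i _ => integral_nonneg fun ω => sq_nonneg _)
  have hd : ∑ i ∈ Finset.Icc 1 n, |D f (gridPoint n i)| ^ 2 ≤ n * Dn ^ 2 := by
    have h1 := (Real.sqrt_le_left hDn).1 (hc.weight f hf)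
    rwa [one_div, inv_mul_le_iff₀ hn0] at h1
  set v : ℕ → ℝ := fun k => min a (Dn * Δ (k + 1)) with hv
  have hv0 : ∀ k, 0 ≤ v k := fun k => le_min ha0 (mul_nonneg hDn (hΔ _))
  have hV1 := sum_min_le_VTilde hν hΔ hβ.summable hDn ha0 q
  have hS0 : 0 ≤ ∑ k ∈ Finset.range q, v k := Finset.sum_nonneg fun k _ => hv0 k
  have haV : a ≤ V := by linarith
  have hSV : ∑ k ∈ Finset.range q, v k ≤ V := by linarith
  have hle : ∀ k, min (∑ i ∈ Finset.Icc 1 n,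
      ∫ ω, f (past (bernoulliShift J ε) i ω) (gridPoint n i) ^ 2 ∂P)
      (∑ i ∈ Finset.Icc 1 n, (|D f (gridPoint n i)| * Δ (k + 1)) ^ 2) ≤ n * v k ^ 2 := fun k => by
    simp only [hv]
    rcases le_total a (Dn * Δ (k + 1)) with h | h
    · rw [min_eq_left h]
      exact (min_le_left _ _).trans_eq hW
    · rw [min_eq_right h]
      refine (min_le_right _ _).trans ?_
      simp only [mul_pow, ← Finset.sum_mul]
      nlinarith [mul_le_mul_of_nonneg_right hd (sq_nonneg (Δ (k + 1)))]
  have hdom := isDominated hn hε hJ hM hF hD hc hf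
  have hsq : 0 < Real.sqrt n := Real.sqrt_pos.2 hn0
  have hsq2 : Real.sqrt n ^ 2 = n := Real.sq_sqrt hn0.le
  have hmain := hdom.measureReal_abs_sum_le hε (isEnvelope hε hΔ hc) hq hn0.le hv0 hle
    (K := n * V ^ 2) (hW.le.trans (mul_le_mul_of_nonneg_left (pow_le_pow_left₀ ha0 haV 2) hn0.le))
    (mul_le_mul_of_nonneg_left (pow_le_pow_left₀ hS0 hSV 2) hn0.le) (t := x * Real.sqrt n / 3)
    (by positivity)
  have hset : {ω | x < |bbG P (bernoulliShift J ε) n f ω|}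
      = {ω | 3 * (x * Real.sqrt n / 3) < |∑ i ∈ Finset.Icc 1 n,
        (f (past (bernoulliShift J ε) i ω) (gridPoint n i)
          - ∫ ω', f (past (bernoulliShift J ε) i ω') (gridPoint n i) ∂P)|} := by
    ext ω
    simp only [Set.mem_ofPred_eq, bbG]
    rw [abs_mul, abs_of_pos (one_div_pos.2 hsq), one_div, lt_inv_mul_iff₀ hsq]
    ring_nf
  rw [hset]
  refine hmain.trans (mul_le_mul_of_nonneg_left (Real.exp_le_exp.2 ?_) (by positivity))
  have hΦ := le_Phi hq
  have hden : 0 < M * q / Real.sqrt n * x := by positivity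
  have hmono : M * q / Real.sqrt n * x ≤ M * Phi q / Real.sqrt n * x := by gcongr
  have e : ∀ r : ℝ, 0 < r → (x * r / 3) ^ 2 / (64 * (r ^ 2 * V ^ 2) + 8 * M * q * (x * r / 3))
      = x ^ 2 / (576 * V ^ 2 + 24 * (M * q / r * x)) := fun r hr => by
    rw [div_eq_div_iff (by positivity) (by positivity)]
    field_simp
    ring
  have e' := e _ hsq
  rw [hsq2] at e'
  rw [e', neg_mul, neg_le_neg_iff, one_div, ← div_eq_inv_mul, div_div]
  refine div_le_div_of_nonneg_left (sq_nonneg x) (by positivity) ?_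
  nlinarith

end Assembly

end EmpProc

theorem mainTheorem10 :
    ∃ c₀ c₁ : ℝ, 0 < c₀ ∧ 0 < c₁ ∧
      ∀ (Ω : Type*) [MeasurableSpace Ω] (P : Measure Ω) [IsProbabilityMeasure P]
        (dt d dO n : ℕ) (ε : ℤ → Ω → Fin dt → ℝ) (J : ℤ → EmpProc.Seq dt → Fin d → ℝ)
        (F : Set (EmpProc.Fn d)) (D : EmpProc.Fn d → unitInterval → ℝ)
        (fbar : EmpProc.Fn d → EmpProc.Fn d) (M ν Dn Dinf : ℝ) (Δ : ℕ → ℝ)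
        (JO : ℤ → EmpProc.Seq dt → Fin dO → ℝ) (mu : ℕ → EmpProc.Fn d → ℕ → EmpProc.Fn dO)
        (L : ℕ → ℝ) (s : ℝ) (R : EmpProc.Fn dO) (CR Cf : ℝ) (p : ℝ≥0∞) (CX Cβ : ℝ),
        1 ≤ n → EmpProc.IsInnovation P ε → (∀ i, Measurable (J i)) →
        0 < M → EmpProc.IsFunctionClass F D fbar M →
        (∀ k, 0 ≤ Δ k) → Antitone Δ → 0 ≤ Dn →
        0 ≤ Dinf → EmpProc.EnvelopeWeightBound F D n Dinf →
        EmpProc.Compatibility P ε (EmpProc.bernoulliShift J ε) n F D fbar ν Δ Dn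
          JO mu L s R CR Cf p CX →
        EmpProc.Submultiplicative ν Δ Cβ →
        ∃ B : ℕ → Set Ω, (∀ q, MeasurableSet (B q)) ∧
          (∀ q ∈ Finset.Icc 1 n,
            (∀ f ∈ F, ∀ x : ℝ, 0 < x →
              P.real ({ω | x < |EmpProc.bbG P (EmpProc.bernoulliShift J ε) n f ω|} ∩ B q)
                ≤ c₀ * Real.exp (-(1 / c₁) * (x ^ 2 /
                  (EmpProc.VTilde ν Δ Dn (EmpProc.norm2n P (EmpProc.bernoulliShift J ε) n f) ^ 2
                    + M * EmpProc.Phi q / Real.sqrt n * x)))) ∧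
            P.real (B q)ᶜ ≤ (4 + EmpProc.CDelta dO L s CX CR Cf * Cβ)
              * (Real.sqrt n * Dinf / M * (EmpProc.betaTilde ν Δ q / EmpProc.Phi q)) ^ 2) ∧
          (0 < Dinf → ∀ y : ℝ, 0 < y →
            (∀ f ∈ F, ∀ x : ℝ, 0 < x →
              P.real ({ω | x < |EmpProc.bbG P (EmpProc.bernoulliShift J ε) n f ω|}
                  ∩ B (EmpProc.qStar ν Δ (M / (Real.sqrt n * Dinf * y))))
                ≤ c₀ * Real.exp (-(1 / c₁) * (x ^ 2 /
                  (EmpProc.VTilde ν Δ Dn (EmpProc.norm2n P (EmpProc.bernoulliShift J ε) n f) ^ 2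
                    + EmpProc.Phi (EmpProc.qStar ν Δ (M / (Real.sqrt n * Dinf * y)))
                      * (M * x / Real.sqrt n))))) ∧
            P.real (B (EmpProc.qStar ν Δ (M / (Real.sqrt n * Dinf * y))))ᶜ
              ≤ (4 + EmpProc.CDelta dO L s CX CR Cf * Cβ) / y ^ 2) := by
  refine ⟨6 * Real.exp 1, 576, by positivity, by norm_num, ?_⟩
  intro Ω _ P _ dt d dO n ε J F D fbar M ν Dn Dinf Δ JO mu L s R CR Cf p CX Cβ hn hε hJ hM hF hΔ _
    hDn hDi hD hc hβ
  have hν : 0 ≤ ν := by linarith [hc.two_le_nu]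
  have hn0 : (0 : ℝ) < n := by exact_mod_cast hn
  have hC := (hc.smooth 1 (by simp)).CDelta_nonneg hc.CX_pos
  have hCβ := hβ.const_pos
  refine ⟨EmpProc.bernsteinEvent P ε n F D M JO L s R CR Cf,
    fun q => EmpProc.measurableSet_goodEvent hε.measurable _ _ _ _ _ _ _, fun q hq => ?_,
    fun hDi' y hy => ?_⟩
  · have hq1 := (Finset.mem_Icc.1 hq).1
    exact ⟨fun f hf x hx =>
        EmpProc.measureReal_bbG_inter_le hn hε hJ hM hF hΔ hDn hD hc hβ hq1 hf hx,
      EmpProc.measureReal_compl_bernsteinEvent_le hn hε hM hΔ hDi hD hc hβ hq1⟩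
  · have hsq : 0 < Real.sqrt n := Real.sqrt_pos.2 hn0
    have hz : 0 < M / (Real.sqrt n * Dinf * y) := by positivity
    obtain ⟨hq1, hq2⟩ := EmpProc.qStar_spec hν hΔ hβ.summable hz
    set q := EmpProc.qStar ν Δ (M / (Real.sqrt n * Dinf * y))
    refine ⟨fun f hf x hx => ?_, ?_⟩
    · have e : EmpProc.Phi q * (M * x / Real.sqrt n)
          = M * EmpProc.Phi q / Real.sqrt n * x := by ring
      rw [e]
      exact EmpProc.measureReal_bbG_inter_le hn hε hJ hM hF hΔ hDn hD hc hβ hq1 hf hx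
    · refine (EmpProc.measureReal_compl_bernsteinEvent_le hn hε hM hΔ hDi hD hc hβ hq1).trans ?_
      have hρ : 0 ≤ EmpProc.betaTilde ν Δ q / EmpProc.Phi q :=
        div_nonneg (EmpProc.betaTilde_nonneg hν hΔ hq1)
          ((Nat.cast_nonneg q).trans (EmpProc.le_Phi hq1))
      have h1 : Real.sqrt n * Dinf / M * (EmpProc.betaTilde ν Δ q / EmpProc.Phi q) ≤ 1 / y := by
        refine (mul_le_mul_of_nonneg_left hq2 (by positivity)).trans_eq ?_
        field_simp
      rw [div_eq_mul_one_div _ (y ^ 2), ← one_div_pow]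
      exact mul_le_mul_of_nonneg_left (pow_le_pow_left₀ (by positivity) h1 2) (by positivity)
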